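/- Let $n\ge 3$ and let $X\subset\mathbb P^{n+2}=\mathbb P(V)$, $V=\mathbb C^{n+3}$, be a nonsingular intersection of two quadric hypersurfaces $\varphi_1=\varphi_2=0$ (that is, $d\varphi_1,d\varphi_2$ are linearly independent at every point of $X$), where $\varphi_1,\varphi_2$ are nondegenerate quadratic forms on $V$. For $x\in X$ let $II_{X,x}$ be the projective second fundamental form of $X$ at $x$, i.e. the linear system of quadratic forms on $T_xX$ given by the derivative at $x$ of the Gauss map. A pencil (a line in the projective space of quadratic forms on an $n$-dimensional complex vector space) is called nonsingular if its general element is nondegenerate and it contains exactly $n$ degenerate elements. Let $\mathcal M_n$ be the moduli space of nonsingular pencils on an $n$-dimensional vector space, i.e. the orbit space of nonsingular pencils modulo linear automorphisms, with its structure of a geometric quotient (its topology is the quotient of the Zariski topology, its regular functions are the invariant regular functions). Let $X^o\subset X$ be the set of points at which $II_{X,x}$ is a nonsingular pencil, and let $\mu^X:X^o\to\mathcal M_n$, $x\mapsto[II_{X,x}]$, be the moduli map of second fundamental forms. A point $x\in X$ is called regular, $x\in X^{\mathrm{reg}}$, if (i) all coordinates of $x$ are nonzero in a basis of $V$ in which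 $\varphi_1=\sum_i\lambda_iz_i^2$ and $\varphi_2=\sum_iz_i^2$ with distinct nonzero $\lambda_1,\dots,\lambda_{n+3}\in\mathbb C$; (ii) $II_{X,x}$ is a nonsingular pencil, i.e. $x\in X^o$; (iii) the identity is the only projective automorphism of the projective line $II_{X,x}$ which preserves its set of degenerate elements; (iv) the quadratic forms on $T_xX$ induced by $\varphi_1$ and $\varphi_2$ are nondegenerate. Then for every $x\in X^{\mathrm{reg}}$ the fiber $(\mu^X)^{-1}(\mu^X(x))\subset X^o$ is of pure dimension three and is smooth at $x$, and the kernel $\ker(d_x\mu^X)$ of the derivative $d_x\mu^X:T_xX\to T_{\mu^X(x)}\mathcal M_n$ is a three-dimensional linear subspace of $T_xX$. -/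

import Mathlib

open scoped LinearAlgebra.Projectivization

noncomputable section

namespace QuadricPencil

/-! ### Quadratic forms and pencils of quadratic forms -/

section Pencils

variable {W W' : Type*} [AddCommGroup W] [Module ℂ W] [AddCommGroup W'] [Module ℂ W']

/-- A quadratic form is degenerate if some nonzero vector is orthogonal to the whole space
with respect to the associated symmetric bilinear form `B_q`, where `B_q u u = q u`. -/
def IsDegenerate (q : QuadraticForm ℂ W) : Prop :=
  ∃ u : W, u ≠ 0 ∧ ∀ v : W, QuadraticMap.associated q u v = 0

/-- Pull-back of quadratic forms along a linear map: `(h^* q) u = q (h u)`. -/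
def pullback (h : W →ₗ[ℂ] W') : QuadraticForm ℂ W' →ₗ[ℂ] QuadraticForm ℂ W where
  toFun q := q.comp h
  map_add' _ _ := rfl
  map_smul' _ _ := rfl

theorem pullback_apply (h : W →ₗ[ℂ] W') (q : QuadraticForm ℂ W') (u : W) :
    pullback h q u = q (h u) :=
  rfl

/-- The points of intersection of the projectivization of `Φ` with the hypersurface of degenerate
forms; a point is given as a one-dimensional subspace. -/
def degeneratePoints (Φ : Submodule ℂ (QuadraticForm ℂ W)) :
    Set (Submodule ℂ (QuadraticForm ℂ W)) :=
  {L | Module.finrank ℂ L = 1 ∧ L ≤ Φ ∧ ∀ q ∈ L, IsDegenerate q}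

/-- `Φ` is (the linear span of) a nonsingular pencil of quadratic forms on the `n`-dimensional
vector space `W`: a line in the projective space of quadratic forms which contains a
nondegenerate form (so that its general element is nondegenerate) and which meets the
hypersurface of degenerate forms in `n` distinct points. -/
structure IsNonsingularPencil (n : ℕ) (Φ : Submodule ℂ (QuadraticForm ℂ W)) : Prop where
  finiteDimensional : FiniteDimensional ℂ W
  finrank_space : Module.finrank ℂ W = n
  finrank_eq : Module.finrank ℂ Φ = 2
  nondegenerate : ∃ q ∈ Φ, ¬ IsDegenerate q
  encard_degenerate : (degeneratePoints Φ).encard = n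

/-- The only projective automorphism of the projective line of `Φ` which preserves the set of
degenerate elements is the identity. -/
def HasTrivialAutomorphisms (Φ : Submodule ℂ (QuadraticForm ℂ W)) : Prop :=
  ∀ g : Φ ≃ₗ[ℂ] Φ,
    (∀ q : Φ, IsDegenerate (g q : QuadraticForm ℂ W) ↔ IsDegenerate (q : QuadraticForm ℂ W)) →
      ∃ a : ℂ, ∀ q : Φ, g q = a • q

theorem pullback_injective (h : W ≃ₗ[ℂ] W') :
    Function.Injective (pullback (h : W →ₗ[ℂ] W')) := by
  intro q q' hq
  ext u
  have := congrArg (fun r : QuadraticForm ℂ W => r (h.symm u)) hq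
  simpa [pullback_apply] using this

theorem isDegenerate_pullback (h : W ≃ₗ[ℂ] W') (q : QuadraticForm ℂ W') :
    IsDegenerate (pullback (h : W →ₗ[ℂ] W') q) ↔ IsDegenerate q := by
  have key : ∀ u v, QuadraticMap.associated (pullback (h : W →ₗ[ℂ] W') q) u v =
      QuadraticMap.associated q (h u) (h v) := by
    intro u v
    simp [pullback_apply, QuadraticMap.associated_apply]
  constructor
  · rintro ⟨u, hu, H⟩
    refine ⟨h u, by simpa using hu, fun v => ?_⟩
    have := H (h.symm v)
    rw [key] at this
    simpa using this
  · rintro ⟨u, hu, H⟩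
    refine ⟨h.symm u, by simpa using hu, fun v => ?_⟩
    rw [key]
    simpa using H (h v)

theorem degeneratePoints_pullback (h : W ≃ₗ[ℂ] W') (Φ : Submodule ℂ (QuadraticForm ℂ W')) :
    degeneratePoints (Φ.map (pullback (h : W →ₗ[ℂ] W'))) =
      Submodule.map (pullback (h : W →ₗ[ℂ] W')) '' degeneratePoints Φ := by
  have hinj := pullback_injective h
  ext L
  constructor
  · rintro ⟨h1, h2, h3⟩
    have hL : (L.comap (pullback (h : W →ₗ[ℂ] W'))).map (pullback (h : W →ₗ[ℂ] W')) = L := by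
      rw [Submodule.map_comap_eq, inf_eq_right]
      exact h2.trans (LinearMap.map_le_range)
    refine ⟨L.comap (pullback (h : W →ₗ[ℂ] W')), ⟨?_, ?_, ?_⟩, hL⟩
    · rw [← h1]
      conv_rhs => rw [← hL]
      exact (LinearEquiv.finrank_eq (Submodule.equivMapOfInjective _ hinj _))
    · intro q hq
      obtain ⟨q', hq', e⟩ := h2 hq
      exact hinj e ▸ hq'
    · intro q hq
      exact (isDegenerate_pullback h q).1 (h3 _ hq)
  · rintro ⟨K, ⟨h1, h2, h3⟩, rfl⟩
    refine ⟨?_, Submodule.map_mono h2, ?_⟩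
    · rw [← h1]
      exact (LinearEquiv.finrank_eq (Submodule.equivMapOfInjective _ hinj _)).symm
    · rintro _ ⟨q, hq, rfl⟩
      exact (isDegenerate_pullback h q).2 (h3 _ hq)

theorem IsNonsingularPencil.pullback {n : ℕ} {Φ : Submodule ℂ (QuadraticForm ℂ W')}
    (H : IsNonsingularPencil n Φ) (h : W ≃ₗ[ℂ] W') :
    IsNonsingularPencil n (Φ.map (QuadricPencil.pullback (h : W →ₗ[ℂ] W'))) := by
  have hinj := pullback_injective h
  have := H.finiteDimensional
  refine ⟨Module.Finite.equiv h.symm, h.finrank_eq.trans H.finrank_space, ?_, ?_, ?_⟩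
  · rw [← H.finrank_eq]
    exact (LinearEquiv.finrank_eq (Submodule.equivMapOfInjective _ hinj _)).symm
  · obtain ⟨q, hq, hq'⟩ := H.nondegenerate
    exact ⟨_, Submodule.mem_map_of_mem hq, fun hd => hq' ((isDegenerate_pullback h q).1 hd)⟩
  · rw [degeneratePoints_pullback, Set.InjOn.encard_image, H.encard_degenerate]
    exact (Submodule.map_injective_of_injective hinj).injOn

end Pencils

/-! ### The Zariski topology and dimension -/

/-- The Zariski topology on the affine space `ℂ^σ`, generated by the principal open sets. -/
abbrev zariski (σ : Type*) : TopologicalSpace (σ → ℂ) :=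
  TopologicalSpace.generateFrom
    {U | ∃ p : MvPolynomial σ ℂ, U = {v | MvPolynomial.eval v p ≠ 0}}

/-- The Zariski topology on the projective space of `ℂ^σ`: the quotient topology of the Zariski
topology on the space of nonzero vectors. -/
abbrev projZariski (σ : Type*) : TopologicalSpace (ℙ ℂ (σ → ℂ)) :=
  ((zariski σ).induced (Subtype.val : {v : σ → ℂ // v ≠ 0} → (σ → ℂ))).coinduced
    (Projectivization.mk' ℂ)

/-- The Zariski topology on a subset of a projective space. -/
abbrev zariskiOn {σ : Type*} (S : Set (ℙ ℂ (σ → ℂ))) : TopologicalSpace S :=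
  (projZariski σ).induced Subtype.val

/-- All irreducible components of `S`, with its Zariski topology, have dimension `d`. -/
def IsOfPureDimension {σ : Type*} (S : Set (ℙ ℂ (σ → ℂ))) (d : ℕ) : Prop :=
  letI := zariskiOn S
  ∀ C ∈ irreducibleComponents S, topologicalKrullDim C = d

/-- The dimension of `S` at its point `x`: the largest dimension of an irreducible component of
`S` through `x`. -/
def localDimension {σ : Type*} (S : Set (ℙ ℂ (σ → ℂ))) (x : S) : WithBot ℕ∞ :=
  letI := zariskiOn S
  ⨆ C : {C : Set S // C ∈ irreducibleComponents S ∧ x ∈ C}, topologicalKrullDim C.1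

/-! ### Tangent spaces and smoothness -/

/-- The affine cone over `S`, without the origin. -/
def cone {σ : Type*} (S : Set (ℙ ℂ (σ → ℂ))) : Set (σ → ℂ) :=
  {v | ∃ h : v ≠ 0, Projectivization.mk ℂ v h ∈ S}

section Tangent

variable {σ : Type*} [Fintype σ]

/-- The affine tangent space of `S` at the vector `v`, i.e. the Zariski tangent space of the
affine cone of `S`: the common kernel of the differentials at `v` of all polynomials which vanish
on the cone. -/
def affineTangent (S : Set (ℙ ℂ (σ → ℂ))) (v : σ → ℂ) : Submodule ℂ (σ → ℂ) where
  carrier := {w | ∀ p : MvPolynomial σ ℂ, (∀ u ∈ cone S, MvPolynomial.eval u p = 0) →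
    ∑ i, MvPolynomial.eval v (MvPolynomial.pderiv i p) * w i = 0}
  zero_mem' := by intro p _; simp
  add_mem' := by
    intro a b ha hb p hp
    simp [mul_add, Finset.sum_add_distrib, ha p hp, hb p hp]
  smul_mem' := by
    intro c a ha p hp
    have := congrArg (c * ·) (ha p hp)
    simpa [Finset.mul_sum, mul_left_comm] using this

/-- The tangent space `T_x S` of `S` at `x`. A representative `v` of `x` being fixed, it is the
quotient of the affine tangent space at `v` by the line of `x` (the canonical tangent space is the
space of linear maps from the line of `x` to this quotient; evaluation at `v` identifies the
two). -/
abbrev TangentAt (S : Set (ℙ ℂ (σ → ℂ))) (x : ℙ ℂ (σ → ℂ)) : Type _ :=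
  affineTangent S x.rep ⧸ x.submodule.comap (affineTangent S x.rep).subtype

/-- The class in `T_x S` of a vector of the affine tangent space. -/
abbrev tangentClass (S : Set (ℙ ℂ (σ → ℂ))) (x : ℙ ℂ (σ → ℂ)) (w : affineTangent S x.rep) :
    TangentAt S x :=
  Submodule.Quotient.mk w

/-- The (locally closed) subset `S`, as a variety, is smooth at `x`: the dimension of its Zariski
tangent space at `x` equals the dimension of `S` at `x`. -/
def IsSmoothAt (S : Set (ℙ ℂ (σ → ℂ))) (x : S) : Prop :=
  ((Module.finrank ℂ (TangentAt S x.1) : ℕ) : WithBot ℕ∞) = localDimension S x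

/-! ### The projective second fundamental form -/

/-- The quadratic form `q` on `T_x S` is the component along the conormal vector `l` (a linear
form which vanishes on the affine tangent space at `v`, where `x = [v]`) of the derivative at `x`
of the Gauss map of `S`. The Gauss map sends a point to its affine tangent space. Its derivative
along the velocity of a curve `[c]` in `S` is the linear map from the affine tangent space `T` at
`v` to the quotient by `T` which sends `e 0` to the class of `e' 0`, for every curve `e` of vectors
with `e t` in the affine tangent space at `c t`. -/
def IsSecondFundamentalFormAlong (S : Set (ℙ ℂ (σ → ℂ))) (x : ℙ ℂ (σ → ℂ))
    (l : (σ → ℂ) →ₗ[ℂ] ℂ) (q : QuadraticForm ℂ (TangentAt S x)) : Prop :=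
  (∀ w ∈ affineTangent S x.rep, l w = 0) ∧
  ∀ (c e : ℂ → σ → ℂ) (c' e₀ : affineTangent S x.rep) (e' : σ → ℂ),
    AnalyticAt ℂ c 0 → AnalyticAt ℂ e 0 →
    (∀ᶠ t in nhds (0 : ℂ), c t ∈ cone S) →
    (∀ᶠ t in nhds (0 : ℂ), e t ∈ affineTangent S (c t)) →
    c 0 = x.rep → HasDerivAt c (c' : σ → ℂ) 0 → e 0 = e₀ → HasDerivAt e e' 0 →
    QuadraticMap.associated q (tangentClass S x c') (tangentClass S x e₀) = l e'

/-- The second fundamental form `II_{S,x}`, as a linear system of quadratic forms on `T_x S`: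
all components of the derivative of the Gauss map along conormal vectors. -/
def secondFundamentalForm (S : Set (ℙ ℂ (σ → ℂ))) (x : ℙ ℂ (σ → ℂ)) :
    Submodule ℂ (QuadraticForm ℂ (TangentAt S x)) where
  carrier := {q | ∃ l, IsSecondFundamentalFormAlong S x l q}
  zero_mem' := ⟨0, by simp, by intros; simp⟩
  add_mem' := by
    rintro a b ⟨l, h1, h2⟩ ⟨m, k1, k2⟩
    refine ⟨l + m, fun w hw => by simp [h1 w hw, k1 w hw], ?_⟩
    intro c e c' e₀ e' i1 i2 i3 i4 i5 i6 i7 i8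
    rw [map_add, LinearMap.add_apply, LinearMap.add_apply, LinearMap.add_apply,
      h2 c e c' e₀ e' i1 i2 i3 i4 i5 i6 i7 i8, k2 c e c' e₀ e' i1 i2 i3 i4 i5 i6 i7 i8]
  smul_mem' := by
    rintro r a ⟨l, h1, h2⟩
    refine ⟨r • l, fun w hw => by simp [h1 w hw], ?_⟩
    intro c e c' e₀ e' i1 i2 i3 i4 i5 i6 i7 i8
    rw [map_smul, LinearMap.smul_apply, LinearMap.smul_apply, LinearMap.smul_apply,
      h2 c e c' e₀ e' i1 i2 i3 i4 i5 i6 i7 i8]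

end Tangent

/-! ### The moduli space of nonsingular pencils of quadratic forms -/

/-- The nonsingular pencils of quadratic forms on `ℂ^n`. -/
def NonsingularPencil (n : ℕ) : Type :=
  {Φ : Submodule ℂ (QuadraticForm ℂ (Fin n → ℂ)) // IsNonsingularPencil n Φ}

/-- Projective equivalence of pencils: `Φ₂ = T^* Φ₁` for a linear automorphism `T`. -/
instance projectiveEquivalence (n : ℕ) : Setoid (NonsingularPencil n) where
  r Φ₁ Φ₂ := ∃ T : (Fin n → ℂ) ≃ₗ[ℂ] (Fin n → ℂ),
    Φ₂.1 = Φ₁.1.map (pullback (T : (Fin n → ℂ) →ₗ[ℂ] (Fin n → ℂ)))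
  iseqv := by
    refine ⟨fun Φ => ⟨LinearEquiv.refl ℂ _, ?_⟩, ?_, ?_⟩
    · ext q
      constructor
      · exact fun hq => ⟨q, hq, rfl⟩
      · rintro ⟨q', hq', rfl⟩
        exact hq'
    · rintro Φ Ψ ⟨T, hT⟩
      refine ⟨T.symm, ?_⟩
      rw [hT]
      ext q
      constructor
      · intro hq
        refine ⟨_, ⟨q, hq, rfl⟩, ?_⟩
        ext u
        simp [pullback_apply]
      · rintro ⟨_, ⟨q', hq', rfl⟩, rfl⟩
        have e : pullback (T.symm : (Fin n → ℂ) →ₗ[ℂ] (Fin n → ℂ))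
            (pullback (T : (Fin n → ℂ) →ₗ[ℂ] (Fin n → ℂ)) q') = q' := by
          ext u
          simp [pullback_apply]
        rw [e]
        exact hq'
    · rintro Φ Ψ Θ ⟨T, hT⟩ ⟨R, hR⟩
      refine ⟨R.trans T, ?_⟩
      rw [hR, hT, ← Submodule.map_comp]
      rfl

/-- The moduli space of nonsingular pencils of quadratic forms on an `n`-dimensional vector space:
the orbit space of nonsingular pencils modulo projective equivalence. -/
def Moduli (n : ℕ) : Type := Quotient (projectiveEquivalence n)

/-- The bases of nonsingular pencils. -/
def PencilFrame (n : ℕ) : Type :=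
  {φ : Fin 2 → QuadraticForm ℂ (Fin n → ℂ) //
    LinearIndependent ℂ φ ∧ IsNonsingularPencil n (Submodule.span ℂ (Set.range φ))}

/-- The coordinates of a basis `(φ₁, φ₂)` of a pencil: the entries of the two symmetric matrices. -/
def PencilFrame.coord {n : ℕ} (s : PencilFrame n) : Fin 2 × Fin n × Fin n → ℂ :=
  fun k => QuadraticMap.associated (s.1 k.1) (Pi.single k.2.1 1) (Pi.single k.2.2 1)

/-- The class of a pencil given by a basis. -/
def PencilFrame.toModuli {n : ℕ} (s : PencilFrame n) : Moduli n :=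
  Quotient.mk (projectiveEquivalence n) ⟨_, s.2.2⟩

/-- The Zariski topology on the moduli space: the quotient topology, the Grassmannian of pencils
itself being the quotient of the space of bases of pencils. -/
instance (n : ℕ) : TopologicalSpace (Moduli n) :=
  ((zariski (Fin 2 × Fin n × Fin n)).induced PencilFrame.coord).coinduced PencilFrame.toModuli

/-- The regular functions on an open subset `U` of the moduli space, as an orbit space: the
functions whose pull-back to the space of bases of pencils is regular, i.e. locally a
quotient of polynomials. -/
def IsRegularOn {n : ℕ} (U : Set (Moduli n)) (f : Moduli n → ℂ) : Prop :=
  ∀ s : PencilFrame n, s.toModuli ∈ U → ∃ p r : MvPolynomial (Fin 2 × Fin n × Fin n) ℂ,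
    MvPolynomial.eval s.coord r ≠ 0 ∧
    ∀ t : PencilFrame n, t.toModuli ∈ U → MvPolynomial.eval t.coord r ≠ 0 →
      f t.toModuli = MvPolynomial.eval t.coord p / MvPolynomial.eval t.coord r

/-- `f` is (a representative of) a germ of a regular function at `m`. -/
def IsRegularGermAt {n : ℕ} (m : Moduli n) (f : Moduli n → ℂ) : Prop :=
  ∃ U : Set (Moduli n), IsOpen U ∧ m ∈ U ∧ IsRegularOn U f

/-! ### Intersections of two quadrics and their moduli maps -/

section Intersection

variable {n : ℕ}

/-- The intersection of the quadric hypersurfaces `φ₁ = 0` and `φ₂ = 0`. -/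
def quadricIntersection (φ₁ φ₂ : QuadraticForm ℂ (Fin (n + 3) → ℂ)) :
    Set (ℙ ℂ (Fin (n + 3) → ℂ)) :=
  {x | φ₁ x.rep = 0 ∧ φ₂ x.rep = 0}

/-- The intersection of the two quadrics is nonsingular (of codimension two): the differentials of
the two equations are linearly independent at each of its points. -/
def IsNonsingularIntersection (φ₁ φ₂ : QuadraticForm ℂ (Fin (n + 3) → ℂ)) : Prop :=
  ∀ v : Fin (n + 3) → ℂ, v ≠ 0 → φ₁ v = 0 → φ₂ v = 0 →
    LinearIndependent ℂ ![QuadraticMap.associated φ₁ v, QuadraticMap.associated φ₂ v]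

/-- The set `X^o` of points of `X` at which the second fundamental form is a nonsingular pencil. -/
def nonsingularLocus (X : Set (ℙ ℂ (Fin (n + 3) → ℂ))) : Set (ℙ ℂ (Fin (n + 3) → ℂ)) :=
  {x | x ∈ X ∧ IsNonsingularPencil n (secondFundamentalForm X x)}

/-- A linear isomorphism of `ℂ^n` with the tangent space at a point of `X^o`. -/
def tangentFrame (X : Set (ℙ ℂ (Fin (n + 3) → ℂ))) (x : nonsingularLocus X) :
    (Fin n → ℂ) ≃ₗ[ℂ] TangentAt X x.1 :=
  LinearEquiv.ofFinrankEq _ _ (by simp [x.2.2.finrank_space])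

/-- The moduli map `μ^X` of second fundamental forms: it sends `x` to the class of `II_{X,x}`,
transported to `ℂ^n` by a linear isomorphism (whose choice is irrelevant). -/
def moduliMap (X : Set (ℙ ℂ (Fin (n + 3) → ℂ))) (x : nonsingularLocus X) : Moduli n :=
  Quotient.mk (projectiveEquivalence n) ⟨_, x.2.2.pullback (tangentFrame X x)⟩

/-- The fiber of the moduli map through `x`. -/
def moduliFiber (X : Set (ℙ ℂ (Fin (n + 3) → ℂ))) (x : nonsingularLocus X) :
    Set (ℙ ℂ (Fin (n + 3) → ℂ)) :=
  {y | ∃ hy : y ∈ nonsingularLocus X, moduliMap X ⟨y, hy⟩ = moduliMap X x}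

theorem mem_moduliFiber (X : Set (ℙ ℂ (Fin (n + 3) → ℂ))) (x : nonsingularLocus X) :
    x.1 ∈ moduliFiber X x :=
  ⟨x.2, rfl⟩

/-- The linear form `L` on `T_x X` is the differential at `x` of the function `g` on `X^o`: for
each holomorphic curve `γ = [c]` in `X^o` with `γ 0 = x`, the derivative of `g ∘ γ` at `0` is the
value of `L` at the velocity of `γ`. -/
def HasDifferentialAt (X : Set (ℙ ℂ (Fin (n + 3) → ℂ))) (x : nonsingularLocus X)
    (g : nonsingularLocus X → ℂ) (L : TangentAt X x.1 →ₗ[ℂ] ℂ) : Prop :=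
  ∀ (γ : ℂ → nonsingularLocus X) (c : ℂ → Fin (n + 3) → ℂ) (c' : affineTangent X x.1.rep),
    AnalyticAt ℂ c 0 →
    (∀ᶠ t in nhds (0 : ℂ), ∃ h : c t ≠ 0, (γ t).1 = Projectivization.mk ℂ (c t) h) →
    c 0 = x.1.rep → HasDerivAt c (c' : Fin (n + 3) → ℂ) 0 →
    HasDerivAt (fun t => g (γ t)) (L (tangentClass X x.1 c')) 0

/-- The kernel of `d_x μ^X`. The tangent space of the moduli space at `m = μ^X(x)` consists of the
derivations at `m` of the local ring of germs of regular functions, and `d_x μ^X` sends `w` to the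
derivation `f ↦ d_x(f ∘ μ^X)(w)`; so `w` is in the kernel if all `d_x(f ∘ μ^X)` vanish
on `w`. -/
def kernelOfDifferential (X : Set (ℙ ℂ (Fin (n + 3) → ℂ))) (x : nonsingularLocus X) :
    Set (TangentAt X x.1) :=
  {w | ∀ f : Moduli n → ℂ, IsRegularGermAt (moduliMap X x) f →
    ∃ L : TangentAt X x.1 →ₗ[ℂ] ℂ,
      HasDifferentialAt X x (fun y => f (moduliMap X y)) L ∧ L w = 0}

/-- The basis `b` of `ℂ^(n+3)` is standard for `(φ₁, φ₂)`: in the coordinates `z` of this basis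
`φ₁ = ∑ l_i z_i²` and `φ₂ = ∑ z_i²`, with distinct nonzero numbers `l_i`. -/
def IsStandardBasis (φ₁ φ₂ : QuadraticForm ℂ (Fin (n + 3) → ℂ))
    (b : Module.Basis (Fin (n + 3)) ℂ (Fin (n + 3) → ℂ)) (l : Fin (n + 3) → ℂ) : Prop :=
  Function.Injective l ∧ (∀ i, l i ≠ 0) ∧
    ∀ z : Fin (n + 3) → ℂ, φ₁ (∑ i, z i • b i) = ∑ i, l i * z i ^ 2 ∧
      φ₂ (∑ i, z i • b i) = ∑ i, z i ^ 2

/-- The quadratic form `q` on `T_x X` is the one induced by `φ`. -/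
def IsInducedForm (X : Set (ℙ ℂ (Fin (n + 3) → ℂ))) (x : ℙ ℂ (Fin (n + 3) → ℂ))
    (φ : QuadraticForm ℂ (Fin (n + 3) → ℂ)) (q : QuadraticForm ℂ (TangentAt X x)) : Prop :=
  ∀ w : affineTangent X x.rep, q (tangentClass X x w) = φ w

/-- The point `x` of `X = {φ₁ = φ₂ = 0}` is regular, for the pair `(φ₁, φ₂)` of nondegenerate
forms: `x` is in `X^o`, i.e. `II_{X,x}` is a nonsingular pencil; the coordinates of `x` in a
standard basis are nonzero; the identity is the only projective automorphism of the line
`II_{X,x}` that preserves the set of its degenerate elements; and the forms on `T_x X` induced by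
`φ₁` and `φ₂` are nondegenerate. -/
structure IsRegularPoint (φ₁ φ₂ : QuadraticForm ℂ (Fin (n + 3) → ℂ))
    (x : ℙ ℂ (Fin (n + 3) → ℂ)) : Prop where
  mem_nonsingularLocus : x ∈ nonsingularLocus (quadricIntersection φ₁ φ₂)
  general : ∃ b l, IsStandardBasis φ₁ φ₂ b l ∧ ∀ i, b.repr x.rep i ≠ 0
  trivialAutomorphisms :
    HasTrivialAutomorphisms (secondFundamentalForm (quadricIntersection φ₁ φ₂) x)
  nondegenerate₁ : ∃ q, IsInducedForm (quadricIntersection φ₁ φ₂) x φ₁ q ∧ ¬ IsDegenerate q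
  nondegenerate₂ : ∃ q, IsInducedForm (quadricIntersection φ₁ φ₂) x φ₂ q ∧ ¬ IsDegenerate q

end Intersection

end QuadricPencil

end

open scoped LinearAlgebra.Projectivization

noncomputable section

namespace QuadricPencil

/-! ### Polynomial functions -/

/-! Take coordinates z with φ₁ = ∑ l_i z_i² and φ₂ = ∑ z_i², and put W_i = ∏_{j ≠ i} (l_i - l_j). To
z corresponds the polynomial P of degree at most n + 2 with P(l_i) = W_i z_i². By Lagrange's formula
the equations of X say exactly that its two top coefficients vanish, so deg P ≤ n
(`natDegree_interp_le`, `sum_sq_eq_zero`, `sum_node_mul_sq_eq_zero`). The second fundamental form at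
[z] is spanned by the restrictions of φ₁ and φ₂ to the tangent space
(`secondFundamentalForm_eq_span`), and sφ₁ + tφ₂ restricts to a degenerate form exactly when P(-t/s)
= 0, the case s = 0 being a root at infinity (`coordDegenerate_iff_of_ne`,
`coordDegenerate_zero_iff`). Thus X modulo sign changes of the coordinates is the projective space
of binary forms of degree n, and the degenerate elements of the pencil at a point are the roots of
its form.

A nonsingular pencil can be diagonalized, so its class is the set of its n roots modulo Möbius
transformations (`HasRoots.exists_equiv`). If r_1, …, r_n are the roots at x, the fiber through x
therefore consists of the [v] with W_i v_i² = ∏_k ((g₀ l_i + g₁) - r_k (g₂ l_i + g₃)) for some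
invertible g (`IsChart.mk_mem_moduliFiber_iff`). No nontrivial Möbius transformation preserves the
set of roots, so g is unique up to a scalar. The resulting map `IsChart.toPGL` from the fiber to
PGL₂ is surjective, continuous and closed, and its fibers are the orbits of the finite group of sign
changes. Lying over, going down and incomparability for such a quotient show that each component of
the fiber has the dimension of PGL₂, which is three (`topologicalKrullDim_component_eq`,
`topologicalKrullDim_PGL₂`).

For the infinitesimal statements, T_x X is identified with the space of velocities δ of the roots
(`IsChart.exists_rootMotion_eq`). Symmetrized polynomials in the cross ratios of the roots are
regular functions on the moduli space (`isRegularOn_moduliFunction`). As the stabilizer is trivial,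
some polynomial in the cross ratios is 1 at the given ordering of the roots and 0 at all others
(`exists_separating`), so the symmetrized functions detect the first order variation of each single
cross ratio. If all of these vanish then δ_k = A + B r_k + C r_k², an infinitesimal Möbius motion
(`exists_quadratic_of_variation_eq_zero`). Conversely, such motions are velocities of curves in the
fiber, along which every function pulled back from the moduli space is constant. Hence the kernel of
the differential and the tangent space of the fiber are both the three-dimensional space of
quadratic δ, and comparison with the dimension of the fiber gives smoothness. -/

/-- Polynomial functions on `ℂ^σ`. -/
def IsPoly {σ : Type*} (f : (σ → ℂ) → ℂ) : Prop :=
  ∃ p : MvPolynomial σ ℂ, ∀ v, f v = MvPolynomial.eval v p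

namespace IsPoly

variable {σ τ : Type*} {f g : (σ → ℂ) → ℂ}

theorem const (a : ℂ) : IsPoly (fun _ : σ → ℂ => a) :=
  ⟨MvPolynomial.C a, fun v => by simp⟩

theorem coord (i : σ) : IsPoly (fun v : σ → ℂ => v i) :=
  ⟨MvPolynomial.X i, fun v => by simp⟩

theorem add (hf : IsPoly f) (hg : IsPoly g) : IsPoly (fun v => f v + g v) := by
  obtain ⟨p, hp⟩ := hf
  obtain ⟨q, hq⟩ := hg
  exact ⟨p + q, fun v => by simp [hp, hq]⟩

theorem mul (hf : IsPoly f) (hg : IsPoly g) : IsPoly (fun v => f v * g v) := by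
  obtain ⟨p, hp⟩ := hf
  obtain ⟨q, hq⟩ := hg
  exact ⟨p * q, fun v => by simp [hp, hq]⟩

theorem neg (hf : IsPoly f) : IsPoly (fun v => -f v) := by
  obtain ⟨p, hp⟩ := hf
  exact ⟨-p, fun v => by simp [hp]⟩

theorem sub (hf : IsPoly f) (hg : IsPoly g) : IsPoly (fun v => f v - g v) := by
  simpa [sub_eq_add_neg] using hf.add hg.neg

theorem pow (hf : IsPoly f) (k : ℕ) : IsPoly (fun v => f v ^ k) := by
  obtain ⟨p, hp⟩ := hf
  exact ⟨p ^ k, fun v => by simp [hp]⟩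

theorem sum {ι : Type*} (s : Finset ι) {F : ι → (σ → ℂ) → ℂ} (hF : ∀ i, IsPoly (F i)) :
    IsPoly (fun v => ∑ i ∈ s, F i v) := by
  choose p hp using hF
  exact ⟨∑ i ∈ s, p i, fun v => by simp [hp]⟩

theorem prod {ι : Type*} (s : Finset ι) {F : ι → (σ → ℂ) → ℂ} (hF : ∀ i, IsPoly (F i)) :
    IsPoly (fun v => ∏ i ∈ s, F i v) := by
  choose p hp using hF
  exact ⟨∏ i ∈ s, p i, fun v => by simp [hp]⟩

theorem comp {f : (τ → ℂ) → ℂ} (hf : IsPoly f) {G : (σ → ℂ) → τ → ℂ}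
    (hG : ∀ i, IsPoly (fun v => G v i)) : IsPoly (fun v => f (G v)) := by
  obtain ⟨p, hp⟩ := hf
  choose q hq using hG
  refine ⟨MvPolynomial.bind₁ q p, fun v => ?_⟩
  have hG' : G v = fun i => MvPolynomial.eval v (q i) := funext fun i => hq i v
  change f (G v) = _
  rw [hp, hG', MvPolynomial.eval, MvPolynomial.eval, MvPolynomial.eval₂Hom_bind₁]

theorem eval (p : MvPolynomial τ ℂ) {G : (σ → ℂ) → τ → ℂ}
    (hG : ∀ i, IsPoly (fun v => G v i)) : IsPoly (fun v => MvPolynomial.eval (G v) p) :=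
  comp ⟨p, fun _ => rfl⟩ hG

theorem linear [Fintype σ] (l : (σ → ℂ) →ₗ[ℂ] ℂ) : IsPoly (fun v => l v) := by
  classical
  have h : (fun v => l v) = fun v => ∑ i, v i * l (Pi.single i 1) := by
    ext v
    conv_lhs => rw [pi_eq_sum_univ' v]
    simp [map_sum]
  rw [h]
  exact sum _ fun i => (coord i).mul (const _)

theorem det {ι : Type*} [Fintype ι] [DecidableEq ι] {M : (σ → ℂ) → Matrix ι ι ℂ}
    (hM : ∀ i j, IsPoly (fun v => M v i j)) : IsPoly (fun v => (M v).det) := by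
  simp only [Matrix.det_apply']
  exact sum _ fun p => (const _).mul (prod _ fun i => hM _ _)

/-- Two polynomial functions which are not identically zero have a common point where they do not
vanish. -/
theorem exists_mul_ne_zero (hf : IsPoly f) (hg : IsPoly g) {u v : σ → ℂ} (hu : f u ≠ 0)
    (hv : g v ≠ 0) : ∃ w, f w ≠ 0 ∧ g w ≠ 0 := by
  obtain ⟨p, hp⟩ := hf
  obtain ⟨q, hq⟩ := hg
  by_contra! h
  have hpq : p * q = 0 := by
    apply MvPolynomial.funext
    intro w
    by_cases hw : f w = 0
    · simp [← hp, hw]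
    · simp [← hq, h w hw]
  rcases mul_eq_zero.1 hpq with h0 | h0
  · exact hu (by simp [hp, h0])
  · exact hv (by simp [hq, h0])

/-- Restriction of a polynomial function to a line through the origin. -/
theorem along_line (hf : IsPoly f) (v : σ → ℂ) :
    ∃ P : Polynomial ℂ, ∀ a : ℂ, f (a • v) = P.eval a := by
  obtain ⟨p, hf⟩ := hf
  refine ⟨MvPolynomial.aeval (fun i => Polynomial.C (v i) * Polynomial.X) p, fun a => ?_⟩
  rw [hf]
  clear hf
  induction p using MvPolynomial.induction_on with
  | C r => simp
  | add p q hp hq => simp [hp, hq]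
  | mul_X p i hp =>
    simp only [map_mul, MvPolynomial.eval_X, MvPolynomial.aeval_X, Polynomial.eval_mul,
      Polynomial.eval_C, Polynomial.eval_X, hp, Pi.smul_apply, smul_eq_mul]
    ring

end IsPoly

/-! ### The Zariski topology through polynomial functions -/

section Zariski

open Topology

variable {σ τ : Type*}

/-- Principal open sets form a basis and not only a subbasis, since the intersection of two of them
is the principal set of the product. -/
theorem zariski_exists_principal {U : Set (σ → ℂ)} (hU : IsOpen[zariski σ] U) {v : σ → ℂ}
    (hv : v ∈ U) : ∃ f : (σ → ℂ) → ℂ, IsPoly f ∧ f v ≠ 0 ∧ ∀ u, f u ≠ 0 → u ∈ U := by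
  induction hU with
  | basic s hs =>
    obtain ⟨p, rfl⟩ := hs
    exact ⟨_, ⟨p, fun _ => rfl⟩, hv, fun u hu => hu⟩
  | univ => exact ⟨_, IsPoly.const 1, one_ne_zero, fun _ _ => trivial⟩
  | inter s t _ _ hs ht =>
    obtain ⟨f, hf, hfv, hfs⟩ := hs hv.1
    obtain ⟨g, hg, hgv, hgt⟩ := ht hv.2
    exact ⟨_, hf.mul hg, mul_ne_zero hfv hgv,
      fun u hu => ⟨hfs u (left_ne_zero_of_mul hu), hgt u (right_ne_zero_of_mul hu)⟩⟩
  | sUnion S _ ih =>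
    obtain ⟨s, hs, hvs⟩ := hv
    obtain ⟨f, hf, hfv, hfs⟩ := ih s hs hvs
    exact ⟨f, hf, hfv, fun u hu => ⟨s, hs, hfs u hu⟩⟩

theorem isOpen_zariski_principal {f : (σ → ℂ) → ℂ} (hf : IsPoly f) :
    IsOpen[zariski σ] {u | f u ≠ 0} := by
  obtain ⟨p, hp⟩ := hf
  apply TopologicalSpace.GenerateOpen.basic
  exact ⟨p, by simp [hp]⟩

/-- Replaces the quotient and subspace topologies by a test on representing vectors. The polynomial
functions involved need not be homogeneous, which spares all homogenization later. -/
theorem isOpen_zariskiOn_iff {S : Set (ℙ ℂ (σ → ℂ))} {A : Set S} :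
    IsOpen[zariskiOn S] A ↔ ∀ (v : σ → ℂ) (hv : v ≠ 0) (hS : Projectivization.mk ℂ v hv ∈ S),
      (⟨_, hS⟩ : S) ∈ A → ∃ f : (σ → ℂ) → ℂ, IsPoly f ∧ f v ≠ 0 ∧
        ∀ (u : σ → ℂ) (hu : u ≠ 0) (hS' : Projectivization.mk ℂ u hu ∈ S), f u ≠ 0 →
          (⟨_, hS'⟩ : S) ∈ A := by
  constructor
  · intro hA v hv hS hvA
    obtain ⟨U, hU, rfl⟩ := (@isOpen_induced_iff _ _ (projZariski σ) _ _).1 hA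
    rw [@isOpen_coinduced] at hU
    obtain ⟨V, hV, hVU⟩ := (@isOpen_induced_iff _ _ (zariski σ) _ _).1 hU
    have hvV : v ∈ V := by
      have : (⟨v, hv⟩ : {v : σ → ℂ // v ≠ 0}) ∈ Subtype.val ⁻¹' V := by
        rw [hVU]; exact hvA
      exact this
    obtain ⟨f, hf, hfv, hfV⟩ := zariski_exists_principal hV hvV
    refine ⟨f, hf, hfv, fun u hu hS' hfu => ?_⟩
    have : (⟨u, hu⟩ : {v : σ → ℂ // v ≠ 0}) ∈ Subtype.val ⁻¹' V := hfV u hfu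
    rw [hVU] at this
    exact this
  · intro H
    choose! f hf hfv hfA using H
    -- The open set of the projective space is the union of the images of the principal sets
    -- supplied by the hypothesis.
    refine (@isOpen_induced_iff _ _ (projZariski σ) _ _).2
      ⟨{x | ∃ (v : σ → ℂ) (hv : v ≠ 0) (hS : Projectivization.mk ℂ v hv ∈ S),
        (⟨_, hS⟩ : S) ∈ A ∧ ∃ (u : σ → ℂ) (hu : u ≠ 0), x = Projectivization.mk ℂ u hu ∧
          f v u ≠ 0}, ?_, ?_⟩
    · rw [@isOpen_coinduced]
      -- Its preimage among vectors is the saturation of these principal sets under scaling, a union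
      -- of principal sets over all nonzero scalars a.
      refine (@isOpen_induced_iff _ _ (zariski σ) _ _).2
        ⟨⋃ (v : σ → ℂ) (_ : ∃ (hv : v ≠ 0) (hS : Projectivization.mk ℂ v hv ∈ S),
          (⟨_, hS⟩ : S) ∈ A) (a : ℂ) (_ : a ≠ 0), {u | f v (a • u) ≠ 0}, ?_, ?_⟩
      · refine @isOpen_iUnion _ _ (zariski σ) _ fun v => @isOpen_iUnion _ _ (zariski σ) _ fun hv =>
          @isOpen_iUnion _ _ (zariski σ) _ fun a => @isOpen_iUnion _ _ (zariski σ) _ fun ha => ?_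
        obtain ⟨hv, hS, hvA⟩ := hv
        exact isOpen_zariski_principal ((hf v hv hS hvA).comp
          (G := fun u => a • u) fun i => (IsPoly.const a).mul (IsPoly.coord i))
      · ext ⟨u, hu⟩
        simp only [Set.mem_preimage, Set.mem_iUnion, Set.mem_ofPred_eq, exists_prop]
        constructor
        · rintro ⟨v, ⟨hv, hS, hvA⟩, a, ha, hau⟩
          refine ⟨v, hv, hS, hvA, a • u, smul_ne_zero ha hu, ?_, hau⟩
          rw [Projectivization.mk'_eq_mk, Projectivization.mk_eq_mk_iff']
          exact ⟨a⁻¹, by simp [smul_smul, ha]⟩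
        · rintro ⟨v, hv, hS, hvA, w, hw, huw, hfw⟩
          rw [Projectivization.mk'_eq_mk, eq_comm, Projectivization.mk_eq_mk_iff'] at huw
          obtain ⟨a, rfl⟩ := huw
          exact ⟨v, ⟨hv, hS, hvA⟩, a, fun h => hw (by simp [h]), hfw⟩
    · ext ⟨x, hx⟩
      induction x using Projectivization.ind with
      | h v hv =>
        constructor
        · rintro ⟨w, hw, hS, hwA, u, hu, hvu, hfu⟩
          dsimp only at hvu
          have := hfA w hw hS hwA u hu (hvu ▸ hx) hfu
          convert this
        · intro hvA
          exact ⟨v, hv, hx, hvA, v, hv, rfl, hfv v hv hx hvA⟩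

/-- Continuity for the Zariski topologies, on the level of vectors. -/
theorem continuous_zariskiOn {S : Set (ℙ ℂ (σ → ℂ))} {T : Set (ℙ ℂ (τ → ℂ))} (ρ : S → T)
    (H : ∀ (v : σ → ℂ) (hv : v ≠ 0), Projectivization.mk ℂ v hv ∈ S →
      ∃ (G : (σ → ℂ) → τ → ℂ) (e : (σ → ℂ) → ℂ), (∀ i, IsPoly fun u => G u i) ∧ IsPoly e ∧
        e v ≠ 0 ∧ ∀ (u : σ → ℂ) (hu : u ≠ 0) (hS' : Projectivization.mk ℂ u hu ∈ S), e u ≠ 0 →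
          ∃ h : G u ≠ 0, Projectivization.mk ℂ (G u) h = (ρ ⟨_, hS'⟩).1) :
    @Continuous _ _ (zariskiOn S) (zariskiOn T) ρ := by
  let _ := zariskiOn S
  let _ := zariskiOn T
  refine continuous_def.2 fun B hB => isOpen_zariskiOn_iff.2 fun v hv hS hvB => ?_
  obtain ⟨G, e, hG, he, hev, hρ⟩ := H v hv hS
  obtain ⟨hGv, hmk⟩ := hρ v hv hS hev
  have hT : Projectivization.mk ℂ (G v) hGv ∈ T := hmk ▸ (ρ ⟨_, hS⟩).2
  obtain ⟨f, hf, hfv, hfB⟩ := isOpen_zariskiOn_iff.1 hB (G v) hGv hT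
    (by
      have h := Set.mem_preimage.1 hvB
      rwa [← show (⟨_, hT⟩ : T) = ρ ⟨_, hS⟩ from Subtype.ext hmk] at h)
  refine ⟨fun u => e u * f (G u), he.mul (hf.comp hG), mul_ne_zero hev hfv,
    fun u hu hS' hefu => ?_⟩
  obtain ⟨hGu, hmk'⟩ := hρ u hu hS' (left_ne_zero_of_mul hefu)
  have hT' : Projectivization.mk ℂ (G u) hGu ∈ T := hmk' ▸ (ρ ⟨_, hS'⟩).2
  have := hfB (G u) hGu hT' (right_ne_zero_of_mul hefu)
  rw [show (⟨_, hT'⟩ : T) = ρ ⟨_, hS'⟩ from Subtype.ext hmk'] at this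
  exact this

end Zariski

end QuadricPencil

namespace QuadricPencil

open TopologicalSpace

/-! ### Krull dimension of quotients by finite families of involutions -/

/-- Going down lifts a descending chain below f a step by step to a chain below a, so the height of
f a is at most that of a. An element a lying over the top makes this a bound for the whole
dimension. -/
theorem krullDim_le_of_goingDown {α β : Type*} [PartialOrder α] [PartialOrder β] (f : α → β)
    (h : ∀ a, ∀ b < f a, ∃ a' < a, f a' = b) (htop : ∃ a, ∀ b, b ≤ f a) :
    Order.krullDim β ≤ Order.krullDim α := by
  have key : ∀ (k : ℕ) (a : α), (k : ℕ∞) ≤ Order.height (f a) → (k : ℕ∞) ≤ Order.height a := by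
    intro k
    induction k with
    | zero => intro a _; simp
    | succ k ih =>
      intro a hk
      rw [Order.height_eq_iSup_lt_height] at hk
      have hlt : (k : ℕ∞) < ⨆ y, ⨆ (_ : y < f a), Order.height y + 1 :=
        lt_of_lt_of_le (by exact_mod_cast Nat.lt_succ_self k) hk
      obtain ⟨b, hb⟩ := lt_iSup_iff.1 hlt
      obtain ⟨hba, hb⟩ := lt_iSup_iff.1 hb
      obtain ⟨a', ha', rfl⟩ := h a b hba
      have := ih a' ((ENat.lt_add_one_iff' (ENat.natCast_ne_top k)).1 hb)
      refine le_trans ?_ (Order.height_add_one_le ha')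
      push_cast
      gcongr
  obtain ⟨a, ha⟩ := htop
  have : Nonempty β := ⟨f a⟩
  refine le_trans ?_ (Order.height_le_krullDim a)
  rw [Order.krullDim_eq_iSup_height_of_nonempty]
  refine WithBot.coe_le_coe.2 (iSup_le fun b => (Order.height_mono (ha b)).trans ?_)
  refine ENat.forall_natCast_le_iff_le.1 fun k hk => key k a hk

/-! ### Lying over, incomparability and going down for quotients by finite families of involutions
-/

section Quotient

variable {F Y ι : Type*} [TopologicalSpace F] [Finite ι] {ρ : F → Y}
  {γ : ι → F → F}

/-- A is covered by the finitely many closed sets γ_i⁻¹(B), so by irreducibility it lies in one of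
them. -/
theorem subset_image_of_image_subset (hγ : ∀ i, Continuous (γ i))
    (hfib : ∀ x y, ρ x = ρ y → ∃ i, γ i x = y) {A B : Set F} (hA : IsIrreducible A)
    (hB : IsClosed B) (h : ρ '' A ⊆ ρ '' B) : ∃ i, γ i '' A ⊆ B := by
  have hcov : A ⊆ ⋃₀ (Set.range fun i => γ i ⁻¹' B) := by
    intro x hx
    obtain ⟨y, hy, hxy⟩ := h ⟨x, hx, rfl⟩
    obtain ⟨i, rfl⟩ := hfib x y hxy.symm
    exact ⟨_, ⟨i, rfl⟩, hy⟩
  obtain ⟨_, ht, hAt⟩ := isIrreducible_iff_sUnion_isClosed.1 hA (Set.finite_range _).toFinset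
    (by
      intro t ht
      obtain ⟨i, rfl⟩ := (Set.Finite.mem_toFinset _).1 ht
      exact hB.preimage (hγ i))
    (by simpa using hcov)
  obtain ⟨i, rfl⟩ := (Set.Finite.mem_toFinset _).1 ht
  exact ⟨i, Set.image_subset_iff.2 hAt⟩

/-- Incomparability. Some γ_i maps A into B ⊆ A; applying the involution γ_i twice puts A itself
into B. -/
theorem eq_of_subset_of_image_subset (hγ : ∀ i, Continuous (γ i))
    (hinv : ∀ i x, γ i (γ i x) = x)
    (hfib : ∀ x y, ρ x = ρ y → ∃ i, γ i x = y) {A B : Set F} (hA : IsIrreducible A)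
    (hB : IsClosed B) (hBA : B ⊆ A) (h : ρ '' A ⊆ ρ '' B) : A = B := by
  obtain ⟨i, hi⟩ := subset_image_of_image_subset hγ hfib hA hB h
  refine Set.Subset.antisymm (fun x hx => ?_) hBA
  have h1 : γ i x ∈ A := hBA (hi ⟨x, hx, rfl⟩)
  have := hi ⟨_, h1, rfl⟩
  rwa [hinv] at this

/-- Lying over. Zorn's lemma gives a minimal closed set with image W. The finiteness of the fibers
is what keeps the intersection of a chain surjective onto W; minimality and the closedness of ρ then
force irreducibility. -/
theorem exists_isIrreducible_image_eq [TopologicalSpace Y] (hcl : IsClosedMap ρ) (hs : Function.Surjective ρ)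
    (hc : Continuous ρ) (hfib : ∀ x y, ρ x = ρ y → ∃ i, γ i x = y) {W : Set Y}
    (hW : IsIrreducible W) (hWc : IsClosed W) :
    ∃ A : Set F, IsIrreducible A ∧ IsClosed A ∧ ρ '' A = W := by
  obtain ⟨A, ⟨hAc, hAW⟩, hmin⟩ := zorn_superset {A : Set F | IsClosed A ∧ ρ '' A = W} (by
    intro c hc' hchain
    rcases c.eq_empty_or_nonempty with rfl | ⟨A₀, hA₀⟩
    · exact ⟨ρ ⁻¹' W, ⟨hWc.preimage hc, Set.image_preimage_eq _ hs⟩, by simp⟩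
    · refine ⟨⋂₀ c, ⟨isClosed_sInter fun t ht => (hc' ht).1, ?_⟩, fun s hs => Set.sInter_subset_of_mem hs⟩
      refine Set.Subset.antisymm ?_ ?_
      · rw [← (hc' hA₀).2]
        exact Set.image_mono (Set.sInter_subset_of_mem hA₀)
      · intro y hy
        have hfin : (ρ ⁻¹' {y}).Finite := by
          obtain ⟨x, rfl⟩ := hs y
          refine (Set.finite_range fun i => γ i x).subset ?_
          intro z hz
          obtain ⟨i, hi⟩ := hfib x z (Eq.symm hz)
          exact ⟨i, hi⟩
        by_contra hcon
        -- Each point over y is missed by some member of the chain. As the members are comparable, a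
        -- single member misses any finite set of such points, hence the whole fiber, which is
        -- absurd.
        have hout : ∀ T : Set F, T.Finite → T ⊆ ρ ⁻¹' {y} → ∃ A ∈ c, ∀ x ∈ T, x ∉ A := by
          intro T hT
          induction T, hT using Set.Finite.induction_on with
          | empty => exact fun _ => ⟨A₀, hA₀, by simp⟩
          | @insert a T _ _ ih =>
            intro hTy
            obtain ⟨A, hA, hAT⟩ := ih ((Set.subset_insert _ _).trans hTy)
            have hay : ρ a = y := hTy (Set.mem_insert _ _)
            have : a ∉ ⋂₀ c := fun h => hcon ⟨a, h, hay⟩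
            simp only [Set.mem_sInter, not_forall] at this
            obtain ⟨B, hB, haB⟩ := this
            rcases hchain.total hA hB with hAB | hBA
            · refine ⟨A, hA, ?_⟩
              rintro x (rfl | hx)
              · exact fun h => haB (hAB h)
              · exact hAT x hx
            · refine ⟨B, hB, ?_⟩
              rintro x (rfl | hx)
              · exact haB
              · exact fun h => hAT x hx (hBA h)
        obtain ⟨A, hA, hAy⟩ := hout _ hfin subset_rfl
        have : y ∈ ρ '' A := by rw [(hc' hA).2]; exact hy
        obtain ⟨x, hx, hxy⟩ := this
        exact hAy x hxy hx)
  refine ⟨A, ⟨?_, ?_⟩, hAc, hAW⟩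
  · rw [← hAW] at hW
    exact hW.nonempty.of_image
  · rw [isPreirreducible_iff_isClosed_union_isClosed]
    -- By minimality, a closed set whose trace on A still maps onto W contains A.
    have hsub : ∀ B, IsClosed B → W ⊆ ρ '' (A ∩ B) → A ⊆ B := by
      intro B hB hWB
      have := hmin (y := A ∩ B) ⟨hAc.inter hB, Set.Subset.antisymm
        (hAW ▸ Set.image_mono Set.inter_subset_left) hWB⟩ Set.inter_subset_left
      exact this.trans Set.inter_subset_right
    intro B C hB hC hABC
    have hWBC : W ⊆ ρ '' (A ∩ B) ∪ ρ '' (A ∩ C) := by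
      rw [← Set.image_union, ← Set.inter_union_distrib_left, ← hAW]
      exact Set.image_mono (Set.subset_inter subset_rfl hABC)
    rcases (isPreirreducible_iff_isClosed_union_isClosed.1 hW.isPreirreducible) _ _
      (hcl _ (hAc.inter hB)) (hcl _ (hAc.inter hC)) hWBC with h | h
    · exact Or.inl (hsub B hB h)
    · exact Or.inr (hsub C hC h)

/-- If `ρ` is a closed continuous surjection to an irreducible space, the fibers of which are the
orbits of a finite family of involutions, then all irreducible components of the source have the
dimension of the target. -/
theorem topologicalKrullDim_component_eq [TopologicalSpace Y] [IrreducibleSpace Y] (hc : Continuous ρ)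
    (hcl : IsClosedMap ρ) (hs : Function.Surjective ρ) (hγ : ∀ i, Continuous (γ i))
    (hinv : ∀ i x, γ i (γ i x) = x) (hρ : ∀ i x, ρ (γ i x) = ρ x)
    (hfib : ∀ x y, ρ x = ρ y → ∃ i, γ i x = y) (C : Set F) (hC : C ∈ irreducibleComponents F) :
    topologicalKrullDim C = topologicalKrullDim Y := by
  have hCc : IsClosed C := isClosed_of_mem_irreducibleComponents C hC
  have hCirr : IsIrreducible C := hC.1
  have hγirr : ∀ i (A : Set F), IsIrreducible A → IsIrreducible (γ i '' A) := fun i A hA =>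
    hA.image _ (hγ i).continuousOn
  have hγim : ∀ i (A : Set F), γ i '' A = γ i ⁻¹' A := by
    intro i A
    ext x
    constructor
    · rintro ⟨y, hy, rfl⟩
      simpa [hinv] using hy
    · exact fun hx => ⟨_, hx, hinv i x⟩
  have hργ : ∀ i (A : Set F), ρ '' (γ i '' A) = ρ '' A := by
    intro i A
    rw [Set.image_image]
    simp [hρ]
  have hval : ∀ Z : IrreducibleCloseds C, IsIrreducible ((↑) '' (Z : Set C) : Set F) := fun Z =>
    Z.isIrreducible.image _ continuous_subtype_val.continuousOn
  have hvalc : ∀ Z : IrreducibleCloseds C, IsClosed ((↑) '' (Z : Set C) : Set F) := fun Z =>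
    hCc.isClosedMap_subtype_val _ Z.isClosed
  let f : IrreducibleCloseds C → IrreducibleCloseds Y := fun Z =>
    ⟨ρ '' ((↑) '' (Z : Set C)), (hval Z).image _ hc.continuousOn, hcl _ (hvalc Z)⟩
  -- C lies in a translate of an irreducible closed set A with image Y, and equals this translate
  -- because C is maximal.
  have hρC : ρ '' C = Set.univ := by
    obtain ⟨A, hA, hAc, hAY⟩ := exists_isIrreducible_image_eq hcl hs hc hfib
      (IrreducibleSpace.isIrreducible_univ Y) isClosed_univ
    obtain ⟨i, hi⟩ := subset_image_of_image_subset hγ hfib hCirr hAc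
      (by rw [hAY]; exact Set.subset_univ _)
    have h1 : C ⊆ γ i '' A := by rw [hγim]; exact Set.image_subset_iff.1 hi
    have h2 : γ i '' A ⊆ C := hC.2 (hγirr i A hA) h1
    rw [Set.Subset.antisymm h1 h2, hργ, hAY]
  -- Incomparability makes Z ↦ ρ(Z) strictly monotone, which gives one inequality; going down gives
  -- the other.
  refine le_antisymm (Order.krullDim_le_of_strictMono f ?_) (krullDim_le_of_goingDown f ?_ ?_)
  · intro Z Z' hZ
    have hle : (Z : Set C) ⊆ Z' := hZ.le
    refine lt_of_le_of_ne (Set.image_mono (Set.image_mono hle)) fun heq => ?_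
    have heq' : ρ '' ((↑) '' (Z : Set C)) = ρ '' ((↑) '' (Z' : Set C)) :=
      congrArg (fun W : IrreducibleCloseds Y => (W : Set Y)) heq
    have := eq_of_subset_of_image_subset hγ hinv hfib (hval Z') (hvalc Z) (Set.image_mono hle)
      heq'.ge
    exact hZ.ne (IrreducibleCloseds.ext (Subtype.val_injective.image_injective this.symm))
  · intro Z W hW
    have hWsub : (W : Set Y) ⊆ ρ '' ((↑) '' (Z : Set C)) := hW.le
    -- Going down: lift W to an irreducible closed A, then move A into Z by one of the involutions.
    obtain ⟨A, hA, hAc, hAW⟩ := exists_isIrreducible_image_eq hcl hs hc hfib W.isIrreducible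
      W.isClosed
    obtain ⟨i, hi⟩ := subset_image_of_image_subset hγ hfib hA (hvalc Z) (hAW ▸ hWsub)
    have hBc : IsClosed (γ i '' A) := by rw [hγim]; exact hAc.preimage (hγ i)
    have hBC : γ i '' A ⊆ C := hi.trans (by rintro _ ⟨y, _, rfl⟩; exact y.2)
    have hBeq : ((↑) '' ((↑) ⁻¹' (γ i '' A) : Set C) : Set F) = γ i '' A := by
      rw [Subtype.image_preimage_coe, Set.inter_eq_right.2 hBC]
    have hBirr : IsIrreducible ((↑) ⁻¹' (γ i '' A) : Set C) := by
      have := hγirr i A hA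
      rw [← hBeq] at this
      refine ⟨this.nonempty.of_image, ?_⟩
      rintro U V hU hV ⟨x, hxA, hxU⟩ ⟨y, hyA, hyV⟩
      obtain ⟨U', hU', rfl⟩ := isOpen_induced_iff.1 hU
      obtain ⟨V', hV', rfl⟩ := isOpen_induced_iff.1 hV
      obtain ⟨_, ⟨z, hz, rfl⟩, hzU, hzV⟩ := this.2 U' V' hU' hV' ⟨x, ⟨x, hxA, rfl⟩, hxU⟩
        ⟨y, ⟨y, hyA, rfl⟩, hyV⟩
      exact ⟨z, hz, hzU, hzV⟩
    refine ⟨⟨_, hBirr, hBc.preimage continuous_subtype_val⟩, ?_, ?_⟩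
    · refine lt_of_le_of_ne ?_ ?_
      · intro x hx
        obtain ⟨y, hy, hyx⟩ := hi hx
        rwa [← Subtype.ext hyx]
      · rintro rfl
        refine hW.ne ?_
        apply IrreducibleCloseds.ext
        change _ = ρ '' ((↑) '' ((↑) ⁻¹' (γ i '' A) : Set C))
        rw [hBeq, hργ, hAW]
    · apply IrreducibleCloseds.ext
      change ρ '' ((↑) '' ((↑) ⁻¹' (γ i '' A) : Set C)) = _
      rw [hBeq, hργ, hAW]
  · have : IrreducibleSpace C := isIrreducible_iff_irreducibleSpace.1 hCirr
    refine ⟨⟨Set.univ, IrreducibleSpace.isIrreducible_univ C, isClosed_univ⟩, fun W y _ => ?_⟩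
    change y ∈ ρ '' ((↑) '' (Set.univ : Set C))
    rw [Set.image_univ, Subtype.range_coe, hρC]
    trivial

end Quotient

end QuadricPencil

namespace QuadricPencil

open TopologicalSpace

/-! ### The dimension of `PGL₂` -/

/-! ### Cone ideals and the upper bound for the dimension of a projective set -/

section UpperBound

variable {σ : Type*}

/-- The ideal of polynomials which vanish on the cone over a subset of `S`. -/
def coneIdeal {S : Set (ℙ ℂ (σ → ℂ))} (Z : Set S) : Ideal (MvPolynomial σ ℂ) where
  carrier := {p | ∀ (u : σ → ℂ) (hu : u ≠ 0) (hS : Projectivization.mk ℂ u hu ∈ S),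
    (⟨_, hS⟩ : S) ∈ Z → MvPolynomial.eval u p = 0}
  zero_mem' := fun _ _ _ _ => map_zero _
  add_mem' := by
    intro p q hp hq u hu hS hZ
    simp [hp u hu hS hZ, hq u hu hS hZ]
  smul_mem' := by
    intro r p hp u hu hS hZ
    simp [hp u hu hS hZ]

/-- The points with a representative where p, respectively q, does not vanish form open subsets of
S. If both meet the irreducible Z they meet in a common point of Z, and on its line p and q are
nonzero polynomials in one variable with a product vanishing away from the origin. -/
theorem coneIdeal_isPrime {S : Set (ℙ ℂ (σ → ℂ))} {Z : Set S}
    (hZ : @IsIrreducible _ (zariskiOn S) Z) : (coneIdeal Z).IsPrime := by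
  let _ := zariskiOn S
  refine ⟨?_, ?_⟩
  · intro h
    have h1 : (1 : MvPolynomial σ ℂ) ∈ coneIdeal Z := h ▸ Submodule.mem_top
    obtain ⟨⟨x, hx⟩, hxZ⟩ := hZ.nonempty
    have := h1 x.rep x.rep_nonzero (by rwa [x.mk_rep]) (by convert hxZ; exact x.mk_rep)
    simp at this
  · intro p q hpq
    by_contra! hcon
    have hopen : ∀ p : MvPolynomial σ ℂ, IsOpen {x : S | ∃ (u : σ → ℂ) (hu : u ≠ 0),
        x.1 = Projectivization.mk ℂ u hu ∧ MvPolynomial.eval u p ≠ 0} := by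
      intro p
      rw [isOpen_zariskiOn_iff]
      rintro v hv hS ⟨u, hu, huv, hpu⟩
      obtain ⟨a, rfl⟩ := (Projectivization.mk_eq_mk_iff' ℂ _ _ hv hu).1 huv |>.imp fun a ha => ha.symm
      by_cases ha : a = 0
      · simp [ha] at hv
      refine ⟨fun w => MvPolynomial.eval (a⁻¹ • w) p,
        IsPoly.eval p (G := fun w => a⁻¹ • w) fun i => (IsPoly.const a⁻¹).mul (IsPoly.coord i),
        by simpa [smul_smul, ha] using hpu, fun w hw hS' hpw => ?_⟩
      exact ⟨a⁻¹ • w, smul_ne_zero (inv_ne_zero ha) hw,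
        (Projectivization.mk_eq_mk_iff' ℂ _ _ _ _).2 ⟨a, by simp [smul_smul, ha]⟩, hpw⟩
    have hne : ∀ p ∉ coneIdeal Z, (Z ∩ {x : S | ∃ (u : σ → ℂ) (hu : u ≠ 0),
        x.1 = Projectivization.mk ℂ u hu ∧ MvPolynomial.eval u p ≠ 0}).Nonempty := by
      intro p hp
      have hp' : ¬ ∀ (u : σ → ℂ) (hu : u ≠ 0) (hS : Projectivization.mk ℂ u hu ∈ S),
        (⟨_, hS⟩ : S) ∈ Z → MvPolynomial.eval u p = 0 := hp
      push Not at hp'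
      obtain ⟨u, hu, hS, hZu, hpu⟩ := hp'
      exact ⟨_, hZu, u, hu, rfl, hpu⟩
    obtain ⟨⟨x, hx⟩, hxZ, ⟨u, hu, hxu, hpu⟩, ⟨v, hv, hxv, hqv⟩⟩ :=
      hZ.2 _ _ (hopen p) (hopen q) (hne p hcon.1) (hne q hcon.2)
    dsimp only at hxu hxv
    obtain ⟨P, hP⟩ := IsPoly.along_line ⟨p, fun _ => rfl⟩ u
    obtain ⟨Q, hQ⟩ := IsPoly.along_line ⟨q, fun _ => rfl⟩ u
    obtain ⟨a, ha⟩ := (Projectivization.mk_eq_mk_iff' ℂ _ _ hv hu).1 (hxv.symm.trans hxu)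
    have hP0 : P ≠ 0 := by
      rintro rfl
      have := hP 1
      simp only [one_smul, Polynomial.eval_zero] at this
      exact hpu this
    have hQ0 : Q ≠ 0 := by
      rintro rfl
      have := hQ a
      rw [ha, Polynomial.eval_zero] at this
      exact hqv this
    -- The factor X takes care of the origin of the line, which does not belong to the cone.
    have h0 : Polynomial.X * (P * Q) = 0 := by
      refine Polynomial.funext fun b => ?_
      rw [Polynomial.eval_mul, Polynomial.eval_X, Polynomial.eval_zero]
      by_cases hb : b = 0
      · simp [hb]
      have hbx : Projectivization.mk ℂ (b • u) (smul_ne_zero hb hu) = x := by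
        rw [hxu, Projectivization.mk_eq_mk_iff']
        exact ⟨b, rfl⟩
      subst hbx
      have := hpq (b • u) (smul_ne_zero hb hu) hx hxZ
      rw [map_mul] at this
      rw [Polynomial.eval_mul, ← hP, ← hQ, this, mul_zero]
    rcases mul_eq_zero.1 h0 with h | h
    · exact Polynomial.X_ne_zero h
    · exact mul_ne_zero hP0 hQ0 h

theorem coneIdeal_lt {S : Set (ℙ ℂ (σ → ℂ))} {Z Z' : Set S} (hZ : @IsClosed _ (zariskiOn S) Z)
    (h : Z ⊂ Z') : coneIdeal Z' < coneIdeal Z := by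
  obtain ⟨hsub, hne⟩ := Set.ssubset_iff_subset_ne.1 h
  obtain ⟨⟨x, hx⟩, hxZ', hxZ⟩ := Set.exists_of_ssubset h
  induction x using Projectivization.ind with
  | h v hv =>
    obtain ⟨f, ⟨p, hp⟩, hfv, hf⟩ := isOpen_zariskiOn_iff.1
      (@IsClosed.isOpen_compl _ (zariskiOn S) _ hZ) v hv hx hxZ
    refine lt_of_le_of_ne (fun q hq u hu hS hZu => hq u hu hS (hsub hZu)) fun heq => ?_
    have hpZ : p ∈ coneIdeal Z := by
      intro u hu hS hZu
      by_contra hpu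
      exact hf u hu hS (by rwa [hp]) hZu
    rw [← heq] at hpZ
    exact hfv (by rw [hp]; exact hpZ v hv hx hxZ')

/-- The maximal ideal of the origin is a further prime strictly above every cone ideal. It accounts
for the difference by one between the dimensions of a projective set and its affine cone. -/
theorem coneIdeal_lt_ker {S : Set (ℙ ℂ (σ → ℂ))} {Z : Set S} (hZ : Z.Nonempty) :
    coneIdeal Z < RingHom.ker (MvPolynomial.eval (0 : σ → ℂ)) := by
  obtain ⟨⟨x, hx⟩, hxZ⟩ := hZ
  induction x using Projectivization.ind with
  | h v hv =>
    refine lt_of_le_of_ne ?_ ?_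
    · intro p hp
      rw [RingHom.mem_ker]
      obtain ⟨P, hP⟩ := IsPoly.along_line ⟨p, fun _ => rfl⟩ v
      have h0 : Polynomial.X * P = 0 := by
        refine Polynomial.funext fun b => ?_
        rw [Polynomial.eval_mul, Polynomial.eval_X, Polynomial.eval_zero]
        by_cases hb : b = 0
        · simp [hb]
        have hbx : Projectivization.mk ℂ (b • v) (smul_ne_zero hb hv) =
            Projectivization.mk ℂ v hv := by
          rw [Projectivization.mk_eq_mk_iff']
          exact ⟨b, rfl⟩
        rw [← hP, hp (b • v) (smul_ne_zero hb hv) (hbx ▸ hx)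
          (by convert hxZ), mul_zero]
      have hP0 := (mul_eq_zero.1 h0).resolve_left Polynomial.X_ne_zero
      have := hP 0
      rwa [zero_smul, hP0, Polynomial.eval_zero] at this
    · intro heq
      obtain ⟨i, hi⟩ := Function.ne_iff.1 hv
      have : (MvPolynomial.X i : MvPolynomial σ ℂ) ∈ coneIdeal Z := by
        rw [heq, RingHom.mem_ker]
        simp
      have := this v hv hx hxZ
      simp only [MvPolynomial.eval_X] at this
      exact hi this

/-- Irreducible closed subsets, together with a new bottom element standing for the origin, map
strictly and order-reversingly to primes of the polynomial ring, whose Krull dimension is the number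
of variables. -/
theorem topologicalKrullDim_add_one_le [Finite σ] (S : Set (ℙ ℂ (σ → ℂ))) (hS : S.Nonempty) :
    @topologicalKrullDim S (zariskiOn S) + 1 ≤ Nat.card σ := by
  let _ := zariskiOn S
  let f : WithBot (IrreducibleCloseds S) → (PrimeSpectrum (MvPolynomial σ ℂ))ᵒᵈ := fun Z =>
    WithBot.recBotCoe (OrderDual.toDual ⟨_, RingHom.ker_isPrime (MvPolynomial.eval (0 : σ → ℂ))⟩)
      (fun Z => OrderDual.toDual ⟨coneIdeal (Z : Set S), coneIdeal_isPrime Z.isIrreducible⟩) Z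
  have hf : StrictMono f := by
    intro Z Z' h
    induction Z' using WithBot.recBotCoe with
    | bot => exact absurd h not_lt_bot
    | coe Z' =>
      induction Z using WithBot.recBotCoe with
      | bot => exact coneIdeal_lt_ker Z'.isIrreducible.nonempty
      | coe Z =>
        have h' : Z < Z' := by simpa using h
        exact coneIdeal_lt Z.isClosed h'
  have : Nonempty (IrreducibleCloseds S) := by
    obtain ⟨x, hx⟩ := hS
    exact ⟨⟨closure {⟨x, hx⟩}, isIrreducible_singleton.closure, isClosed_closure⟩⟩
  have h1 := Order.krullDim_le_of_strictMono f hf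
  rw [Order.krullDim_withBot, Order.krullDim_orderDual] at h1
  refine h1.trans ?_
  change ringKrullDim (MvPolynomial σ ℂ) ≤ _
  rw [MvPolynomial.ringKrullDim_of_isNoetherianRing, ringKrullDim_eq_zero_of_field]
  simp

end UpperBound

/-- The determinant of the matrix with rows `(g 0, g 1)` and `(g 2, g 3)`. -/
def det₂ (g : Fin 4 → ℂ) : ℂ := g 0 * g 3 - g 1 * g 2

theorem isPoly_det₂ : IsPoly det₂ :=
  ((IsPoly.coord 0).mul (IsPoly.coord 3)).sub ((IsPoly.coord 1).mul (IsPoly.coord 2))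

theorem det₂_smul (a : ℂ) (g : Fin 4 → ℂ) : det₂ (a • g) = a ^ 2 * det₂ g := by
  simp [det₂]; ring

theorem ne_zero_of_det₂_ne_zero {g : Fin 4 → ℂ} (hg : det₂ g ≠ 0) : g ≠ 0 := by
  rintro rfl
  simp [det₂] at hg

/-- The group `PGL₂`, as an open subset of the projective space of matrices. -/
def PGL₂ : Set (ℙ ℂ (Fin 4 → ℂ)) := {x | det₂ x.rep ≠ 0}

theorem mk_mem_PGL₂ {g : Fin 4 → ℂ} (hg : g ≠ 0) :
    Projectivization.mk ℂ g hg ∈ PGL₂ ↔ det₂ g ≠ 0 := by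
  obtain ⟨a, ha⟩ := Projectivization.exists_smul_eq_mk_rep ℂ g hg
  change det₂ (Projectivization.mk ℂ g hg).rep ≠ 0 ↔ _
  rw [← ha, Units.smul_def, det₂_smul]
  simp

/-- The subset of fixed points of an idempotent linear map. -/
def fixedPart (l : (Fin 4 → ℂ) → Fin 4 → ℂ) : Set PGL₂ := {x | l x.1.rep = x.1.rep}

section FixedPart

variable {l : (Fin 4 → ℂ) → Fin 4 → ℂ}

theorem mk_mem_fixedPart (hl : ∀ (a : ℂ) v, l (a • v) = a • l v) {g : Fin 4 → ℂ} (hg : g ≠ 0)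
    (h : Projectivization.mk ℂ g hg ∈ PGL₂) : (⟨_, h⟩ : PGL₂) ∈ fixedPart l ↔ l g = g := by
  obtain ⟨a, ha⟩ := Projectivization.exists_smul_eq_mk_rep ℂ g hg
  change l (Projectivization.mk ℂ g hg).rep = _ ↔ _
  rw [← ha, Units.smul_def, hl]
  exact (smul_right_injective _ a.ne_zero).eq_iff

theorem isClosed_fixedPart (hl : ∀ (a : ℂ) v, l (a • v) = a • l v)
    (hp : ∀ i, IsPoly fun v => l v i) : @IsClosed _ (zariskiOn PGL₂) (fixedPart l) := by
  let _ := zariskiOn PGL₂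
  rw [← isOpen_compl_iff, isOpen_zariskiOn_iff]
  intro v hv hS hvA
  rw [Set.mem_compl_iff, mk_mem_fixedPart hl hv hS] at hvA
  obtain ⟨i, hi⟩ := Function.ne_iff.1 hvA
  refine ⟨fun u => l u i - u i, (hp i).sub (IsPoly.coord i), sub_ne_zero.2 hi,
    fun u hu hS' hfu => ?_⟩
  rw [Set.mem_compl_iff, mk_mem_fixedPart hl hu hS']
  intro h
  exact hfu (sub_eq_zero.2 (congrFun h i))

/-- The fixed vectors are the image of an affine space under the projection l, and on an affine
space two nonzero polynomial functions have a common point of nonvanishing. -/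
theorem isIrreducible_fixedPart (hl : ∀ (a : ℂ) v, l (a • v) = a • l v)
    (hp : ∀ i, IsPoly fun v => l v i) (hll : ∀ v, l (l v) = l v) {g : Fin 4 → ℂ}
    (hg : det₂ g ≠ 0) (hlg : l g = g) : @IsIrreducible _ (zariskiOn PGL₂) (fixedPart l) := by
  let _ := zariskiOn PGL₂
  refine ⟨⟨⟨_, (mk_mem_PGL₂ (ne_zero_of_det₂_ne_zero hg)).2 hg⟩,
    (mk_mem_fixedPart hl _ _).2 hlg⟩, ?_⟩
  rintro U V hU hV ⟨⟨x, hx⟩, hxZ, hxU⟩ ⟨⟨y, hy⟩, hyZ, hyV⟩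
  induction x using Projectivization.ind with
  | h u hu =>
  induction y using Projectivization.ind with
  | h v hv =>
    rw [mk_mem_fixedPart hl] at hxZ hyZ
    obtain ⟨f, hf, hfu, hfU⟩ := isOpen_zariskiOn_iff.1 hU u hu hx hxU
    obtain ⟨f', hf', hfv, hfV⟩ := isOpen_zariskiOn_iff.1 hV v hv hy hyV
    obtain ⟨w, hw, hw'⟩ := IsPoly.exists_mul_ne_zero (f := fun w => f (l w) * det₂ (l w))
      (g := fun w => f' (l w)) (u := u) (v := v) ((hf.comp hp).mul (isPoly_det₂.comp hp))
      (hf'.comp hp) (by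
        rw [hxZ]
        exact mul_ne_zero hfu ((mk_mem_PGL₂ hu).1 hx)) (by rwa [hyZ])
    have hlw := right_ne_zero_of_mul hw
    have h0 := ne_zero_of_det₂_ne_zero hlw
    have hS := (mk_mem_PGL₂ h0).2 hlw
    exact ⟨⟨_, hS⟩, (mk_mem_fixedPart hl h0 hS).2 (hll w),
      hfU _ h0 hS (left_ne_zero_of_mul hw), hfV _ h0 hS hw'⟩

theorem fixedPart_lt {l' : (Fin 4 → ℂ) → Fin 4 → ℂ} (hl : ∀ (a : ℂ) v, l (a • v) = a • l v)
    (hl' : ∀ (a : ℂ) v, l' (a • v) = a • l' v) (h : ∀ v, l v = v → l' v = v) {g : Fin 4 → ℂ}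
    (hg : det₂ g ≠ 0) (hlg : l g ≠ g) (hlg' : l' g = g) : fixedPart l ⊂ fixedPart l' := by
  refine Set.ssubset_iff_of_subset (fun x hx => h _ hx) |>.2
    ⟨⟨_, (mk_mem_PGL₂ (ne_zero_of_det₂_ne_zero hg)).2 hg⟩, (mk_mem_fixedPart hl' _ _).2 hlg', ?_⟩
  exact fun h => hlg ((mk_mem_fixedPart hl _ _).1 h)

end FixedPart

theorem isIrreducible_univ_PGL₂ : @IsIrreducible _ (zariskiOn PGL₂) Set.univ := by
  have := isIrreducible_fixedPart (l := id) (fun _ _ => rfl) (fun i => IsPoly.coord i)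
    (fun _ => rfl) (g := ![1, 0, 0, 1]) (by simp [det₂]) rfl
  convert this
  exact (Set.eq_univ_of_forall fun x => rfl).symm

/-- The ambient space of matrices has dimension four, which bounds the dimension by three; an
explicit chain of linear sections attains the bound. -/
theorem topologicalKrullDim_PGL₂ : @topologicalKrullDim PGL₂ (zariskiOn PGL₂) = 3 := by
  let _ := zariskiOn PGL₂
  apply le_antisymm
  · have h := topologicalKrullDim_add_one_le PGL₂
      ⟨_, (mk_mem_PGL₂ (ne_zero_of_det₂_ne_zero (g := ![1, 0, 0, 1]) (by simp [det₂]))).2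
        (by simp [det₂])⟩
    rw [Nat.card_eq_fintype_card, Fintype.card_fin] at h
    generalize topologicalKrullDim PGL₂ = d at h
    induction d using WithBot.recBotCoe with
    | bot => exact bot_le
    | coe d =>
      have h4 : ((4 : ℕ) : WithBot ℕ∞) = ((3 + 1 : ℕ∞) : WithBot ℕ∞) := by norm_num
      rw [h4] at h
      exact WithBot.coe_le_coe.2 ((ENat.add_le_add_iff_right (by decide)).1 (WithBot.coe_le_coe.1 h))
  · let L : Fin 4 → (Fin 4 → ℂ) → Fin 4 → ℂ :=
      ![fun v => ![v 0, 0, 0, v 0], fun v => ![v 0, v 1, 0, v 0], fun v => ![v 0, v 1, 0, v 3], id]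
    have hL : ∀ i (a : ℂ) v, L i (a • v) = a • L i v := by
      intro i a v
      fin_cases i <;> simp [L]
    have hp : ∀ i j, IsPoly fun v => L i v j := by
      intro i j
      fin_cases i <;> fin_cases j <;> first | exact IsPoly.coord _ | exact IsPoly.const 0
    have hLL : ∀ i v, L i (L i v) = L i v := by
      intro i v
      fin_cases i <;> simp [L]
    have h1 : ∀ i, L i ![1, 0, 0, 1] = ![1, 0, 0, 1] := by
      intro i
      fin_cases i <;> simp [L]
    let Z : Fin 4 → IrreducibleCloseds PGL₂ := fun i => ⟨fixedPart (L i),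
      isIrreducible_fixedPart (hL i) (hp i) (hLL i) (by simp [det₂]) (h1 i),
      isClosed_fixedPart (hL i) (hp i)⟩
    have hZ : ∀ i : Fin 3, Z i.castSucc < Z i.succ := by
      intro i
      have hw : ∀ i : Fin 3, ∃ g, det₂ g ≠ 0 ∧ L i.castSucc g ≠ g ∧ L i.succ g = g := by
        intro i
        fin_cases i
        · exact ⟨![1, 1, 0, 1], by simp [det₂], by simp [L], by simp [L]⟩
        · exact ⟨![1, 0, 0, 2], by simp [det₂], by simp [L], by simp [L]⟩
        · exact ⟨![1, 0, 1, 1], by simp [det₂], by simp [L], by simp [L]⟩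
      obtain ⟨g, hg, hg1, hg2⟩ := hw i
      refine fixedPart_lt (hL _) (hL _) ?_ hg hg1 hg2
      intro v hv
      rw [← hv]
      fin_cases i <;> simp [L]
    have := (Order.le_krullDim_iff (α := IrreducibleCloseds PGL₂) (n := 3)).2
      ⟨⟨3, Z, hZ⟩, rfl⟩
    exact_mod_cast this

end QuadricPencil

namespace QuadricPencil

/-! ### Lagrange interpolation and the discriminant of the second fundamental form -/

section Lagrange

open Polynomial

variable {n : ℕ} {l : Fin (n + 3) → ℂ}

/-- The products `∏_{j ≠ i} (l i - l j)`. -/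
def nodeWeight (l : Fin (n + 3) → ℂ) (i : Fin (n + 3)) : ℂ :=
  ∏ j ∈ Finset.univ.erase i, (l i - l j)

theorem nodeWeight_ne_zero (hl : Function.Injective l) (i : Fin (n + 3)) :
    nodeWeight l i ≠ 0 := by
  refine Finset.prod_ne_zero_iff.2 fun j hj => sub_ne_zero.2 fun h => ?_
  exact (Finset.mem_erase.1 hj).1 (hl h).symm

/-- With n + 3 nodes, X^(n+2) is the highest power in Lagrange's formula. This identity converts
weighted sums over the nodes into coefficients, and thus quadratic equations in z into degree
conditions. -/
theorem coeff_eq_sum_nodeWeight (hl : Function.Injective l) {P : ℂ[X]}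
    (hP : P.natDegree ≤ n + 2) :
    P.coeff (n + 2) = ∑ i, P.eval (l i) / nodeWeight l i := by
  have h := Lagrange.coeff_eq_sum (s := Finset.univ) (v := l) hl.injOn (P := P) (by
    rw [Finset.card_univ, Fintype.card_fin]
    exact (degree_le_of_natDegree_le hP).trans_lt (by exact_mod_cast Nat.lt_succ_self _))
  rw [Finset.card_univ, Fintype.card_fin] at h
  exact h

/-- The polynomial with values `y i * ∏_{j ≠ i} (l i - l j)` at the nodes `l i`. -/
def interp (l y : Fin (n + 3) → ℂ) : ℂ[X] :=
  Lagrange.interpolate Finset.univ l fun i => y i * nodeWeight l i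

theorem eval_interp (hl : Function.Injective l) (y : Fin (n + 3) → ℂ) (i : Fin (n + 3)) :
    (interp l y).eval (l i) = y i * nodeWeight l i :=
  Lagrange.eval_interpolate_at_node _ hl.injOn (Finset.mem_univ i)

theorem eq_of_eval_nodes_eq (hl : Function.Injective l) {P Q : ℂ[X]} (hP : P.natDegree ≤ n + 2)
    (hQ : Q.natDegree ≤ n + 2) (h : ∀ i, P.eval (l i) = Q.eval (l i)) : P = Q := by
  have hd : ∀ {R : ℂ[X]}, R.natDegree ≤ n + 2 →
      R.degree < (Finset.univ : Finset (Fin (n + 3))).card := by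
    intro R hR
    rw [Finset.card_univ, Fintype.card_fin]
    exact (degree_le_of_natDegree_le hR).trans_lt (by exact_mod_cast Nat.lt_succ_self _)
  exact eq_of_degrees_lt_of_eval_index_eq (s := Finset.univ) (v := l) hl.injOn (hd hP) (hd hQ)
    fun i _ => h i

theorem natDegree_interp_le' (hl : Function.Injective l) (y : Fin (n + 3) → ℂ) :
    (interp l y).natDegree ≤ n + 2 := by
  have h : (interp l y).degree ≤ _ :=
    Lagrange.degree_interpolate_le (s := Finset.univ) (v := l)
      (r := fun i => y i * nodeWeight l i) hl.injOn
  rw [Finset.card_univ, Fintype.card_fin] at h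
  exact natDegree_le_of_degree_le h

/-- Since y_i is the value at l_i divided by the weight, the two sums are the coefficients of
X^(n+2) in P and in X P. For y_i = z_i² their vanishing is the pair of equations of X. -/
theorem natDegree_interp_le (hl : Function.Injective l) {y : Fin (n + 3) → ℂ}
    (h0 : ∑ i, y i = 0) (h1 : ∑ i, l i * y i = 0) : (interp l y).natDegree ≤ n := by
  have hdeg := natDegree_interp_le' hl y
  have hc : ∀ k, n < k → (interp l y).coeff k = 0 := by
    have hc2 : (interp l y).coeff (n + 2) = 0 := by
      rw [coeff_eq_sum_nodeWeight hl hdeg, ← h0]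
      refine Finset.sum_congr rfl fun i _ => ?_
      rw [eval_interp hl, mul_div_cancel_right₀ _ (nodeWeight_ne_zero hl i)]
    have hdeg1 : (interp l y).natDegree ≤ n + 1 := by
      rw [natDegree_le_iff_coeff_eq_zero]
      intro k hk
      rcases (show n + 2 ≤ k from hk).eq_or_lt with rfl | hk'
      · exact hc2
      · exact coeff_eq_zero_of_natDegree_lt (by omega)
    have hc1 : (interp l y).coeff (n + 1) = 0 := by
      rw [← coeff_X_mul, coeff_eq_sum_nodeWeight hl, ← h1]
      · refine Finset.sum_congr rfl fun i _ => ?_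
        rw [eval_mul, eval_X, eval_interp hl, ← mul_assoc,
          mul_div_cancel_right₀ _ (nodeWeight_ne_zero hl i)]
      · exact natDegree_mul_le.trans (by rw [natDegree_X]; omega)
    intro k hk
    rcases (show n + 1 ≤ k from hk).eq_or_lt with rfl | hk'
    · exact hc1
    · exact coeff_eq_zero_of_natDegree_lt (by omega)
  exact natDegree_le_iff_coeff_eq_zero.2 fun k hk => hc k hk

variable {P : ℂ[X]} {z : Fin (n + 3) → ℂ}

/-- Converse of the degree bound: a polynomial of degree at most n has no coefficient in degree n +
2, so its squared coordinates satisfy the equation of the quadric. -/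
theorem sum_sq_eq_zero (hl : Function.Injective l) (hP : P.natDegree ≤ n)
    (hz : ∀ i, z i ^ 2 * nodeWeight l i = P.eval (l i)) : ∑ i, z i ^ 2 = 0 := by
  rw [← coeff_eq_zero_of_natDegree_lt (show P.natDegree < n + 2 by omega),
    coeff_eq_sum_nodeWeight hl (by omega)]
  refine Finset.sum_congr rfl fun i _ => ?_
  rw [← hz, mul_div_cancel_right₀ _ (nodeWeight_ne_zero hl i)]

theorem sum_node_mul_sq_eq_zero (hl : Function.Injective l) (hP : P.natDegree ≤ n)
    (hz : ∀ i, z i ^ 2 * nodeWeight l i = P.eval (l i)) : ∑ i, l i * z i ^ 2 = 0 := by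
  have h : (X * P).natDegree ≤ n + 1 := natDegree_mul_le.trans (by rw [natDegree_X]; omega)
  rw [← coeff_eq_zero_of_natDegree_lt (show (X * P).natDegree < n + 2 by omega),
    coeff_eq_sum_nodeWeight hl (by omega)]
  refine Finset.sum_congr rfl fun i _ => ?_
  rw [eval_mul, eval_X, ← hz, ← mul_assoc, mul_div_cancel_right₀ _ (nodeWeight_ne_zero hl i)]

/-- The next moment reads off the coefficient that vanishes precisely when the form of degree n has
a root at infinity. -/
theorem sum_node_sq_mul_sq (hl : Function.Injective l) (hP : P.natDegree ≤ n)
    (hz : ∀ i, z i ^ 2 * nodeWeight l i = P.eval (l i)) :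
    ∑ i, l i ^ 2 * z i ^ 2 = P.coeff n := by
  have h : (X ^ 2 * P).natDegree ≤ n + 2 :=
    natDegree_mul_le.trans (by rw [natDegree_X_pow]; omega)
  rw [← coeff_X_pow_mul P 2 n, coeff_eq_sum_nodeWeight hl h]
  refine Finset.sum_congr rfl fun i _ => ?_
  rw [eval_mul, eval_pow, eval_X, ← hz, ← mul_assoc,
    mul_div_cancel_right₀ _ (nodeWeight_ne_zero hl i)]

/-- The quotient Q of P - P(t) by X - t has degree below n + 2, so its weighted sum vanishes. This
expresses the sum as P(t) times the barycentric sum at t, which is nonzero. -/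
theorem sum_sq_div_eq_zero_iff (hl : Function.Injective l) (hP : P.natDegree ≤ n)
    (hz : ∀ i, z i ^ 2 * nodeWeight l i = P.eval (l i)) {t : ℂ} (ht : ∀ i, l i ≠ t) :
    ∑ i, z i ^ 2 / (l i - t) = 0 ↔ P.eval t = 0 := by
  obtain ⟨Q, hQ⟩ : X - C t ∣ P - C (P.eval t) := by
    rw [dvd_iff_isRoot, IsRoot, eval_sub, eval_C, sub_self]
  have hQdeg : Q.natDegree ≤ n + 1 := by
    by_cases hQ0 : Q = 0
    · simp [hQ0]
    have h1 : (P - C (P.eval t)).natDegree = 1 + Q.natDegree := by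
      rw [hQ, natDegree_mul (X_sub_C_ne_zero t) hQ0, natDegree_X_sub_C]
    have h2 : (P - C (P.eval t)).natDegree ≤ n := by
      rw [natDegree_sub_C]; exact hP
    omega
  have h0 := coeff_eq_sum_nodeWeight hl (P := Q) (by omega)
  rw [coeff_eq_zero_of_natDegree_lt (by omega)] at h0
  have h1 : ∀ i, Q.eval (l i) / nodeWeight l i =
      z i ^ 2 / (l i - t) - P.eval t * ((nodeWeight l i)⁻¹ * (t - l i)⁻¹) * (-1) := by
    intro i
    have hne := sub_ne_zero.2 (ht i)
    have hne' := sub_ne_zero.2 (ht i).symm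
    have hW := nodeWeight_ne_zero hl i
    have h2 := congrArg (eval (l i)) hQ
    simp only [eval_sub, eval_C, eval_mul, eval_X, ← hz] at h2
    have h3 : (t - l i)⁻¹ = -(l i - t)⁻¹ := by rw [← neg_sub, inv_neg]
    rw [h3]
    field_simp
    linear_combination -h2
  have h2 : ∑ i, z i ^ 2 / (l i - t) =
      -P.eval t * ∑ i, (nodeWeight l i)⁻¹ * (t - l i)⁻¹ := by
    simp only [h1, Finset.sum_sub_distrib] at h0
    rw [Finset.mul_sum, ← sub_eq_zero, ← Finset.sum_sub_distrib, h0, ← Finset.sum_sub_distrib]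
    exact Finset.sum_congr rfl fun i _ => by ring
  have h3 : ∑ i, (nodeWeight l i)⁻¹ * (t - l i)⁻¹ ≠ 0 := by
    have := Lagrange.sum_nodalWeight_mul_inv_sub_ne_zero (s := Finset.univ) (v := l) (x := t)
      hl.injOn (fun i _ => (ht i).symm) Finset.univ_nonempty
    simpa only [Lagrange.nodalWeight, nodeWeight, Finset.prod_inv_distrib] using this
  rw [h2, mul_eq_zero, neg_eq_zero, or_iff_left h3]

/-! ### Degenerate elements in coordinates -/

/-- The vectors which are orthogonal to `z` with respect to `∑ l_i z_i²` and `∑ z_i²`. -/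
def coordTangent (l z : Fin (n + 3) → ℂ) : Submodule ℂ (Fin (n + 3) → ℂ) where
  carrier := {w | ∑ i, l i * z i * w i = 0 ∧ ∑ i, z i * w i = 0}
  zero_mem' := by simp
  add_mem' := by
    rintro a b ⟨h1, h2⟩ ⟨h3, h4⟩
    simp [mul_add, Finset.sum_add_distrib, h1, h2, h3, h4]
  smul_mem' := by
    rintro c a ⟨h1, h2⟩
    have h1' := congrArg (c * ·) h1
    have h2' := congrArg (c * ·) h2
    simp only [Finset.mul_sum, mul_zero] at h1' h2'
    exact ⟨by rw [← h1']; exact Finset.sum_congr rfl fun i _ => by simp; ring,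
      by rw [← h2']; exact Finset.sum_congr rfl fun i _ => by simp; ring⟩

theorem mem_coordTangent {w : Fin (n + 3) → ℂ} :
    w ∈ coordTangent l z ↔ ∑ i, l i * z i * w i = 0 ∧ ∑ i, z i * w i = 0 :=
  Iff.rfl

/-- The linear form `w ↦ ∑ a_i w_i`. -/
def dotForm (a : Fin (n + 3) → ℂ) : (Fin (n + 3) → ℂ) →ₗ[ℂ] ℂ :=
  ∑ i, a i • LinearMap.proj i

theorem dotForm_apply (a w : Fin (n + 3) → ℂ) : dotForm a w = ∑ i, a i * w i := by
  simp [dotForm]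

theorem forall_mem_coordTangent_iff {a : Fin (n + 3) → ℂ} : (∀ w ∈ coordTangent l z, ∑ i, a i * w i = 0) ↔
      ∃ r s : ℂ, ∀ i, a i = r * (l i * z i) + s * z i := by
  constructor
  · intro h
    have : dotForm a ∈ Submodule.span ℂ (Set.range ![dotForm (fun i => l i * z i), dotForm z]) := by
      apply mem_span_of_iInf_ker_le_ker
      intro w hw
      simp only [Submodule.mem_iInf, Fin.forall_fin_two, LinearMap.mem_ker,
        Matrix.cons_val_zero, Matrix.cons_val_one, dotForm_apply] at hw
      rw [LinearMap.mem_ker, dotForm_apply]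
      exact h w hw
    rw [Matrix.range_cons, Matrix.range_cons, Matrix.range_empty, Set.union_empty,
      Set.singleton_union, Submodule.mem_span_pair] at this
    obtain ⟨r, s, hrs⟩ := this
    refine ⟨r, s, fun i => ?_⟩
    have := congrArg (fun f => f (Pi.single i 1)) hrs
    simpa [dotForm_apply, Pi.single_apply, eq_comm] using this
  · rintro ⟨r, s, h⟩ w hw
    have : ∑ i, a i * w i = r * ∑ i, l i * z i * w i + s * ∑ i, z i * w i := by
      rw [Finset.mul_sum, Finset.mul_sum, ← Finset.sum_add_distrib]
      exact Finset.sum_congr rfl fun i _ => by rw [h]; ring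
    rw [this, hw.1, hw.2]
    simp

/-- The restriction of `∑ (s l_i + t) z_i²` to the tangent space at `[z]` is degenerate. -/
def CoordDegenerate (l z : Fin (n + 3) → ℂ) (s t : ℂ) : Prop :=
  ∃ w ∈ coordTangent l z, (∀ a : ℂ, w ≠ a • z) ∧
    ∀ w' ∈ coordTangent l z, ∑ i, (s * l i + t) * w i * w' i = 0

/-- A single nonzero coordinate cannot have square sum zero. Two nonzero coordinates are used below
to see that radical vectors such as (l_i z_i) are not proportional to z. -/
theorem exists_ne_zero_of_sum_sq (hz : z ≠ 0) (hz0 : ∑ i, z i ^ 2 = 0) :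
    ∃ i j, i ≠ j ∧ z i ≠ 0 ∧ z j ≠ 0 := by
  obtain ⟨i, hi⟩ := Function.ne_iff.1 hz
  by_contra! h
  have : ∑ j, z j ^ 2 = z i ^ 2 :=
    Finset.sum_eq_single i (fun j _ hj => by rw [h i j hj.symm hi]; ring) (by simp)
  rw [hz0] at this
  exact hi (by simpa using this.symm)

/-- With c = -t/s, a radical vector can be taken with (l_i - c) w_i = r z_i. If c is not a node then
w is a multiple of z_i / (l_i - c), and tangency is the equation ∑ z_i² / (l_i - c) = 0. If c =
l_{i₀}, a radical vector exists exactly when z_{i₀} = 0, namely the basis vector at i₀. -/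
theorem coordDegenerate_iff_of_ne (hl : Function.Injective l) (hP : P.natDegree ≤ n)
    (hzP : ∀ i, z i ^ 2 * nodeWeight l i = P.eval (l i)) (hz : z ≠ 0) {s t : ℂ} (hs : s ≠ 0) :
    CoordDegenerate l z s t ↔ P.eval (-t / s) = 0 := by
  have hz0 := sum_sq_eq_zero hl hP hzP
  have hz1 := sum_node_mul_sq_eq_zero hl hP hzP
  set c := -t / s with hc
  have hst : ∀ i, s * l i + t = s * (l i - c) := fun i => by rw [hc]; field_simp; ring
  have hzmem : z ∈ coordTangent l z :=
    ⟨by rw [← hz1]; exact Finset.sum_congr rfl fun i _ => by ring,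
      by rw [← hz0]; exact Finset.sum_congr rfl fun i _ => by ring⟩
  have key : CoordDegenerate l z s t ↔ ∃ w ∈ coordTangent l z, (∀ a : ℂ, w ≠ a • z) ∧
      ∃ r, ∀ i, (l i - c) * w i = r * z i := by
    constructor
    · rintro ⟨w, hw, hwz, H⟩
      obtain ⟨q, r, hqr⟩ := forall_mem_coordTangent_iff.1 H
      -- The multipliers give s (l_i - c) w_i = (q l_i + r) z_i; subtracting a multiple of z, which
      -- is harmless in the tangent space, removes the part growing with l_i.
      refine ⟨w - (q / s) • z, Submodule.sub_mem _ hw (Submodule.smul_mem _ _ hzmem), ?_,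
        (r + q * c) / s, fun i => ?_⟩
      · intro a ha
        exact hwz (a + q / s) (by rw [add_smul, ← ha]; simp)
      · have := hqr i
        rw [hst] at this
        simp only [Pi.sub_apply, Pi.smul_apply, smul_eq_mul]
        field_simp
        linear_combination this
    · rintro ⟨w, hw, hwz, r, hr⟩
      refine ⟨w, hw, hwz, forall_mem_coordTangent_iff.2 ⟨0, s * r, fun i => ?_⟩⟩
      rw [hst, mul_assoc, hr]
      ring
  rw [key]
  by_cases hcl : ∃ i, l i = c
  · obtain ⟨i₀, hi₀⟩ := hcl
    rw [← hi₀, ← hzP, mul_eq_zero, or_iff_left (nodeWeight_ne_zero hl i₀), sq_eq_zero_iff]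
    constructor
    · rintro ⟨w, hw, hwz, r, hr⟩
      by_contra h0
      have hr0 : r = 0 := by
        have := hr i₀
        rw [hi₀, sub_self, zero_mul] at this
        exact (mul_eq_zero.1 this.symm).resolve_right h0
      have hw0 : ∀ i ≠ i₀, w i = 0 := by
        intro i hi
        have := hr i
        rw [hr0, zero_mul] at this
        exact (mul_eq_zero.1 this).resolve_left (sub_ne_zero.2 (hl.ne hi))
      have h1 := hw.2
      rw [Finset.sum_eq_single i₀ (fun i _ hi => by rw [hw0 i hi, mul_zero]) (by simp)] at h1
      have h2 := (mul_eq_zero.1 h1).resolve_left h0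
      refine hwz 0 (funext fun i => ?_)
      by_cases hi : i = i₀
      · simp [hi, h2]
      · simp [hw0 i hi]
    · intro h0
      refine ⟨Pi.single i₀ 1, ⟨?_, ?_⟩, ?_, 0, fun i => ?_⟩
      · simp [Pi.single_apply, h0]
      · simp [Pi.single_apply, h0]
      · intro a ha
        have := congrFun ha i₀
        simp [h0] at this
      · by_cases hi : i = i₀
        · simp [hi, hi₀]
        · simp [hi]
  · push Not at hcl
    rw [← sum_sq_div_eq_zero_iff hl hP hzP hcl]
    have hne : ∀ i, l i - c ≠ 0 := fun i => sub_ne_zero.2 (hcl i)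
    constructor
    · rintro ⟨w, hw, hwz, r, hr⟩
      have hwi : ∀ i, w i = r * (z i / (l i - c)) := by
        intro i
        rw [mul_div_assoc', eq_div_iff (hne i), mul_comm, hr]
      have hr0 : r ≠ 0 := by
        rintro rfl
        exact hwz 0 (funext fun i => by simp [hwi])
      have h1 := hw.2
      have h2 : ∑ i, z i * w i = r * ∑ i, z i ^ 2 / (l i - c) := by
        rw [Finset.mul_sum]
        exact Finset.sum_congr rfl fun i _ => by rw [hwi]; ring
      rw [h2] at h1
      exact (mul_eq_zero.1 h1).resolve_left hr0
    · intro h0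
      have h2 : ∑ i, z i * (z i / (l i - c)) = 0 := by
        rw [← h0]
        exact Finset.sum_congr rfl fun i _ => by ring
      refine ⟨fun i => z i / (l i - c), ⟨?_, h2⟩, ?_, 1, fun i => ?_⟩
      · have h3 : ∑ i, l i * z i * (z i / (l i - c)) =
            ∑ i, z i ^ 2 + c * ∑ i, z i * (z i / (l i - c)) := by
          rw [Finset.mul_sum, ← Finset.sum_add_distrib]
          refine Finset.sum_congr rfl fun i _ => ?_
          have := hne i
          field_simp
          ring
        rw [h3, hz0, h2]
        simp
      · intro a ha
        obtain ⟨i, j, hij, hi, hj⟩ := exists_ne_zero_of_sum_sq hz hz0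
        have hai : ∀ i, z i ≠ 0 → a * (l i - c) = 1 := by
          intro i hi
          have := congrFun ha i
          simp only [Pi.smul_apply, smul_eq_mul] at this
          rw [div_eq_iff (hne i)] at this
          have h4 : z i * (a * (l i - c)) = z i * 1 := by linear_combination -this
          exact mul_left_cancel₀ hi h4
        have h5 := (hai i hi).trans (hai j hj).symm
        have ha0 : a ≠ 0 := by
          rintro rfl
          simpa using hai i hi
        have h6 := mul_left_cancel₀ ha0 h5
        exact hij (hl (sub_left_injective h6))
      · have := hne i
        field_simp

/-- The root at infinity. The only candidate for a radical vector of φ₂, modulo z and up to scaling,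
is (l_i z_i), and it is tangent exactly when ∑ l_i² z_i² = 0. -/
theorem coordDegenerate_zero_iff (hl : Function.Injective l) (hP : P.natDegree ≤ n)
    (hzP : ∀ i, z i ^ 2 * nodeWeight l i = P.eval (l i)) (hz : z ≠ 0) {t : ℂ} (ht : t ≠ 0) :
    CoordDegenerate l z 0 t ↔ P.coeff n = 0 := by
  have hz0 := sum_sq_eq_zero hl hP hzP
  have hz1 := sum_node_mul_sq_eq_zero hl hP hzP
  rw [← sum_node_sq_mul_sq hl hP hzP]
  constructor
  · rintro ⟨w, hw, hwz, H⟩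
    obtain ⟨q, r, hqr⟩ := forall_mem_coordTangent_iff.1 H
    have hwi : ∀ i, w i = (q / t) * (l i * z i) + (r / t) * z i := by
      intro i
      have := hqr i
      field_simp
      linear_combination this
    have hq : q / t ≠ 0 := by
      intro h
      exact hwz (r / t) (funext fun i => by rw [hwi, h]; simp)
    have h1 := hw.1
    have h2 : ∑ i, l i * z i * w i =
        (q / t) * ∑ i, l i ^ 2 * z i ^ 2 + (r / t) * ∑ i, l i * z i ^ 2 := by
      rw [Finset.mul_sum, Finset.mul_sum, ← Finset.sum_add_distrib]
      exact Finset.sum_congr rfl fun i _ => by rw [hwi]; ring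
    rw [h2, hz1, mul_zero, add_zero] at h1
    exact (mul_eq_zero.1 h1).resolve_left hq
  · intro h0
    refine ⟨fun i => l i * z i, ⟨?_, ?_⟩, ?_, forall_mem_coordTangent_iff.2
      ⟨t, 0, fun i => by ring⟩⟩
    · rw [← h0]
      exact Finset.sum_congr rfl fun i _ => by ring
    · rw [← hz1]
      exact Finset.sum_congr rfl fun i _ => by ring
    · intro a ha
      obtain ⟨i, j, hij, hi, hj⟩ := exists_ne_zero_of_sum_sq hz hz0
      have hai : ∀ i, z i ≠ 0 → l i = a := fun i hi =>
        mul_right_cancel₀ hi (congrFun ha i)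
      exact hij (hl ((hai i hi).trans (hai j hj).symm))

end Lagrange

end QuadricPencil

namespace QuadricPencil

open Polynomial

/-! ### Families of polynomials in one variable and symmetric functions of their roots -/

/-- A family of polynomials in one variable, the coefficients of which are polynomial functions of
the parameters. -/
def IsPolyFamily {σ : Type*} (P : (σ → ℂ) → ℂ[X]) : Prop :=
  ∀ k, IsPoly fun v => (P v).coeff k

namespace IsPolyFamily

variable {σ : Type*} {P Q : (σ → ℂ) → ℂ[X]}

theorem fixed (p : ℂ[X]) : IsPolyFamily (fun _ : σ → ℂ => p) := fun _ => IsPoly.const _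

theorem add (hP : IsPolyFamily P) (hQ : IsPolyFamily Q) : IsPolyFamily fun v => P v + Q v := by
  intro k
  simp only [coeff_add]
  exact (hP k).add (hQ k)

theorem mul (hP : IsPolyFamily P) (hQ : IsPolyFamily Q) : IsPolyFamily fun v => P v * Q v := by
  intro k
  simp only [coeff_mul]
  exact IsPoly.sum _ fun p => (hP p.1).mul (hQ p.2)

theorem C {f : (σ → ℂ) → ℂ} (hf : IsPoly f) : IsPolyFamily fun v => Polynomial.C (f v) := by
  intro k
  by_cases hk : k = 0
  · subst hk
    simpa using hf
  · simpa [coeff_C, hk] using IsPoly.const (σ := σ) 0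

theorem sum {ι : Type*} (s : Finset ι) {F : ι → (σ → ℂ) → ℂ[X]} (hF : ∀ i, IsPolyFamily (F i)) :
    IsPolyFamily fun v => ∑ i ∈ s, F i v := by
  intro k
  simp only [finsetSum_coeff]
  exact IsPoly.sum _ fun i => hF i k

theorem prod {ι : Type*} (s : Finset ι) {F : ι → (σ → ℂ) → ℂ[X]}
    (hF : ∀ i, IsPolyFamily (F i)) : IsPolyFamily fun v => ∏ i ∈ s, F i v := by
  classical
  induction s using Finset.induction_on with
  | empty => simpa using fixed 1
  | insert a s ha ih =>
    simp only [Finset.prod_insert ha]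
    exact (hF a).mul ih

theorem det {ι : Type*} [Fintype ι] [DecidableEq ι] {M : (σ → ℂ) → Matrix ι ι ℂ[X]}
    (hM : ∀ i j, IsPolyFamily fun v => M v i j) : IsPolyFamily fun v => (M v).det := by
  simp only [Matrix.det_apply']
  exact sum _ fun p => (fixed _).mul (prod _ fun i => hM _ _)

end IsPolyFamily

/-! ### Symmetric functions of roots as polynomials in the coefficients -/

section Symmetric

variable {σ : Type*} {n : ℕ}

theorem coeff_prod_X_sub_C (a : ℂ) (w : Fin n → ℂ) {j : ℕ} (hj : j ≤ n) :
    (C a * ∏ k, (X - C (w k))).coeff (n - j) =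
      a * ((-1) ^ j * MvPolynomial.eval w (MvPolynomial.esymm (Fin n) ℂ j)) := by
  have h := Multiset.prod_X_sub_C_coeff ((Finset.univ : Finset (Fin n)).val.map w)
    (k := n - j) (by simp)
  rw [Multiset.map_map] at h
  simp only [Multiset.card_map, Finset.card_val, Finset.card_univ, Fintype.card_fin] at h
  rw [coeff_C_mul]
  have h' : (∏ k, (X - C (w k))).coeff (n - j) = _ := h
  rw [h', Nat.sub_sub_self hj, ← MvPolynomial.aeval_esymm_eq_multiset_esymm (Fin n) ℂ j w]
  rfl

theorem coeff_prod_X_sub_C_self (a : ℂ) (w : Fin n → ℂ) :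
    (C a * ∏ k, (X - C (w k))).coeff n = a := by
  have := coeff_prod_X_sub_C a w (Nat.zero_le n)
  simpa using this

/-- By Vieta, a times an elementary symmetric function of the roots is a coefficient up to sign.
Exponents of a are equalized by multiplying with the leading coefficient, itself a polynomial
function of the parameters. -/
theorem exists_isPoly_esymm {P : (σ → ℂ) → ℂ[X]} (hP : IsPolyFamily P)
    (Q : MvPolynomial (Fin n) ℂ) : ∃ (N : (σ → ℂ) → ℂ) (M : ℕ), IsPoly N ∧
      ∀ v a (w : Fin n → ℂ), P v = C a * ∏ k, (X - C (w k)) →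
        N v = a ^ M * MvPolynomial.eval (fun i : Fin n =>
          MvPolynomial.eval w (MvPolynomial.esymm (Fin n) ℂ (i + 1))) Q := by
  have hlead : ∀ v a (w : Fin n → ℂ), P v = C a * ∏ k, (X - C (w k)) → (P v).coeff n = a :=
    fun v a w h => by rw [h, coeff_prod_X_sub_C_self]
  induction Q using MvPolynomial.induction_on with
  | C r => exact ⟨fun _ => r, 0, IsPoly.const r, fun v a w _ => by simp⟩
  | add p q hp hq =>
    obtain ⟨N, M, hN, h⟩ := hp
    obtain ⟨N', M', hN', h'⟩ := hq
    refine ⟨fun v => (P v).coeff n ^ M' * N v + (P v).coeff n ^ M * N' v, M + M',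
      (((hP n).pow M').mul hN).add (((hP n).pow M).mul hN'), fun v a w hw => ?_⟩
    dsimp only
    rw [hlead v a w hw, h v a w hw, h' v a w hw, map_add]
    ring
  | mul_X p i hp =>
    obtain ⟨N, M, hN, h⟩ := hp
    refine ⟨fun v => N v * ((-1) ^ ((i : ℕ) + 1) * (P v).coeff (n - ((i : ℕ) + 1))), M + 1,
      hN.mul ((IsPoly.const _).mul (hP _)), fun v a w hw => ?_⟩
    dsimp only
    rw [h v a w hw, hw, coeff_prod_X_sub_C a w (by omega), map_mul, MvPolynomial.eval_X]
    have : ((-1 : ℂ) ^ ((i : ℕ) + 1)) * (-1) ^ ((i : ℕ) + 1) = 1 := by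
      rw [← mul_pow]; simp
    generalize (-1 : ℂ) ^ ((i : ℕ) + 1) = s at this ⊢
    generalize MvPolynomial.eval w (MvPolynomial.esymm (Fin n) ℂ (i + 1)) = e
    generalize MvPolynomial.eval _ p = E
    linear_combination (a ^ (M + 1) * e * E) * this

/-- Symmetrized polynomials in the roots are polynomials in the coefficients, up to a power of the
leading coefficient. -/
theorem exists_isPoly_symmetrization {P : (σ → ℂ) → ℂ[X]} (hP : IsPolyFamily P)
    (h : MvPolynomial (Fin n) ℂ) : ∃ (N : (σ → ℂ) → ℂ) (M : ℕ), IsPoly N ∧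
      ∀ v a (w : Fin n → ℂ), P v = C a * ∏ k, (X - C (w k)) →
        N v = a ^ M * ∑ τ : Equiv.Perm (Fin n), MvPolynomial.eval (w ∘ τ) h := by
  have hsym : (∑ τ : Equiv.Perm (Fin n), MvPolynomial.rename τ h).IsSymmetric := by
    intro e
    rw [map_sum]
    simp only [MvPolynomial.rename_rename]
    exact Fintype.sum_equiv (Equiv.mulLeft e) _ _ fun τ => rfl
  obtain ⟨Q, hQ⟩ := MvPolynomial.esymmAlgHom_fin_surjective (n := n) (m := n) ℂ le_rfl
    ⟨_, hsym⟩
  obtain ⟨N, M, hN, hNM⟩ := exists_isPoly_esymm hP Q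
  refine ⟨N, M, hN, fun v a w hw => ?_⟩
  rw [hNM v a w hw]
  congr 1
  have h1 := congrArg (fun p => MvPolynomial.eval w p.1) hQ
  simp only [MvPolynomial.esymmAlgHom_apply, map_sum, MvPolynomial.eval_rename] at h1
  rw [← h1]
  clear hNM h1 hQ
  induction Q using MvPolynomial.induction_on with
  | C r => simp
  | add p q hp hq => rw [map_add, map_add, map_add, hp, hq]
  | mul_X p i hp => rw [map_mul, map_mul, map_mul, hp, MvPolynomial.eval_X, MvPolynomial.aeval_X]

/-- A common exponent M for the whole family makes the values a single scalar multiple of the vector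
of symmetrizations, as needed for homogeneous coordinates and for quotients. -/
theorem exists_isPoly_symmetrization_family {ι : Type*} [Fintype ι] {P : (σ → ℂ) → ℂ[X]}
    (hP : IsPolyFamily P) (h : ι → MvPolynomial (Fin n) ℂ) :
    ∃ (N : ι → (σ → ℂ) → ℂ) (M : ℕ), (∀ i, IsPoly (N i)) ∧
      ∀ v a (w : Fin n → ℂ), P v = C a * ∏ k, (X - C (w k)) →
        ∀ i, N i v = a ^ M * ∑ τ : Equiv.Perm (Fin n), MvPolynomial.eval (w ∘ τ) (h i) := by
  choose N M hN hNM using fun i => exists_isPoly_symmetrization hP (h i)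
  refine ⟨fun i v => (P v).coeff n ^ (∑ j, M j - M i) * N i v, ∑ j, M j,
    fun i => ((hP n).pow _).mul (hN i), fun v a w hw i => ?_⟩
  dsimp only
  rw [hNM i v a w hw, hw, coeff_prod_X_sub_C_self, ← mul_assoc, ← pow_add,
    Nat.sub_add_cancel (Finset.single_le_sum (fun _ _ => Nat.zero_le _) (Finset.mem_univ i))]

end Symmetric

/-! ### Cross ratios and Möbius transformations -/

section CrossRatio

variable {n : ℕ}

/-- The cross ratios of the quadruples `(w i, w j, w k, w m)`. -/
def crossRatio (i j k : Fin n) (w : Fin n → ℂ) (m : Fin n) : ℂ :=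
  (w m - w i) * (w j - w k) / ((w m - w k) * (w j - w i))

/-- The product of the differences `w p - w q`, over all pairs of distinct indices. -/
def discProd (w : Fin n → ℂ) : ℂ := ∏ p ∈ (Finset.univ : Finset (Fin n)).offDiag, (w p.1 - w p.2)

theorem discProd_ne_zero {w : Fin n → ℂ} (hw : Function.Injective w) : discProd w ≠ 0 := by
  refine Finset.prod_ne_zero_iff.2 fun p hp => sub_ne_zero.2 fun h => ?_
  exact (Finset.mem_offDiag.1 hp).2.2 (hw h)

theorem discProd_comp (w : Fin n → ℂ) (τ : Equiv.Perm (Fin n)) :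
    discProd (w ∘ τ) = discProd w := by
  refine Finset.prod_bij (fun p _ => (τ p.1, τ p.2)) ?_ ?_ ?_ ?_
  · rintro ⟨p, q⟩ h
    simpa using h
  · rintro ⟨p, q⟩ _ ⟨p', q'⟩ _ h
    simpa using h
  · rintro ⟨p, q⟩ h
    refine ⟨(τ.symm p, τ.symm q), by simpa using h, by simp⟩
  · rintro ⟨p, q⟩ h
    rfl

theorem exists_discProd_eq {p q : Fin n} (h : p ≠ q) : ∃ D : MvPolynomial (Fin n) ℂ,
    ∀ w : Fin n → ℂ, discProd w = (w p - w q) * MvPolynomial.eval w D := by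
  classical
  refine ⟨∏ r ∈ (Finset.univ : Finset (Fin n)).offDiag.erase (p, q),
    (MvPolynomial.X r.1 - MvPolynomial.X r.2), fun w => ?_⟩
  simp only [map_prod, map_sub, MvPolynomial.eval_X]
  exact (Finset.mul_prod_erase (Finset.offDiag Finset.univ) (fun r => w r.1 - w r.2)
    (a := (p, q)) (by simpa using h)).symm

/-- Polynomials in the cross ratios are polynomials in the `w i`, up to a power of `discProd`. -/
theorem exists_eval_crossRatio_eq {i j k : Fin n} (hij : i ≠ j)
    (ψ : MvPolynomial (Fin n) ℂ) : ∃ (H : MvPolynomial (Fin n) ℂ) (N : ℕ),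
      ∀ w : Fin n → ℂ, Function.Injective w →
        MvPolynomial.eval w H = discProd w ^ N * MvPolynomial.eval (crossRatio i j k w) ψ := by
  obtain ⟨V, hV⟩ : ∃ V : MvPolynomial (Fin n) ℂ, ∀ w, MvPolynomial.eval w V = discProd w := by
    refine ⟨∏ r ∈ (Finset.univ : Finset (Fin n)).offDiag,
      (MvPolynomial.X r.1 - MvPolynomial.X r.2), fun w => ?_⟩
    simp [discProd]
  induction ψ using MvPolynomial.induction_on with
  | C r => exact ⟨MvPolynomial.C r, 0, fun w _ => by simp⟩
  | add p q hp hq =>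
    obtain ⟨H, N, h⟩ := hp
    obtain ⟨H', N', h'⟩ := hq
    refine ⟨V ^ N' * H + V ^ N * H', N + N', fun w hw => ?_⟩
    simp only [map_add, map_mul, map_pow, h w hw, h' w hw, hV]
    ring
  | mul_X p m hp =>
    obtain ⟨H, N, h⟩ := hp
    -- The k-th cross ratio, which should be infinite, is 0 by the convention for division by zero.
    by_cases hmk : m = k
    · refine ⟨0, 0, fun w _ => ?_⟩
      simp [hmk, crossRatio]
    · obtain ⟨D, hD⟩ := exists_discProd_eq hmk
      obtain ⟨D', hD'⟩ := exists_discProd_eq hij.symm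
      refine ⟨H * ((MvPolynomial.X m - MvPolynomial.X i) *
        (MvPolynomial.X j - MvPolynomial.X k) * D * D'), N + 2, fun w hw => ?_⟩
      have h1 : w m - w k ≠ 0 := sub_ne_zero.2 (hw.ne hmk)
      have h2 : w j - w i ≠ 0 := sub_ne_zero.2 (hw.ne hij.symm)
      simp only [map_mul, map_sub, MvPolynomial.eval_X, h w hw, crossRatio]
      have h3 : discProd w ^ (N + 2) = discProd w ^ N * (discProd w * discProd w) := by ring
      have h4 : discProd w * discProd w =
          ((w m - w k) * MvPolynomial.eval w D) * ((w j - w i) * MvPolynomial.eval w D') := by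
        rw [← hD', ← hD]
      rw [h3, h4]
      field_simp

/-- The product of `2 × 2` matrices. -/
def mul₂ (g h : Fin 4 → ℂ) : Fin 4 → ℂ :=
  ![g 0 * h 0 + g 1 * h 2, g 0 * h 1 + g 1 * h 3, g 2 * h 0 + g 3 * h 2, g 2 * h 1 + g 3 * h 3]

/-- The adjugate of a `2 × 2` matrix. -/
def adj₂ (g : Fin 4 → ℂ) : Fin 4 → ℂ := ![g 3, -g 1, -g 2, g 0]

theorem det₂_mul₂ (g h : Fin 4 → ℂ) : det₂ (mul₂ g h) = det₂ g * det₂ h := by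
  simp [det₂, mul₂]; ring

theorem det₂_adj₂ (g : Fin 4 → ℂ) : det₂ (adj₂ g) = det₂ g := by
  simp [det₂, adj₂]; ring

/-- The Möbius transformation `g` sends `x` to `y`. -/
def Sends (g : Fin 4 → ℂ) (x y : ℂ) : Prop := g 0 * x + g 1 = y * (g 2 * x + g 3)

theorem Sends.den_ne_zero {g : Fin 4 → ℂ} (hg : det₂ g ≠ 0) {x y : ℂ} (h : Sends g x y) :
    g 2 * x + g 3 ≠ 0 := by
  intro h0
  rw [Sends, h0, mul_zero] at h
  apply hg
  by_cases h2 : g 2 = 0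
  · rw [h2, zero_mul, zero_add] at h0
    rw [det₂, h2, h0]; ring
  · have : g 2 * det₂ g = 0 := by
      rw [det₂]
      linear_combination (g 2 * g 0) * h0 - g 2 ^ 2 * h
    exact (mul_eq_zero.1 this).resolve_left h2

theorem Sends.injective {g : Fin 4 → ℂ} (hg : det₂ g ≠ 0) {x x' y : ℂ} (h : Sends g x y)
    (h' : Sends g x' y) : x = x' := by
  have h1 := h.den_ne_zero hg
  have h2 : det₂ g * (x - x') = 0 := by
    rw [Sends] at h h'
    have hy : (g 2 * x + g 3) * (g 0 * x' + g 1) = (g 2 * x' + g 3) * (g 0 * x + g 1) := by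
      rw [h, h']; ring
    rw [det₂]
    linear_combination -hy
  exact sub_eq_zero.1 ((mul_eq_zero.1 h2).resolve_left hg)

theorem Sends.functional {g : Fin 4 → ℂ} (hg : det₂ g ≠ 0) {x y y' : ℂ} (h : Sends g x y)
    (h' : Sends g x y') : y = y' := by
  have h1 := h.den_ne_zero hg
  rw [Sends] at h h'
  exact mul_right_cancel₀ h1 (h.symm.trans h')

/-- The reason for the invariance of cross ratios: differences are multiplied by the determinant and
divided by one factor for each point, and all of these cancel. -/
theorem Sends.sub_eq {g : Fin 4 → ℂ} {x x' y y' : ℂ} (h : Sends g x y)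
    (h' : Sends g x' y') :
    (y - y') * ((g 2 * x + g 3) * (g 2 * x' + g 3)) = det₂ g * (x - x') := by
  rw [Sends] at h h'
  rw [det₂]
  linear_combination -(g 2 * x' + g 3) * h + (g 2 * x + g 3) * h'

theorem crossRatio_eq_of_sends {i j k : Fin n} {g : Fin 4 → ℂ} (hg : det₂ g ≠ 0)
    {w w' : Fin n → ℂ} (h : ∀ m, Sends g (w m) (w' m)) :
    crossRatio i j k w' = crossRatio i j k w := by
  ext m
  have hd : ∀ p, g 2 * w p + g 3 ≠ 0 := fun p => (h p).den_ne_zero hg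
  have hs : ∀ p q, w' p - w' q = det₂ g * (w p - w q) /
      ((g 2 * w p + g 3) * (g 2 * w q + g 3)) := fun p q => by
    rw [eq_div_iff (mul_ne_zero (hd p) (hd q)), (h p).sub_eq (h q)]
  rw [crossRatio, crossRatio, hs, hs, hs, hs]
  have h1 := hd i
  have h2 := hd j
  have h3 := hd k
  have h4 := hd m
  generalize g 2 * w i + g 3 = A at h1 ⊢
  generalize g 2 * w j + g 3 = B at h2 ⊢
  generalize g 2 * w k + g 3 = E at h3 ⊢
  generalize g 2 * w m + g 3 = F at h4 ⊢
  by_cases h5 : w m - w k = 0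
  · simp [h5]
  by_cases h6 : w j - w i = 0
  · simp [h6]
  field_simp

/-- The matrix of the Möbius transformation which sends `(w i, w j, w k)` to `(0, 1, ∞)`. -/
def stdMatrix (i j k : Fin n) (w : Fin n → ℂ) : Fin 4 → ℂ :=
  ![w j - w k, -(w i * (w j - w k)), w j - w i, -(w k * (w j - w i))]

theorem det₂_stdMatrix_ne_zero {i j k : Fin n} (hij : i ≠ j) (hik : i ≠ k) (hjk : j ≠ k)
    {w : Fin n → ℂ} (hw : Function.Injective w) : det₂ (stdMatrix i j k w) ≠ 0 := by
  have : det₂ (stdMatrix i j k w) = (w j - w k) * (w j - w i) * (w i - w k) := by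
    simp [det₂, stdMatrix]; ring
  rw [this]
  exact mul_ne_zero (mul_ne_zero (sub_ne_zero.2 (hw.ne hjk)) (sub_ne_zero.2 (hw.ne hij.symm)))
    (sub_ne_zero.2 (hw.ne hik))

/-- The normalizing transformations of w and w' carry w m and w' m to the same cross ratio; the
matrix is the first followed by the adjugate of the second. -/
theorem sends_of_crossRatio_eq {i j k : Fin n} (hij : i ≠ j)
    {w w' : Fin n → ℂ} (hw : Function.Injective w) (hw' : Function.Injective w')
    (h : crossRatio i j k w' = crossRatio i j k w) (m : Fin n) :
    Sends (mul₂ (adj₂ (stdMatrix i j k w')) (stdMatrix i j k w)) (w m) (w' m) := by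
  have key : (w m - w i) * (w j - w k) * ((w' m - w' k) * (w' j - w' i)) =
      (w' m - w' i) * (w' j - w' k) * ((w m - w k) * (w j - w i)) := by
    by_cases hmk : m = k
    · simp [hmk]
    have h1 : w m - w k ≠ 0 := sub_ne_zero.2 (hw.ne hmk)
    have h2 : w j - w i ≠ 0 := sub_ne_zero.2 (hw.ne hij.symm)
    have h1' : w' m - w' k ≠ 0 := sub_ne_zero.2 (hw'.ne hmk)
    have h2' : w' j - w' i ≠ 0 := sub_ne_zero.2 (hw'.ne hij.symm)
    have h3 := congrFun h m
    rw [crossRatio, crossRatio, div_eq_div_iff (mul_ne_zero h1' h2') (mul_ne_zero h1 h2)] at h3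
    exact h3.symm
  simp only [Sends, mul₂, adj₂, stdMatrix, Matrix.cons_val]
  linear_combination key

/-- Two Möbius transformations which agree at three points coincide. -/
theorem exists_eq_smul_of_sends {g h : Fin 4 → ℂ} (hg : det₂ g ≠ 0) (hh : det₂ h ≠ 0)
    {x y : Fin 3 → ℂ} (hx : Function.Injective x) (hgx : ∀ a, Sends g (x a) (y a))
    (hhx : ∀ a, Sends h (x a) (y a)) : ∃ a : ℂ, a ≠ 0 ∧ h = a • g := by
  -- This transformation fixes three distinct points, so the quadratic fixed point equation vanishes
  -- identically and c is a scalar matrix.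
  set c := mul₂ (adj₂ g) h with hc
  have h1 : ∀ a, c 0 * x a + c 1 = x a * (c 2 * x a + c 3) := by
    intro a
    have h2 := hgx a
    have h3 := hhx a
    rw [Sends] at h2 h3
    simp only [hc, mul₂, adj₂, Matrix.cons_val]
    linear_combination (g 2 * x a + g 3) * h3 - (h 2 * x a + h 3) * h2
  have h01 : x 0 - x 1 ≠ 0 := sub_ne_zero.2 (hx.ne (by decide))
  have h02 : x 0 - x 2 ≠ 0 := sub_ne_zero.2 (hx.ne (by decide))
  have h12 : x 1 - x 2 ≠ 0 := sub_ne_zero.2 (hx.ne (by decide))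
  have e01 : c 0 - c 3 = c 2 * (x 0 + x 1) := by
    apply mul_left_cancel₀ h01
    linear_combination h1 0 - h1 1
  have e02 : c 0 - c 3 = c 2 * (x 0 + x 2) := by
    apply mul_left_cancel₀ h02
    linear_combination h1 0 - h1 2
  have c2 : c 2 = 0 := by
    have : c 2 * (x 1 - x 2) = 0 := by linear_combination e02 - e01
    exact (mul_eq_zero.1 this).resolve_right h12
  have c03 : c 0 = c 3 := by
    rw [c2, zero_mul] at e01
    exact sub_eq_zero.1 e01
  have c1 : c 1 = 0 := by
    have := h1 0
    rw [c2, c03] at this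
    linear_combination this
  have hgc : mul₂ g c = det₂ g • h := by
    ext a
    fin_cases a <;> simp [mul₂, adj₂, det₂, hc] <;> ring
  have hc0 : c 0 ≠ 0 := by
    intro h0
    have hdc : det₂ c = det₂ g * det₂ h := by rw [hc, det₂_mul₂, det₂_adj₂]
    apply mul_ne_zero hg hh
    rw [← hdc, det₂, c2, ← c03, h0]
    ring
  refine ⟨c 0 / det₂ g, div_ne_zero hc0 hg, ?_⟩
  have hgc' : mul₂ g c = c 0 • g := by
    ext a
    fin_cases a <;> simp [mul₂, c1, c2, ← c03] <;> ring
  rw [div_eq_inv_mul, mul_smul, ← hgc', hgc, smul_smul, inv_mul_cancel₀ hg, one_smul]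

/-- The only Möbius transformation which preserves the set `{r_1, …, r_n}` is the identity. -/
def HasTrivialStabilizer (r : Fin n → ℂ) : Prop :=
  ∀ (g : Fin 4 → ℂ) (τ : Equiv.Perm (Fin n)), det₂ g ≠ 0 → (∀ k, Sends g (r k) (r (τ k))) → τ = 1

/-- If a permutation preserved all cross ratios, a Möbius transformation would realize it, so it
would be trivial. Hence each other permutation changes some cross ratio, and the product of the
corresponding normalized linear factors separates. -/
theorem exists_separating {r : Fin n → ℂ} (hr : Function.Injective r)
    (hT : HasTrivialStabilizer r) {i j k : Fin n} (hij : i ≠ j) (hik : i ≠ k) (hjk : j ≠ k) :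
    ∃ ψ : MvPolynomial (Fin n) ℂ, MvPolynomial.eval (crossRatio i j k r) ψ = 1 ∧
      ∀ τ : Equiv.Perm (Fin n), τ ≠ 1 →
        MvPolynomial.eval (crossRatio i j k (r ∘ τ)) ψ = 0 := by
  classical
  have hne : ∀ τ : Equiv.Perm (Fin n), τ ≠ 1 →
      ∃ m, crossRatio i j k (r ∘ τ) m ≠ crossRatio i j k r m := by
    intro τ hτ
    by_contra! h
    refine hτ (hT _ τ ?_ (sends_of_crossRatio_eq hij hr (hr.comp τ.injective) (funext h)))
    rw [det₂_mul₂, det₂_adj₂]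
    exact mul_ne_zero (det₂_stdMatrix_ne_zero hij hik hjk (hr.comp τ.injective))
      (det₂_stdMatrix_ne_zero hij hik hjk hr)
  have : Nonempty (Fin n) := ⟨i⟩
  choose! m hm using hne
  refine ⟨∏ τ ∈ Finset.univ.erase (1 : Equiv.Perm (Fin n)),
    (MvPolynomial.C (crossRatio i j k r (m τ) - crossRatio i j k (r ∘ τ) (m τ))⁻¹ *
      (MvPolynomial.X (m τ) - MvPolynomial.C (crossRatio i j k (r ∘ τ) (m τ)))), ?_, ?_⟩
  · rw [map_prod]
    refine Finset.prod_eq_one fun τ hτ => ?_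
    simp only [map_mul, map_sub, MvPolynomial.eval_C, MvPolynomial.eval_X]
    exact inv_mul_cancel₀ (sub_ne_zero.2 (hm τ (Finset.mem_erase.1 hτ).1).symm)
  · intro τ hτ
    rw [map_prod]
    refine Finset.prod_eq_zero (i := τ) (by simp [hτ]) ?_
    simp

end CrossRatio

end QuadricPencil

namespace QuadricPencil

open QuadraticMap

/-! ### Curves and tangent spaces -/

section Curves

variable {σ : Type*} [Fintype σ]

theorem hasDerivAt_bilin {V : Type*} [NormedAddCommGroup V] [NormedSpace ℂ V]
    [FiniteDimensional ℂ V] (B : V →ₗ[ℂ] V →ₗ[ℂ] ℂ) {c e : ℂ → V} {c' e' : V}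
    {t : ℂ} (hc : HasDerivAt c c' t) (he : HasDerivAt e e' t) :
    HasDerivAt (fun t => B (c t) (e t)) (B c' (e t) + B (c t) e') t := by
  have h1 := (B.toContinuousBilinearMap.hasFDerivAt (x := c t)).comp_hasDerivAt t hc
  exact h1.clm_apply he

theorem hasDerivAt_quadratic (φ : QuadraticForm ℂ (σ → ℂ)) {c : ℂ → σ → ℂ} {c' : σ → ℂ} {t : ℂ}
    (hc : HasDerivAt c c' t) : HasDerivAt (fun t => φ (c t)) (2 * associated φ (c t) c') t := by
  have h := hasDerivAt_bilin (associated φ) hc hc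
  simp only [associated_eq_self_apply] at h
  convert h using 1
  rw [associated_isSymm ℂ φ c' (c t)]
  ring

theorem hasDerivAt_mvPolynomial (p : MvPolynomial σ ℂ) {c : ℂ → σ → ℂ} {c' : σ → ℂ} {t : ℂ}
    (hc : HasDerivAt c c' t) : HasDerivAt (fun t => MvPolynomial.eval (c t) p)
      (∑ i, MvPolynomial.eval (c t) (MvPolynomial.pderiv i p) * c' i) t := by
  classical
  induction p using MvPolynomial.induction_on with
  | C r => simpa using hasDerivAt_const t r
  | add p q hp hq =>
    simp only [map_add, add_mul, Finset.sum_add_distrib]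
    exact hp.add hq
  | mul_X p j hp =>
    simp only [map_mul, MvPolynomial.eval_X, Derivation.leibniz, smul_eq_mul, map_add,
      MvPolynomial.pderiv_X]
    convert! hp.mul (hasDerivAt_pi.1 hc j) using 1
    simp only [add_mul, Finset.sum_add_distrib, Pi.single_apply]
    rw [add_comm, Finset.sum_mul]
    congr 1
    · exact Finset.sum_congr rfl fun i _ => by ring
    · rw [Finset.sum_eq_single j]
      · simp
      · intro i _ hi
        simp [hi.symm]
      · simp

theorem mem_affineTangent_of_curve {S : Set (ℙ ℂ (σ → ℂ))} {c : ℂ → σ → ℂ} {c' : σ → ℂ}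
    (hc : HasDerivAt c c' 0) (hS : ∀ᶠ t in nhds (0 : ℂ), c t ∈ cone S) :
    c' ∈ affineTangent S (c 0) := by
  intro p hp
  have h1 := hasDerivAt_mvPolynomial p hc
  have h2 : HasDerivAt (fun t => MvPolynomial.eval (c t) p) 0 0 :=
    (hasDerivAt_const (0 : ℂ) (0 : ℂ)).congr_of_eventuallyEq (hS.mono fun t ht => hp _ ht)
  exact h1.unique h2

theorem affineTangent_mono {S T : Set (ℙ ℂ (σ → ℂ))} (h : S ⊆ T) (v : σ → ℂ) :
    affineTangent S v ≤ affineTangent T v :=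
  fun _ hw p hp => hw p fun u hu => hp u ⟨hu.1, h hu.2⟩

end Curves

/-! ### Curves on an intersection of two quadrics -/

section Intersection

variable {n : ℕ} {φ₁ φ₂ : QuadraticForm ℂ (Fin (n + 3) → ℂ)}

theorem quadratic_rep_eq_zero_iff (φ : QuadraticForm ℂ (Fin (n + 3) → ℂ)) {v : Fin (n + 3) → ℂ}
    (hv : v ≠ 0) : φ (Projectivization.mk ℂ v hv).rep = 0 ↔ φ v = 0 := by
  obtain ⟨a, ha⟩ := Projectivization.exists_smul_eq_mk_rep ℂ v hv
  rw [← ha, Units.smul_def, QuadraticMap.map_smul]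
  simp

theorem mk_mem_quadricIntersection {v : Fin (n + 3) → ℂ} (hv : v ≠ 0) :
    Projectivization.mk ℂ v hv ∈ quadricIntersection φ₁ φ₂ ↔ φ₁ v = 0 ∧ φ₂ v = 0 := by
  change φ₁ _ = 0 ∧ φ₂ _ = 0 ↔ _
  rw [quadratic_rep_eq_zero_iff, quadratic_rep_eq_zero_iff]

theorem mem_cone_quadricIntersection {v : Fin (n + 3) → ℂ} :
    v ∈ cone (quadricIntersection φ₁ φ₂) ↔ v ≠ 0 ∧ φ₁ v = 0 ∧ φ₂ v = 0 := by
  constructor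
  · rintro ⟨hv, h⟩
    exact ⟨hv, (mk_mem_quadricIntersection hv).1 h⟩
  · rintro ⟨hv, h⟩
    exact ⟨hv, (mk_mem_quadricIntersection hv).2 h⟩

/-- Vectors dual to a pair of independent linear forms. -/
theorem exists_dual_pair {V : Type*} [AddCommGroup V] [Module ℂ V] [FiniteDimensional ℂ V]
    {f g : V →ₗ[ℂ] ℂ} (h : LinearIndependent ℂ ![f, g]) :
    ∃ p q : V, f p = 1 ∧ g p = 0 ∧ f q = 0 ∧ g q = 1 := by
  have key : ∀ f g : V →ₗ[ℂ] ℂ, LinearIndependent ℂ ![f, g] → ∃ p, f p = 1 ∧ g p = 0 := by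
    intro f g h
    by_contra! hcon
    have hker : LinearMap.ker g ≤ LinearMap.ker f := by
      intro v hv
      rw [LinearMap.mem_ker] at hv ⊢
      by_contra hf
      exact hcon ((f v)⁻¹ • v) (by simp [hf]) (by simp [hv])
    have hmem : f ∈ Submodule.span ℂ (Set.range fun _ : Unit => g) := by
      apply mem_span_of_iInf_ker_le_ker
      simpa using hker
    rw [Set.range_const, Submodule.mem_span_singleton] at hmem
    obtain ⟨a, rfl⟩ := hmem
    rw [LinearIndependent.pair_iff] at h
    have := h 1 (-a) (by simp)
    simp at this
  obtain ⟨p, hp⟩ := key f g h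
  obtain ⟨q, hq⟩ := key g f (by
    rw [LinearIndependent.pair_iff] at h ⊢
    intro s t hst
    exact (h t s (by rw [add_comm]; exact hst)).symm)
  exact ⟨p, q, hp.1, hp.2, hq.2, hq.1⟩

theorem exists_dual_vectors (hX : IsNonsingularIntersection φ₁ φ₂) {u : Fin (n + 3) → ℂ}
    (hu : u ∈ cone (quadricIntersection φ₁ φ₂)) :
    ∃ p q, associated φ₁ u p = 1 ∧ associated φ₂ u p = 0 ∧ associated φ₁ u q = 0 ∧
      associated φ₂ u q = 1 := by
  obtain ⟨h0, h1, h2⟩ := mem_cone_quadricIntersection.1 hu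
  exact exists_dual_pair (hX u h0 h1 h2)

/-- Every tangent vector of `X` is the velocity of a curve. -/
theorem exists_curve (hX : IsNonsingularIntersection φ₁ φ₂) {u w : Fin (n + 3) → ℂ}
    (hu : u ∈ cone (quadricIntersection φ₁ φ₂)) (h₁ : associated φ₁ u w = 0)
    (h₂ : associated φ₂ u w = 0) : ∃ c : ℂ → Fin (n + 3) → ℂ, AnalyticAt ℂ c 0 ∧
      (∀ᶠ t in nhds (0 : ℂ), c t ∈ cone (quadricIntersection φ₁ φ₂)) ∧ c 0 = u ∧
      HasDerivAt c w 0 := by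
  obtain ⟨p, q, hp₁, hp₂, hq₁, hq₂⟩ := exists_dual_vectors hX hu
  obtain ⟨hu0, hu1, hu2⟩ := mem_cone_quadricIntersection.1 hu
  -- The curve will be u + t w, corrected in the directions p and q dual to the differentials. The
  -- factor 1/2 compensates for the differential of φ being twice the bilinear form.
  let A : ℂ × ℂ × ℂ →L[ℂ] (Fin (n + 3) → ℂ) :=
    (ContinuousLinearMap.fst ℂ ℂ (ℂ × ℂ)).smulRight w +
    ((2⁻¹ : ℂ) • ((ContinuousLinearMap.fst ℂ ℂ ℂ).comp
      (ContinuousLinearMap.snd ℂ ℂ (ℂ × ℂ)))).smulRight p +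
    ((2⁻¹ : ℂ) • ((ContinuousLinearMap.snd ℂ ℂ ℂ).comp
      (ContinuousLinearMap.snd ℂ ℂ (ℂ × ℂ)))).smulRight q
  have hA : ∀ x, A x = x.1 • w + (2⁻¹ * x.2.1) • p + (2⁻¹ * x.2.2) • q := fun x => rfl
  have hfd : ∀ φ : QuadraticForm ℂ (Fin (n + 3) → ℂ),
      HasFDerivAt (fun x => φ (u + A x))
        ((2 : ℂ) • ((associated φ).toContinuousBilinearMap u).comp A) 0 := by
    intro φ
    have h1 : HasFDerivAt (fun x => u + A x) A 0 := A.hasFDerivAt.const_add u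
    have h2 := HasFDerivAt.comp (0 : ℂ × ℂ × ℂ) (f := fun x => u + A x)
      ((associated φ).toContinuousBilinearMap.hasFDerivAt (x := u + A 0)) h1
    have h3 := h2.clm_apply h1
    have h4 : (fun x => φ (u + A x)) = fun x =>
        (((associated φ).toContinuousBilinearMap ∘ fun x => u + A x) x) (u + A x) := by
      ext x
      exact (associated_eq_self_apply ℂ φ (u + A x)).symm
    rw [h4]
    refine h3.congr_fderiv ?_
    ext <;>
    · simp only [map_zero, add_zero]
      simp [associated_isSymm ℂ φ _ u]
      ring
  have hcd : ∀ φ : QuadraticForm ℂ (Fin (n + 3) → ℂ),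
      ContDiff ℂ ⊤ (fun x => φ (u + A x)) := by
    intro φ
    have h4 : (fun x => φ (u + A x)) = fun x =>
        ((associated φ).toContinuousBilinearMap (u + A x)) (u + A x) := by
      ext x
      exact (associated_eq_self_apply ℂ φ (u + A x)).symm
    rw [h4]
    have h5 : ContDiff ℂ ⊤ (fun x => u + A x) := contDiff_const.add A.contDiff
    exact ((associated φ).toContinuousBilinearMap.contDiff.comp h5).clm_apply h5
  -- The derivative of G at 0 is the identity. Its local inverse along (t, 0, 0) solves both
  -- equations with first parameter t.
  let G : ℂ × ℂ × ℂ → ℂ × ℂ × ℂ := fun x => (x.1, φ₁ (u + A x), φ₂ (u + A x))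
  have hG : HasFDerivAt G ((ContinuousLinearEquiv.refl ℂ (ℂ × ℂ × ℂ) :
      ℂ × ℂ × ℂ →L[ℂ] ℂ × ℂ × ℂ)) 0 := by
    refine (hasFDerivAt_fst.prodMk ((hfd φ₁).prodMk (hfd φ₂))).congr_fderiv ?_
    ext <;> simp [hA, h₁, h₂, hp₁, hp₂, hq₁, hq₂]
  have hGc : ContDiffAt ℂ ⊤ G 0 :=
    (contDiff_fst.prodMk ((hcd φ₁).prodMk (hcd φ₂))).contDiffAt
  have hG0 : G 0 = 0 := by
    simp [G, hu1, hu2]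
  have hinv := hGc.to_localInverse hG (by simp)
  have hright := (hGc.hasStrictFDerivAt' hG (by simp)).eventually_right_inverse
  set g := hGc.localInverse hG (by simp) with hg
  have hg0 : g 0 = 0 := by
    have := hGc.localInverse_apply_image hG (by simp)
    rwa [hG0] at this
  rw [hG0] at hinv hright
  have hι : ContinuousAt (fun t : ℂ => ((t, 0, 0) : ℂ × ℂ × ℂ)) 0 := by fun_prop
  have hιa : AnalyticAt ℂ (fun t : ℂ => ((t, 0, 0) : ℂ × ℂ × ℂ)) 0 :=
    analyticAt_id.prod (analyticAt_const.prod analyticAt_const)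
  have hga : AnalyticAt ℂ (fun t : ℂ => g (t, 0, 0)) 0 :=
    AnalyticAt.fun_comp (g := g) (by exact hinv.analyticAt) hιa
  let c : ℂ → Fin (n + 3) → ℂ := fun t => u + A (g (t, 0, 0))
  have hca : AnalyticAt ℂ c 0 :=
    analyticAt_const.add ((A.analyticAt _).comp hga)
  have hc0 : c 0 = u := by
    change u + A (g 0) = u
    rw [hg0, map_zero, add_zero]
  have hev : ∀ᶠ t in nhds (0 : ℂ), G (g (t, 0, 0)) = (t, 0, 0) := hι.eventually hright
  have hcone : ∀ᶠ t in nhds (0 : ℂ), c t ∈ cone (quadricIntersection φ₁ φ₂) := by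
    have hne : ∀ᶠ t in nhds (0 : ℂ), c t ≠ 0 :=
      hca.continuousAt.eventually_ne (by rwa [hc0])
    filter_upwards [hev, hne] with t ht htne
    exact mem_cone_quadricIntersection.2 ⟨htne, congrArg (fun x => x.2.1) ht,
      congrArg (fun x => x.2.2) ht⟩
  refine ⟨c, hca, hcone, hc0, ?_⟩
  set g' := deriv (fun t : ℂ => g (t, 0, 0)) 0 with hg'
  have hgd : HasDerivAt (fun t : ℂ => g (t, 0, 0)) g' 0 := hga.differentiableAt.hasDerivAt
  have hcd' : HasDerivAt c (A g') 0 :=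
    ((A.hasFDerivAt (x := g (0, 0, 0))).comp_hasDerivAt 0 hgd).const_add u
  have e1 : g'.1 = 1 := by
    have h3 : HasDerivAt (fun t : ℂ => (g (t, 0, 0)).1) g'.1 0 :=
      (ContinuousLinearMap.fst ℂ ℂ (ℂ × ℂ)).hasFDerivAt.comp_hasDerivAt 0 hgd
    exact h3.unique ((hasDerivAt_id (0 : ℂ)).congr_of_eventuallyEq
      (hev.mono fun t ht => congrArg (fun x => x.1) ht))
  -- Differentiating the equations along the curve shows that the corrections in the directions p
  -- and q vanish to first order, so the velocity is exactly w.
  have hzero : ∀ φ : QuadraticForm ℂ (Fin (n + 3) → ℂ), (∀ᶠ t in nhds (0 : ℂ), φ (c t) = 0) →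
      associated φ u (A g') = 0 := by
    intro φ hφ
    have h3 := hasDerivAt_quadratic φ hcd'
    have h4 : HasDerivAt (fun t => φ (c t)) 0 0 :=
      (hasDerivAt_const (0 : ℂ) (0 : ℂ)).congr_of_eventuallyEq hφ
    have := h3.unique h4
    rw [hc0] at this
    simpa using this
  have e2 := hzero φ₁ (hcone.mono fun t ht => (mem_cone_quadricIntersection.1 ht).2.1)
  have e3 := hzero φ₂ (hcone.mono fun t ht => (mem_cone_quadricIntersection.1 ht).2.2)
  rw [hA] at e2 e3
  simp only [map_add, map_smul, h₁, h₂, hp₁, hp₂, hq₁, hq₂, smul_eq_mul, mul_zero, mul_one,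
    add_zero, zero_add, mul_eq_zero, inv_eq_zero, OfNat.ofNat_ne_zero, false_or] at e2 e3
  have : A g' = w := by rw [hA, e1, e2, e3]; simp
  rwa [this] at hcd'

/-! ### Tangent spaces and second fundamental forms of intersections of quadrics -/

/-- The quadratic form `φ` as a polynomial. -/
theorem exists_eval_eq_quadratic {σ : Type*} [Fintype σ] (φ : QuadraticForm ℂ (σ → ℂ)) :
    ∃ p : MvPolynomial σ ℂ, ∀ v, φ v = MvPolynomial.eval v p := by
  classical
  have h : IsPoly fun v => φ v := by
    have : (fun v => φ v) = fun v : σ → ℂ =>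
        ∑ i, v i * associated φ (Pi.single i 1) v := by
      ext v
      conv_lhs => rw [← associated_eq_self_apply ℂ φ v]
      conv_lhs =>
        arg 1
        rw [pi_eq_sum_univ' v]
      simp only [map_sum, LinearMap.sum_apply, map_smul, LinearMap.smul_apply, smul_eq_mul]
    rw [this]
    exact IsPoly.sum _ fun i => (IsPoly.coord i).mul (IsPoly.linear _)
  exact h

/-- The two forms are among the polynomials vanishing on the cone, which bounds the tangent space
from above. From below, each vector of the common kernel is the velocity of a curve in the cone, so
the full ideal of the cone need not be known. -/
theorem mem_affineTangent_iff (hX : IsNonsingularIntersection φ₁ φ₂) {u w : Fin (n + 3) → ℂ}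
    (hu : u ∈ cone (quadricIntersection φ₁ φ₂)) :
    w ∈ affineTangent (quadricIntersection φ₁ φ₂) u ↔
      associated φ₁ u w = 0 ∧ associated φ₂ u w = 0 := by
  constructor
  · intro hw
    have key : ∀ φ : QuadraticForm ℂ (Fin (n + 3) → ℂ),
        (∀ v ∈ cone (quadricIntersection φ₁ φ₂), φ v = 0) → associated φ u w = 0 := by
      intro φ hφ
      obtain ⟨p, hp⟩ := exists_eval_eq_quadratic φ
      have h1 := hw p fun v hv => by rw [← hp, hφ v hv]
      have hline : HasDerivAt (fun t : ℂ => u + t • w) w 0 := by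
        simpa using ((hasDerivAt_id (0 : ℂ)).smul_const w).const_add u
      have h2 := hasDerivAt_mvPolynomial p hline
      have h3 := hasDerivAt_quadratic φ hline
      simp only [hp] at h3
      have h4 := h3.unique h2
      simp only [zero_smul, add_zero] at h4
      rw [h1] at h4
      simpa using h4
    exact ⟨key φ₁ fun v hv => (mem_cone_quadricIntersection.1 hv).2.1,
      key φ₂ fun v hv => (mem_cone_quadricIntersection.1 hv).2.2⟩
  · rintro ⟨h₁, h₂⟩
    obtain ⟨c, _, hc, rfl, hcw⟩ := exists_curve hX hu h₁ h₂
    exact mem_affineTangent_of_curve hcw hc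

theorem rep_mem_cone {σ : Type*} {S : Set (ℙ ℂ (σ → ℂ))} {x : ℙ ℂ (σ → ℂ)} (hx : x ∈ S) :
    x.rep ∈ cone S :=
  ⟨x.rep_nonzero, by rwa [x.mk_rep]⟩

theorem tangentClass_eq_zero_iff {σ : Type*} [Fintype σ] {S : Set (ℙ ℂ (σ → ℂ))}
    {x : ℙ ℂ (σ → ℂ)} (w : affineTangent S x.rep) :
    tangentClass S x w = 0 ↔ ∃ a : ℂ, (w : σ → ℂ) = a • x.rep := by
  rw [tangentClass, Submodule.Quotient.mk_eq_zero, Submodule.mem_comap, Projectivization.submodule_eq,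
    Submodule.mem_span_singleton]
  simp only [Submodule.subtype_apply, eq_comm]

/-- The quadratic form on a tangent space induced by a form with radical containing the point. -/
def inducedForm {σ : Type*} [Fintype σ] (S : Set (ℙ ℂ (σ → ℂ))) (x : ℙ ℂ (σ → ℂ))
    (φ : QuadraticForm ℂ (σ → ℂ)) (h : ∀ w ∈ affineTangent S x.rep, associated φ x.rep w = 0) :
    QuadraticForm ℂ (TangentAt S x) :=
  LinearMap.BilinMap.toQuadraticMap
    (Submodule.liftQ (x.submodule.comap (affineTangent S x.rep).subtype)
      (Submodule.liftQ (x.submodule.comap (affineTangent S x.rep).subtype)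
        ((associated φ).compl₁₂ (affineTangent S x.rep).subtype (affineTangent S x.rep).subtype)
        (by
          intro w hw
          rw [Submodule.mem_comap, Projectivization.submodule_eq, Submodule.mem_span_singleton] at hw
          obtain ⟨a, ha⟩ := hw
          rw [LinearMap.mem_ker]
          ext w'
          rw [LinearMap.compl₁₂_apply, ← ha, map_smul, LinearMap.smul_apply,
            Submodule.subtype_apply, h w' w'.2, smul_zero, LinearMap.zero_apply])).flip
      (by
        intro w hw
        rw [Submodule.mem_comap, Projectivization.submodule_eq, Submodule.mem_span_singleton] at hw
        obtain ⟨a, ha⟩ := hw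
        rw [LinearMap.mem_ker]
        ext w'
        change associated φ w' ((affineTangent S x.rep).subtype w) = 0
        rw [← ha, associated_isSymm ℂ φ, map_smul, LinearMap.smul_apply, h w' w'.2, smul_zero]))

section InducedForm

variable {σ : Type*} [Fintype σ] {S : Set (ℙ ℂ (σ → ℂ))} {x : ℙ ℂ (σ → ℂ)}
  {φ : QuadraticForm ℂ (σ → ℂ)} {h : ∀ w ∈ affineTangent S x.rep, associated φ x.rep w = 0}

theorem inducedForm_apply (w : affineTangent S x.rep) :
    inducedForm S x φ h (tangentClass S x w) = φ w := by
  change associated φ w w = φ w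
  exact associated_eq_self_apply ℂ φ _

theorem associated_inducedForm (w w' : affineTangent S x.rep) :
    associated (inducedForm S x φ h) (tangentClass S x w) (tangentClass S x w') =
      associated φ w w' := by
  have hadd : tangentClass S x w + tangentClass S x w' = tangentClass S x (w + w') := rfl
  rw [associated_apply, associated_apply, hadd, inducedForm_apply, inducedForm_apply,
    inducedForm_apply]
  rfl

end InducedForm

theorem associated_rep_eq_zero (hX : IsNonsingularIntersection φ₁ φ₂)
    {x : ℙ ℂ (Fin (n + 3) → ℂ)} (hx : x ∈ quadricIntersection φ₁ φ₂) :
    (∀ w ∈ affineTangent (quadricIntersection φ₁ φ₂) x.rep, associated φ₁ x.rep w = 0) ∧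
      ∀ w ∈ affineTangent (quadricIntersection φ₁ φ₂) x.rep, associated φ₂ x.rep w = 0 :=
  ⟨fun _ hw => ((mem_affineTangent_iff hX (rep_mem_cone hx)).1 hw).1,
    fun _ hw => ((mem_affineTangent_iff hX (rep_mem_cone hx)).1 hw).2⟩

/-- Differentiating B(c, e) = 0 along the curve gives B(c', e) = -B(c, e'), whence the sign of the
conormal vector. -/
theorem isSecondFundamentalFormAlong_inducedForm (hX : IsNonsingularIntersection φ₁ φ₂)
    {x : ℙ ℂ (Fin (n + 3) → ℂ)} (hx : x ∈ quadricIntersection φ₁ φ₂) (a b : ℂ) :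
    IsSecondFundamentalFormAlong (quadricIntersection φ₁ φ₂) x
      (-(a • associated φ₁ x.rep + b • associated φ₂ x.rep))
      (a • inducedForm _ x φ₁ (associated_rep_eq_zero hX hx).1 +
        b • inducedForm _ x φ₂ (associated_rep_eq_zero hX hx).2) := by
  refine ⟨fun w hw => ?_, fun c e c' e₀ e' hc he hcX heX hc0 hcd he0 hed => ?_⟩
  · obtain ⟨h1, h2⟩ := (mem_affineTangent_iff hX (rep_mem_cone hx)).1 hw
    simp [h1, h2]
  · have key : ∀ φ : QuadraticForm ℂ (Fin (n + 3) → ℂ),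
        (∀ᶠ t in nhds (0 : ℂ), associated φ (c t) (e t) = 0) →
          associated φ (c' : Fin (n + 3) → ℂ) e₀ = -associated φ x.rep e' := by
      intro φ hφ
      have h1 := hasDerivAt_bilin (associated φ) hcd hed
      have h2 : HasDerivAt (fun t => associated φ (c t) (e t)) 0 0 :=
        (hasDerivAt_const (0 : ℂ) (0 : ℂ)).congr_of_eventuallyEq hφ
      have h3 := h1.unique h2
      rw [hc0, he0] at h3
      exact eq_neg_of_add_eq_zero_left h3
    have h1 := key φ₁ (by
      filter_upwards [hcX, heX] with t ht ht'
      exact ((mem_affineTangent_iff hX ht).1 ht').1)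
    have h2 := key φ₂ (by
      filter_upwards [hcX, heX] with t ht ht'
      exact ((mem_affineTangent_iff hX ht).1 ht').2)
    rw [map_add, map_smul, map_smul, LinearMap.add_apply, LinearMap.add_apply,
      LinearMap.smul_apply, LinearMap.smul_apply, LinearMap.smul_apply, LinearMap.smul_apply,
      associated_inducedForm, associated_inducedForm, h1, h2]
    simp only [LinearMap.neg_apply, LinearMap.add_apply, LinearMap.smul_apply, smul_eq_mul]
    ring

/-- Conormal vectors are combinations of the two differentials, for which the induced forms are
second fundamental forms. A form along a given conormal vector is unique because curves with
arbitrary tangent velocity exist. -/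
theorem secondFundamentalForm_eq_span (hX : IsNonsingularIntersection φ₁ φ₂)
    {x : ℙ ℂ (Fin (n + 3) → ℂ)} (hx : x ∈ quadricIntersection φ₁ φ₂) :
    secondFundamentalForm (quadricIntersection φ₁ φ₂) x =
      Submodule.span ℂ {inducedForm _ x φ₁ (associated_rep_eq_zero hX hx).1,
        inducedForm _ x φ₂ (associated_rep_eq_zero hX hx).2} := by
  apply le_antisymm
  · rintro q ⟨l, hl, hq⟩
    have hu := rep_mem_cone hx
    have hmem : l ∈ Submodule.span ℂ (Set.range ![associated φ₁ x.rep, associated φ₂ x.rep]) := by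
      apply mem_span_of_iInf_ker_le_ker
      intro w hw
      simp only [Submodule.mem_iInf, Fin.forall_fin_two, LinearMap.mem_ker,
        Matrix.cons_val_zero, Matrix.cons_val_one] at hw
      exact hl w ((mem_affineTangent_iff hX hu).2 hw)
    rw [Matrix.range_cons, Matrix.range_cons, Matrix.range_empty, Set.union_empty,
      Set.singleton_union, Submodule.mem_span_pair] at hmem
    obtain ⟨a, b, rfl⟩ := hmem
    have hab := isSecondFundamentalFormAlong_inducedForm hX hx (-a) (-b)
    rw [Submodule.mem_span_pair]
    refine ⟨-a, -b, ?_⟩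
    ext ξ
    induction ξ using Submodule.Quotient.induction_on with
    | H w =>
      obtain ⟨h1, h2⟩ := (mem_affineTangent_iff hX hu).1 w.2
      obtain ⟨c, hc, hcX, hc0, hcw⟩ := exists_curve hX hu h1 h2
      -- With the moving tangent vector e = c', both forms are evaluated on the diagonal at w, with
      -- the same right-hand side.
      have hd := hc.deriv
      have hdX : ∀ᶠ t in nhds (0 : ℂ),
          deriv c t ∈ affineTangent (quadricIntersection φ₁ φ₂) (c t) := by
        filter_upwards [hcX.eventually_nhds, hc.eventually_analyticAt] with t ht hta
        have hder := hta.differentiableAt.hasDerivAt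
        have hzero : ∀ φ : QuadraticForm ℂ (Fin (n + 3) → ℂ),
            (∀ᶠ s in nhds t, φ (c s) = 0) → associated φ (c t) (deriv c t) = 0 := by
          intro φ hφ
          have h3 := hasDerivAt_quadratic φ hder
          have h4 : HasDerivAt (fun t => φ (c t)) 0 t :=
            (hasDerivAt_const t (0 : ℂ)).congr_of_eventuallyEq hφ
          simpa using h3.unique h4
        exact (mem_affineTangent_iff hX ht.self_of_nhds).2
          ⟨hzero φ₁ (ht.mono fun s hs => (mem_cone_quadricIntersection.1 hs).2.1),
            hzero φ₂ (ht.mono fun s hs => (mem_cone_quadricIntersection.1 hs).2.2)⟩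
      have h3 := hq c (deriv c) w w (deriv (deriv c) 0) hc hd hcX hdX hc0 hcw hcw.deriv
        hd.differentiableAt.hasDerivAt
      have h4 := hab.2 c (deriv c) w w (deriv (deriv c) 0) hc hd hcX hdX hc0 hcw hcw.deriv
        hd.differentiableAt.hasDerivAt
      rw [associated_eq_self_apply] at h3 h4
      refine h4.trans (Eq.trans ?_ h3.symm)
      simp
      ring
  · rw [Submodule.span_le]
    rintro q (rfl | rfl)
    · exact ⟨-associated φ₁ x.rep, by simpa only [one_smul, zero_smul, add_zero] using
        isSecondFundamentalFormAlong_inducedForm hX hx 1 0⟩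
    · exact ⟨-associated φ₂ x.rep, by simpa only [one_smul, zero_smul, zero_add] using
        isSecondFundamentalFormAlong_inducedForm hX hx 0 1⟩

theorem finrank_affineTangent (hX : IsNonsingularIntersection φ₁ φ₂) {u : Fin (n + 3) → ℂ}
    (hu : u ∈ cone (quadricIntersection φ₁ φ₂)) :
    Module.finrank ℂ (affineTangent (quadricIntersection φ₁ φ₂) u) = n + 1 := by
  let f : (Fin (n + 3) → ℂ) →ₗ[ℂ] ℂ × ℂ := (associated φ₁ u).prod (associated φ₂ u)
  have hker : LinearMap.ker f = affineTangent (quadricIntersection φ₁ φ₂) u := by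
    ext w
    rw [mem_affineTangent_iff hX hu, LinearMap.mem_ker]
    exact Prod.mk_eq_zero
  have hrange : LinearMap.range f = ⊤ := by
    obtain ⟨p, q, hp₁, hp₂, hq₁, hq₂⟩ := exists_dual_vectors hX hu
    rw [LinearMap.range_eq_top]
    rintro ⟨a, b⟩
    exact ⟨a • p + b • q, by simp [f, hp₁, hp₂, hq₁, hq₂]⟩
  have h := LinearMap.finrank_range_add_finrank_ker f
  rw [hrange, hker, finrank_top, Module.finrank_prod, Module.finrank_self,
    Module.finrank_fin_fun] at h
  omega

theorem finrank_tangentAt_add_one {σ : Type*} [Fintype σ] {S : Set (ℙ ℂ (σ → ℂ))}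
    {x : ℙ ℂ (σ → ℂ)} (hx : x.rep ∈ affineTangent S x.rep) :
    Module.finrank ℂ (TangentAt S x) + 1 = Module.finrank ℂ (affineTangent S x.rep) := by
  have h := Submodule.finrank_quotient_add_finrank
    (x.submodule.comap (affineTangent S x.rep).subtype)
  have h1 : Module.finrank ℂ (x.submodule.comap (affineTangent S x.rep).subtype) = 1 := by
    rw [← x.finrank_submodule]
    refine LinearEquiv.finrank_eq (Submodule.comapSubtypeEquivOfLe ?_)
    rw [Projectivization.submodule_eq, Submodule.span_singleton_le_iff_mem]
    exact hx
  rw [h1] at h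
  exact h

theorem self_mem_affineTangent (hX : IsNonsingularIntersection φ₁ φ₂) {u : Fin (n + 3) → ℂ}
    (hu : u ∈ cone (quadricIntersection φ₁ φ₂)) :
    u ∈ affineTangent (quadricIntersection φ₁ φ₂) u := by
  obtain ⟨h0, h1, h2⟩ := mem_cone_quadricIntersection.1 hu
  rw [mem_affineTangent_iff hX hu, associated_eq_self_apply, associated_eq_self_apply]
  exact ⟨h1, h2⟩

theorem finrank_tangentAt (hX : IsNonsingularIntersection φ₁ φ₂) {x : ℙ ℂ (Fin (n + 3) → ℂ)}
    (hx : x ∈ quadricIntersection φ₁ φ₂) :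
    Module.finrank ℂ (TangentAt (quadricIntersection φ₁ φ₂) x) = n := by
  have h1 := finrank_tangentAt_add_one (self_mem_affineTangent hX (rep_mem_cone hx))
  rw [finrank_affineTangent hX (rep_mem_cone hx)] at h1
  omega

end Intersection

end QuadricPencil

namespace QuadricPencil

open QuadraticMap

/-! ### Pencils with given degenerate elements -/

section Abstract

variable {W W' : Type*} [AddCommGroup W] [Module ℂ W] [AddCommGroup W'] [Module ℂ W'] {n : ℕ}

theorem isDegenerate_zero [Nontrivial W] : IsDegenerate (0 : QuadraticForm ℂ W) := by
  obtain ⟨u, hu⟩ := exists_ne (0 : W)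
  exact ⟨u, hu, fun v => by simp⟩

theorem IsDegenerate.smul {q : QuadraticForm ℂ W} (h : IsDegenerate q) (a : ℂ) :
    IsDegenerate (a • q) := by
  obtain ⟨u, hu, H⟩ := h
  exact ⟨u, hu, fun v => by
    rw [map_smul, LinearMap.smul_apply, LinearMap.smul_apply, H, smul_zero]⟩

theorem isDegenerate_smul_iff {q : QuadraticForm ℂ W} {a : ℂ} (ha : a ≠ 0) :
    IsDegenerate (a • q) ↔ IsDegenerate q := by
  refine ⟨fun h => ?_, fun h => h.smul a⟩
  have := h.smul a⁻¹
  rwa [smul_smul, inv_mul_cancel₀ ha, one_smul] at this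

/-- The degenerate elements of the pencil spanned by `q₁` and `q₂` are the multiples of the
pairwise independent forms `α k • q₁ + β k • q₂`. -/
structure HasRoots (q₁ q₂ : QuadraticForm ℂ W) (α β : Fin n → ℂ) : Prop where
  pairwise : ∀ k m, k ≠ m → α k * β m ≠ α m * β k
  degenerate_iff : ∀ s t : ℂ, (s, t) ≠ 0 →
    (IsDegenerate (s • q₁ + t • q₂) ↔ ∃ k, s * β k = t * α k)

namespace HasRoots

variable {q₁ q₂ : QuadraticForm ℂ W} {α β : Fin n → ℂ}

theorem pair_ne_zero (h : HasRoots q₁ q₂ α β) (hn : 2 ≤ n) (k : Fin n) : (α k, β k) ≠ 0 := by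
  have : Nontrivial (Fin n) := Fin.nontrivial_iff_two_le.2 hn
  obtain ⟨m, hm⟩ := exists_ne k
  intro h0
  rw [Prod.mk_eq_zero] at h0
  exact h.pairwise k m hm.symm (by rw [h0.1, h0.2]; ring)

theorem exists_not_isDegenerate (h : HasRoots q₁ q₂ α β) (hn : 2 ≤ n) :
    ∃ t : ℂ, ¬ IsDegenerate ((1 : ℂ) • q₁ + t • q₂) := by
  obtain ⟨t, ht⟩ := (Set.finite_range fun k => β k / α k).infinite_compl.nonempty
  refine ⟨t, fun hd => ?_⟩
  obtain ⟨k, hk⟩ := (h.degenerate_iff 1 t (by simp)).1 hd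
  by_cases ha : α k = 0
  · apply h.pair_ne_zero hn k
    rw [ha, mul_zero, one_mul] at hk
    simp [ha, hk]
  · exact ht ⟨k, by rw [div_eq_iff ha, ← hk, one_mul]⟩

theorem isDegenerate_root (h : HasRoots q₁ q₂ α β) (hn : 2 ≤ n) (k : Fin n) :
    IsDegenerate (α k • q₁ + β k • q₂) :=
  (h.degenerate_iff _ _ (h.pair_ne_zero hn k)).2 ⟨k, mul_comm _ _⟩

theorem exists_eq_smul_of_mul_eq {a b c d : ℂ} (h0 : (c, d) ≠ 0) (h : a * d = b * c) :
    ∃ r : ℂ, a = r * c ∧ b = r * d := by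
  by_cases hc : c = 0
  · have hd : d ≠ 0 := by
      rintro rfl
      simp [hc] at h0
    refine ⟨b / d, ?_, by field_simp⟩
    rw [hc, mul_zero] at h
    rw [hc, mul_zero]
    exact (mul_eq_zero.1 h).resolve_right hd
  · exact ⟨a / c, by field_simp, by field_simp; linear_combination -h⟩

/-- A vanishing combination would be degenerate, so the root form with some index k would be zero.
Any two root forms span, so every element would be a multiple of another root form, contrary to the
existence of a nondegenerate one. -/
theorem linearIndependent (h : HasRoots q₁ q₂ α β) (hn : 2 ≤ n) :
    LinearIndependent ℂ ![q₁, q₂] := by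
  rw [LinearIndependent.pair_iff]
  intro s t hst
  by_contra hne
  have hne' : (s, t) ≠ 0 := by simpa [Prod.mk_eq_zero] using hne
  have hnt : Nontrivial W := by
    obtain ⟨u, hu, _⟩ := h.isDegenerate_root hn ⟨0, by omega⟩
    exact ⟨u, 0, hu⟩
  obtain ⟨k, hk⟩ := (h.degenerate_iff s t hne').1 (hst ▸ isDegenerate_zero)
  have : Nontrivial (Fin n) := Fin.nontrivial_iff_two_le.2 hn
  obtain ⟨m, hm⟩ := exists_ne k
  obtain ⟨r, hr⟩ := h.exists_not_isDegenerate hn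
  apply hr
  obtain ⟨a, rfl, rfl⟩ := exists_eq_smul_of_mul_eq (h.pair_ne_zero hn k) hk
  have ha : a ≠ 0 := by
    rintro rfl
    simp at hne'
  have hst' : α k • q₁ + β k • q₂ = 0 := by
    have : a • (α k • q₁ + β k • q₂) = 0 := by rw [smul_add, smul_smul, smul_smul, hst]
    exact (smul_eq_zero.1 this).resolve_left ha
  have hd := h.isDegenerate_root hn m
  set D := α k * β m - α m * β k with hD
  have hD0 : D ≠ 0 := sub_ne_zero.2 (h.pairwise k m hm.symm)
  -- Cramer's rule for the root forms with indices k and m.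
  have e : (1 : ℂ) • q₁ + r • q₂ = ((β m - r * α m) / D) • (α k • q₁ + β k • q₂) +
      ((r * α k - β k) / D) • (α m • q₁ + β m • q₂) := by
    have e1 : (β m - r * α m) / D * α k + (r * α k - β k) / D * α m = 1 := by
      field_simp
      rw [hD]; ring
    have e2 : (β m - r * α m) / D * β k + (r * α k - β k) / D * β m = r := by
      field_simp
      rw [hD]; ring
    rw [smul_add, smul_add, smul_smul, smul_smul, smul_smul, smul_smul, add_add_add_comm,
      ← add_smul, ← add_smul, e1, e2]
  rw [e, hst', smul_zero, zero_add]
  exact hd.smul _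

theorem isNonsingularPencil [FiniteDimensional ℂ W] (h : HasRoots q₁ q₂ α β) (hn : 2 ≤ n)
    (hW : Module.finrank ℂ W = n) : IsNonsingularPencil n (Submodule.span ℂ {q₁, q₂}) := by
  have hli := h.linearIndependent hn
  have hspan : Submodule.span ℂ (Set.range ![q₁, q₂]) = Submodule.span ℂ {q₁, q₂} := by
    rw [Matrix.range_cons, Matrix.range_cons, Matrix.range_empty, Set.union_empty,
      Set.singleton_union]
  have hcoef : ∀ {s t s' t' : ℂ}, s • q₁ + t • q₂ = s' • q₁ + t' • q₂ → s = s' ∧ t = t' := by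
    intro s t s' t' he
    have := LinearIndependent.pair_iff.1 hli (s - s') (t - t') (by
      rw [sub_smul, sub_smul, sub_add_sub_comm, he, sub_self])
    exact ⟨sub_eq_zero.1 this.1, sub_eq_zero.1 this.2⟩
  have hmem : ∀ s t : ℂ, s • q₁ + t • q₂ ∈ Submodule.span ℂ {q₁, q₂} := fun s t =>
    Submodule.mem_span_pair.2 ⟨s, t, rfl⟩
  have hne : ∀ k, α k • q₁ + β k • q₂ ≠ 0 := by
    intro k h0
    apply h.pair_ne_zero hn k
    have := LinearIndependent.pair_iff.1 hli _ _ h0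
    exact Prod.mk_eq_zero.2 this
  refine ⟨inferInstance, hW, ?_, ?_, ?_⟩
  · rw [← hspan, finrank_span_eq_card hli, Fintype.card_fin]
  · obtain ⟨t, ht⟩ := h.exists_not_isDegenerate hn
    exact ⟨_, hmem 1 t, ht⟩
  · have hrange : degeneratePoints (Submodule.span ℂ {q₁, q₂}) =
        Set.range fun k => Submodule.span ℂ {α k • q₁ + β k • q₂} := by
      ext L
      constructor
      · rintro ⟨hL, hLΦ, hLd⟩
        obtain ⟨q, hq, hqL⟩ := finrank_eq_one_iff'.1 hL
        obtain ⟨s, t, hst⟩ := Submodule.mem_span_pair.1 (hLΦ q.2)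
        have hst0 : (s, t) ≠ 0 := by
          intro h0
          rw [Prod.mk_eq_zero] at h0
          apply hq
          rw [h0.1, h0.2, zero_smul, zero_smul, add_zero] at hst
          exact Subtype.ext hst.symm
        obtain ⟨k, hk⟩ := (h.degenerate_iff s t hst0).1 (hst ▸ hLd q q.2)
        obtain ⟨a, rfl, rfl⟩ := exists_eq_smul_of_mul_eq (h.pair_ne_zero hn k) hk
        have ha : a ≠ 0 := by
          rintro rfl
          simp at hst0
        refine ⟨k, ?_⟩
        have hq' : (q : QuadraticForm ℂ W) = a • (α k • q₁ + β k • q₂) := by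
          rw [← hst, smul_add, smul_smul, smul_smul]
        apply le_antisymm
        · rw [Submodule.span_singleton_le_iff_mem]
          have := L.smul_mem a⁻¹ q.2
          rwa [hq', smul_smul, inv_mul_cancel₀ ha, one_smul] at this
        · intro p hp
          obtain ⟨c, hc⟩ := hqL ⟨p, hp⟩
          rw [Submodule.mem_span_singleton]
          refine ⟨c * a, ?_⟩
          rw [mul_smul, ← hq']
          exact congrArg Subtype.val hc
      · rintro ⟨k, rfl⟩
        refine ⟨finrank_span_singleton (hne k), ?_, ?_⟩
        · rw [Submodule.span_singleton_le_iff_mem]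
          exact hmem _ _
        · intro q hq
          obtain ⟨a, rfl⟩ := Submodule.mem_span_singleton.1 hq
          exact (h.isDegenerate_root hn k).smul a
    have hinj : Function.Injective fun k => Submodule.span ℂ {α k • q₁ + β k • q₂} := by
      intro k m hkm
      by_contra hkm'
      have hkm₂ : Submodule.span ℂ {α k • q₁ + β k • q₂} =
        Submodule.span ℂ {α m • q₁ + β m • q₂} := hkm
      have : α k • q₁ + β k • q₂ ∈ Submodule.span ℂ {α m • q₁ + β m • q₂} := by
        rw [← hkm₂]
        exact Submodule.mem_span_singleton_self _
      obtain ⟨a, ha⟩ := Submodule.mem_span_singleton.1 this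
      rw [smul_add, smul_smul, smul_smul] at ha
      obtain ⟨h1, h2⟩ := hcoef ha
      exact h.pairwise k m hkm' (by rw [← h1, ← h2]; ring)
    rw [hrange, ← Set.image_univ, hinj.encard_image, Set.encard_univ, ENat.card_eq_coe_fintype_card,
      Fintype.card_fin]

theorem pullback (h : HasRoots q₁ q₂ α β) (T : W' ≃ₗ[ℂ] W) :
    HasRoots (QuadricPencil.pullback (T : W' →ₗ[ℂ] W) q₁)
      (QuadricPencil.pullback (T : W' →ₗ[ℂ] W) q₂) α β := by
  refine ⟨h.pairwise, fun s t hst => ?_⟩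
  rw [← h.degenerate_iff s t hst, ← map_smul, ← map_smul, ← map_add, isDegenerate_pullback]

/-- Change of basis in a pencil. -/
theorem change {g : Fin 4 → ℂ} {r : Fin n → ℂ} (hg : det₂ g ≠ 0)
    (h : HasRoots q₁ q₂ (fun k => g 0 - r k * g 2) (fun k => g 1 - r k * g 3)) :
    HasRoots (g 0 • q₁ + g 1 • q₂) (g 2 • q₁ + g 3 • q₂) (fun _ => 1) (fun k => -r k) := by
  have hst' : ∀ s t : ℂ, s • (g 0 • q₁ + g 1 • q₂) + t • (g 2 • q₁ + g 3 • q₂) =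
      (s * g 0 + t * g 2) • q₁ + (s * g 1 + t * g 3) • q₂ := by
    intro s t
    module
  refine ⟨fun k m hkm h0 => h.pairwise k m hkm ?_, fun s t hst => ?_⟩
  · have : r k = r m := by linear_combination h0
    simp only [this]
  · rw [hst', h.degenerate_iff]
    · refine exists_congr fun k => ?_
      rw [← sub_eq_zero, ← sub_eq_zero (a := s * -r k)]
      have : (s * g 0 + t * g 2) * (g 1 - r k * g 3) - (s * g 1 + t * g 3) * (g 0 - r k * g 2) =
          det₂ g * (s * -r k - t * 1) := by
        rw [det₂]; ring
      rw [this, mul_eq_zero, or_iff_right hg]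
    · intro h0
      rw [Prod.mk_eq_zero] at h0
      apply hst
      rw [Prod.mk_eq_zero]
      have h1 : det₂ g * s = 0 := by
        rw [det₂]; linear_combination g 3 * h0.1 - g 2 * h0.2
      have h2 : det₂ g * t = 0 := by
        rw [det₂]; linear_combination g 0 * h0.2 - g 1 * h0.1
      exact ⟨(mul_eq_zero.1 h1).resolve_left hg, (mul_eq_zero.1 h2).resolve_left hg⟩

/-- Simultaneous diagonalization. -/
theorem exists_diagonalization [FiniteDimensional ℂ W] {r : Fin n → ℂ} (hn : 2 ≤ n)
    (hW : Module.finrank ℂ W = n) (h : HasRoots q₁ q₂ (fun _ => 1) (fun k => -r k)) :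
    ∃ D : (Fin n → ℂ) ≃ₗ[ℂ] W, ∀ x, q₁ (D x) = ∑ k, r k * x k ^ 2 ∧ q₂ (D x) = ∑ k, x k ^ 2 := by
  have hr : Function.Injective r := by
    intro k m hkm
    by_contra hne
    exact h.pairwise k m hne (by simp [hkm])
  have hnd : ¬ IsDegenerate q₂ := by
    intro hd
    obtain ⟨k, hk⟩ := (h.degenerate_iff 0 1 (by simp)).1 (by simpa using hd)
    simp at hk
  have hroot := fun k => h.isDegenerate_root hn k
  choose u hu0 hu using hroot
  have hB : ∀ k w, associated q₁ (u k) w = r k * associated q₂ (u k) w := by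
    intro k w
    have := hu k w
    rw [map_add, map_smul, map_smul] at this
    simp only [LinearMap.add_apply, LinearMap.smul_apply, smul_eq_mul] at this
    linear_combination this
  -- The u k are radical vectors of q₁ - r_k q₂. Comparing the two evaluations of q₁ on u k, u m
  -- gives orthogonality, since r_k ≠ r_m.
  have horth : ∀ k m, k ≠ m → associated q₂ (u k) (u m) = 0 := by
    intro k m hkm
    have h1 := hB k (u m)
    have h2 := hB m (u k)
    rw [associated_isSymm ℂ q₁, associated_isSymm ℂ q₂] at h2
    have h3 : (r k - r m) * associated q₂ (u k) (u m) = 0 := by linear_combination h2 - h1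
    exact (mul_eq_zero.1 h3).resolve_left (sub_ne_zero.2 (hr.ne hkm))
  have hker : LinearMap.ker (associated q₂) = ⊥ := by
    rw [LinearMap.ker_eq_bot']
    intro w hw
    by_contra hw0
    exact hnd ⟨w, hw0, fun v => by rw [hw]; rfl⟩
  have hinj : Function.Injective (associated q₂) := LinearMap.ker_eq_bot.1 hker
  let e : W ≃ₗ[ℂ] Module.Dual ℂ W :=
    LinearEquiv.ofInjectiveOfFinrankEq (associated q₂) hinj (by
      rw [Subspace.dual_finrank_eq])
  have he : ∀ w, e w = associated q₂ w := fun w => rfl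
  -- The endomorphism q₂⁻¹ q₁ has the u k as eigenvectors with distinct eigenvalues r k, so they
  -- form a basis.
  let S : Module.End ℂ W := (e.symm : Module.Dual ℂ W →ₗ[ℂ] W) ∘ₗ associated q₁
  have hS : ∀ k, S.HasEigenvector (r k) (u k) := by
    intro k
    rw [Module.End.hasEigenvector_iff, Module.End.mem_eigenspace_iff]
    refine ⟨?_, hu0 k⟩
    change e.symm (associated q₁ (u k)) = _
    rw [LinearEquiv.symm_apply_eq, map_smul, he]
    ext w
    rw [hB, LinearMap.smul_apply, smul_eq_mul]
  have hli : LinearIndependent ℂ u := Module.End.eigenvectors_linearIndependent' S r hr u hS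
  have : Nonempty (Fin n) := ⟨⟨0, by omega⟩⟩
  let b := basisOfLinearIndependentOfCardEqFinrank hli (by rw [hW, Fintype.card_fin])
  have hb : ∀ k, b k = u k := fun k => by simp [b]
  -- A vector of the orthogonal basis that is isotropic for q₂ would lie in the radical of q₂.
  have hself : ∀ k, associated q₂ (u k) (u k) ≠ 0 := by
    intro k h0
    apply hu0 k
    apply hinj
    rw [map_zero]
    apply b.ext
    intro m
    rw [hb]
    by_cases hkm : k = m
    · rw [← hkm, h0]; rfl
    · rw [horth k m hkm]; rfl
  have hsq : ∀ k, ∃ a : ℂ, a ^ 2 = associated q₂ (u k) (u k) := fun k =>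
    IsAlgClosed.exists_pow_nat_eq _ (by norm_num)
  choose a ha using hsq
  have ha0 : ∀ k, a k ≠ 0 := by
    intro k h0
    apply hself k
    rw [← ha, h0]; ring
  let b' := b.unitsSMul fun k => (Units.mk0 (a k) (ha0 k))⁻¹
  have hb' : ∀ k, b' k = (a k)⁻¹ • u k := by
    intro k
    rw [Module.Basis.unitsSMul_apply, hb]
    rfl
  have hself' : ∀ k m, associated q₂ (b' k) (b' m) = if k = m then 1 else 0 := by
    intro k m
    rw [hb', hb']
    simp only [map_smul, LinearMap.smul_apply, smul_eq_mul]
    split_ifs with hkm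
    · rw [← hkm, ← ha]
      have := ha0 k
      field_simp
    · rw [horth k m hkm, mul_zero, mul_zero]
  have hself₁ : ∀ k w, associated q₁ (b' k) w = r k * associated q₂ (b' k) w := by
    intro k w
    rw [hb']
    simp only [map_smul, LinearMap.smul_apply, smul_eq_mul, hB]
    ring
  have hB₂ : ∀ (x : Fin n → ℂ) (m : Fin n), associated q₂ (b' m) (∑ k, x k • b' k) = x m := by
    intro x m
    simp [hself']
  refine ⟨b'.equivFun.symm, fun x => ?_⟩
  rw [Module.Basis.equivFun_symm_apply]
  constructor
  · rw [← associated_eq_self_apply ℂ q₁]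
    conv_lhs => rw [map_sum]
    refine Finset.sum_congr rfl fun k _ => ?_
    rw [map_smul, associated_isSymm ℂ q₁, hself₁, hB₂, smul_eq_mul]
    ring
  · rw [← associated_eq_self_apply ℂ q₂]
    conv_lhs => rw [map_sum]
    refine Finset.sum_congr rfl fun k _ => ?_
    rw [map_smul, associated_isSymm ℂ q₂, hB₂, smul_eq_mul]
    ring

/-- Pencils with the same degenerate elements are isomorphic. -/
theorem exists_equiv [FiniteDimensional ℂ W] [FiniteDimensional ℂ W'] {r : Fin n → ℂ}
    (hn : 2 ≤ n) (hW : Module.finrank ℂ W = n) (hW' : Module.finrank ℂ W' = n)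
    (h : HasRoots q₁ q₂ (fun _ => 1) (fun k => -r k)) {q₁' q₂' : QuadraticForm ℂ W'}
    (h' : HasRoots q₁' q₂' (fun _ => 1) (fun k => -r k)) :
    ∃ T : W' ≃ₗ[ℂ] W, QuadricPencil.pullback (T : W' →ₗ[ℂ] W) q₁ = q₁' ∧
      QuadricPencil.pullback (T : W' →ₗ[ℂ] W) q₂ = q₂' := by
  obtain ⟨D, hD⟩ := h.exists_diagonalization hn hW
  obtain ⟨D', hD'⟩ := h'.exists_diagonalization hn hW'
  refine ⟨D'.symm.trans D, ?_, ?_⟩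
  · ext w
    obtain ⟨x, rfl⟩ := D'.surjective w
    simp [pullback_apply, (hD x).1, (hD' x).1]
  · ext w
    obtain ⟨x, rfl⟩ := D'.surjective w
    simp [pullback_apply, (hD x).2, (hD' x).2]

end HasRoots

/-- The degenerate elements of a nonsingular pencil. -/
theorem IsNonsingularPencil.exists_hasRoots {q₁ q₂ : QuadraticForm ℂ W} 
    (h : IsNonsingularPencil n (Submodule.span ℂ {q₁, q₂})) :
    ∃ α β : Fin n → ℂ, HasRoots q₁ q₂ α β := by
  set Φ := Submodule.span ℂ {q₁, q₂} with hΦ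
  have hspan : Submodule.span ℂ (Set.range ![q₁, q₂]) = Φ := by
    rw [Matrix.range_cons, Matrix.range_cons, Matrix.range_empty, Set.union_empty,
      Set.singleton_union]
  have hli : LinearIndependent ℂ ![q₁, q₂] := by
    rw [linearIndependent_iff_card_eq_finrank_span, Set.finrank, hspan, h.finrank_eq,
      Fintype.card_fin]
  have hcoef : ∀ {s t s' t' : ℂ}, s • q₁ + t • q₂ = s' • q₁ + t' • q₂ → s = s' ∧ t = t' := by
    intro s t s' t' he
    have := LinearIndependent.pair_iff.1 hli (s - s') (t - t') (by
      rw [sub_smul, sub_smul, sub_add_sub_comm, he, sub_self])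
    exact ⟨sub_eq_zero.1 this.1, sub_eq_zero.1 this.2⟩
  have hfin : (degeneratePoints Φ).Finite := Set.finite_of_encard_eq_coe h.encard_degenerate
  have hcard : Nat.card (degeneratePoints Φ) = n := by
    rw [Nat.card_coe_set_eq, Set.ncard, h.encard_degenerate, ENat.toNat_natCast]
  have := hfin.to_subtype
  let e : degeneratePoints Φ ≃ Fin n := Finite.equivFinOfCardEq hcard
  have hgen : ∀ k, ∃ s t : ℂ, (s, t) ≠ 0 ∧ (e.symm k).1 = Submodule.span ℂ {s • q₁ + t • q₂} := by
    intro k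
    obtain ⟨hL, hLΦ, hLd⟩ := (e.symm k).2
    obtain ⟨q, hq, hqL⟩ := finrank_eq_one_iff'.1 hL
    obtain ⟨s, t, hst⟩ := Submodule.mem_span_pair.1 (hLΦ q.2)
    refine ⟨s, t, ?_, ?_⟩
    · intro h0
      rw [Prod.mk_eq_zero] at h0
      apply hq
      rw [h0.1, h0.2, zero_smul, zero_smul, add_zero] at hst
      exact Subtype.ext hst.symm
    · apply le_antisymm
      · intro p hp
        obtain ⟨c, hc⟩ := hqL ⟨p, hp⟩
        exact Submodule.mem_span_singleton.2 ⟨c, by rw [hst]; exact congrArg Subtype.val hc⟩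
      · rw [Submodule.span_singleton_le_iff_mem, hst]
        exact q.2
  choose α β h0 hL using hgen
  refine ⟨α, β, fun k m hkm heq => ?_, fun s t hst => ⟨fun hd => ?_, ?_⟩⟩
  · apply hkm
    apply e.symm.injective
    apply Subtype.ext
    obtain ⟨a, ha1, ha2⟩ := HasRoots.exists_eq_smul_of_mul_eq (h0 m)
      (show α k * β m = β k * α m by rw [heq]; ring)
    have ha : a ≠ 0 := by
      rintro rfl
      apply h0 k
      simp [ha1, ha2]
    rw [hL, hL, ha1, ha2, mul_smul, mul_smul, ← smul_add]
    exact Submodule.span_singleton_smul_eq (IsUnit.mk0 a ha) _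
  · have hne : s • q₁ + t • q₂ ≠ 0 := by
      intro hz
      apply hst
      exact Prod.mk_eq_zero.2 (LinearIndependent.pair_iff.1 hli _ _ hz)
    have hmem : Submodule.span ℂ {s • q₁ + t • q₂} ∈ degeneratePoints Φ := by
      refine ⟨finrank_span_singleton hne, ?_, ?_⟩
      · rw [Submodule.span_singleton_le_iff_mem]
        exact Submodule.mem_span_pair.2 ⟨s, t, rfl⟩
      · intro q hq
        obtain ⟨a, rfl⟩ := Submodule.mem_span_singleton.1 hq
        exact hd.smul a
    refine ⟨e ⟨_, hmem⟩, ?_⟩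
    have h1 := hL (e ⟨_, hmem⟩)
    rw [Equiv.symm_apply_apply] at h1
    have h2 : s • q₁ + t • q₂ ∈ Submodule.span ℂ {s • q₁ + t • q₂} :=
      Submodule.mem_span_singleton_self _
    dsimp only at h1
    rw [h1] at h2
    obtain ⟨a, ha⟩ := Submodule.mem_span_singleton.1 h2
    rw [smul_add, smul_smul, smul_smul] at ha
    obtain ⟨h3, h4⟩ := hcoef ha
    linear_combination (-β (e ⟨_, hmem⟩)) * h3 + α (e ⟨_, hmem⟩) * h4
  · rintro ⟨k, hk⟩
    obtain ⟨a, rfl, rfl⟩ := HasRoots.exists_eq_smul_of_mul_eq (h0 k) hk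
    have hd := (e.symm k).2.2.2 (α k • q₁ + β k • q₂) (by
      rw [hL]
      exact Submodule.mem_span_singleton_self _)
    rw [mul_smul, mul_smul, ← smul_add]
    exact hd.smul a

end Abstract

end QuadricPencil

namespace QuadricPencil

open QuadraticMap Polynomial

/-! ### Products of linear factors -/

section LinearFactors

variable {n : ℕ} {α β : Fin n → ℂ}

theorem natDegree_prod_linear_le (α β : Fin n → ℂ) :
    (∏ k, (C (α k) * X + C (β k))).natDegree ≤ n := by
  refine (natDegree_prod_le _ _).trans ?_
  refine (Finset.sum_le_card_nsmul _ _ 1 fun k _ => natDegree_linear_le).trans ?_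
  simp

theorem coeff_prod_linear (α β : Fin n → ℂ) :
    (∏ k, (C (α k) * X + C (β k))).coeff n = ∏ k, α k := by
  have h := coeff_prod_of_natDegree_le (s := (Finset.univ : Finset (Fin n)))
    (f := fun k => C (α k) * X + C (β k)) (n := 1) (fun k _ => natDegree_linear_le)
  simpa using h

/-- A homogeneous zero of a product of linear factors. -/
theorem exists_linear_eq_zero_iff (α β : Fin n → ℂ) (x y : ℂ) (hxy : (x, y) ≠ 0) :
    (∃ k, α k * x + β k * y = 0) ↔
      (y ≠ 0 → (∏ k, (C (α k) * X + C (β k))).eval (x / y) = 0) ∧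
      (y = 0 → (∏ k, (C (α k) * X + C (β k))).coeff n = 0) := by
  rw [coeff_prod_linear, eval_prod]
  by_cases hy : y = 0
  · have hx : x ≠ 0 := by
      rintro rfl
      exact hxy (by simp [hy])
    simp [hy, hx, Finset.prod_eq_zero_iff]
  · simp only [hy, ne_eq, not_false_eq_true, forall_const, false_imp_iff, and_true,
      Finset.prod_eq_zero_iff, Finset.mem_univ, true_and]
    refine exists_congr fun k => ?_
    simp only [eval_add, eval_mul, eval_C, eval_X]
    rw [← mul_div_assoc, div_add' _ _ _ hy, div_eq_zero_iff, or_iff_left hy]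

/-- A polynomial is determined up to a constant by its roots, the root at infinity included. -/
theorem eq_C_mul_prod_linear {P : ℂ[X]} (hP : P.natDegree ≤ n) (hP0 : P ≠ 0)
    (hpw : ∀ k m, k ≠ m → α k * β m ≠ α m * β k)
    (h1 : ∀ c, P.eval c = 0 ↔ ∃ k, α k * c + β k = 0)
    (h2 : P.coeff n = 0 ↔ ∃ k, α k = 0) :
    ∃ κ : ℂ, κ ≠ 0 ∧ P = C κ * ∏ k, (C (α k) * X + C (β k)) := by
  classical
  set Q := ∏ k, (C (α k) * X + C (β k)) with hQ
  obtain ⟨c₀, hc₀⟩ : ∃ c₀, P.eval c₀ ≠ 0 := by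
    by_contra! h
    exact hP0 (Polynomial.funext fun c => by simp [h])
  have hQ0 : ∀ c, Q.eval c = 0 ↔ ∃ k, α k * c + β k = 0 := by
    intro c
    simp [hQ, eval_prod, Finset.prod_eq_zero_iff]
  have hQc₀ : Q.eval c₀ ≠ 0 := fun h => hc₀ ((h1 _).2 ((hQ0 _).1 h))
  refine ⟨P.eval c₀ / Q.eval c₀, div_ne_zero hc₀ hQc₀, ?_⟩
  set κ := P.eval c₀ / Q.eval c₀
  rw [← sub_eq_zero]
  -- D vanishes at c₀ and at all finite roots. Without a root at infinity these are n + 1 points.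
  -- With one they are only n, but then the coefficient of degree n vanishes as well. Either way D =
  -- 0.
  set D := P - C κ * Q with hD
  let s : Finset (Fin n) := Finset.univ.filter fun k => α k ≠ 0
  let S : Finset ℂ := insert c₀ (s.image fun k => -β k / α k)
  have hroot : ∀ k ∈ s, α k * (-β k / α k) + β k = 0 := by
    intro k hk
    have : α k ≠ 0 := (Finset.mem_filter.1 hk).2
    field_simp
    ring
  have hS : ∀ c ∈ S, D.eval c = 0 := by
    intro c hc
    rw [hD, eval_sub, eval_mul, eval_C]
    rcases Finset.mem_insert.1 hc with rfl | hc
    · rw [div_mul_cancel₀ _ hQc₀, sub_self]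
    · obtain ⟨k, hk, rfl⟩ := Finset.mem_image.1 hc
      rw [(h1 _).2 ⟨k, hroot k hk⟩, (hQ0 _).2 ⟨k, hroot k hk⟩, mul_zero, sub_zero]
  have hcard : S.card = s.card + 1 := by
    rw [Finset.card_insert_of_notMem, Finset.card_image_of_injOn]
    · intro k hk m hm hkm
      by_contra hne
      have hk0 : α k ≠ 0 := (Finset.mem_filter.1 hk).2
      have hm0 : α m ≠ 0 := (Finset.mem_filter.1 hm).2
      apply hpw k m hne
      dsimp only at hkm
      field_simp at hkm
      linear_combination hkm
    · intro hc
      obtain ⟨k, hk, hk'⟩ := Finset.mem_image.1 hc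
      exact hc₀ ((h1 _).2 ⟨k, by rw [← hk']; exact hroot k hk⟩)
  have hDn : D.natDegree ≤ n := by
    refine (natDegree_sub_le _ _).trans (max_le hP ?_)
    exact (natDegree_C_mul_le _ _).trans (natDegree_prod_linear_le α β)
  by_contra hD0
  have hdeg : S.card ≤ D.natDegree := by
    have hsub : S ⊆ D.roots.toFinset := fun c hc => by
      rw [Multiset.mem_toFinset, mem_roots hD0]
      exact hS c hc
    exact (Finset.card_le_card hsub).trans ((Multiset.toFinset_card_le _).trans (card_roots' D))
  by_cases hall : ∃ k₀, α k₀ = 0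
  · obtain ⟨k₀, hk₀⟩ := hall
    have hs : s = Finset.univ.erase k₀ := by
      ext k
      simp only [s, Finset.mem_filter, Finset.mem_univ, true_and, Finset.mem_erase, and_true]
      constructor
      · rintro h rfl
        exact h hk₀
      · intro hne h
        exact hpw k k₀ hne (by rw [h, hk₀]; ring)
    have hc : D.coeff n = 0 := by
      rw [hD, coeff_sub, coeff_C_mul, h2.2 ⟨k₀, hk₀⟩, coeff_prod_linear,
        Finset.prod_eq_zero (Finset.mem_univ k₀) hk₀]
      simp
    have hn : 0 < n := k₀.pos
    rw [hcard, hs, Finset.card_erase_of_mem (Finset.mem_univ _), Finset.card_univ,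
      Fintype.card_fin] at hdeg
    have : D.natDegree = n := by omega
    rw [← this, coeff_natDegree, leadingCoeff_eq_zero] at hc
    exact hD0 hc
  · have hs : s = Finset.univ := by
      ext k
      simp only [s, Finset.mem_filter, Finset.mem_univ, true_and, iff_true]
      exact fun h => hall ⟨k, h⟩
    rw [hcard, hs, Finset.card_univ, Fintype.card_fin] at hdeg
    omega

end LinearFactors

/-! ### Points with prescribed degenerate elements of the second fundamental form -/

section Moebius

variable {n : ℕ}

/-- The polynomial `∏ ((g₀ X + g₁) - r_k (g₂ X + g₃))`. -/
def moebiusPoly (r : Fin n → ℂ) (g : Fin 4 → ℂ) : ℂ[X] :=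
  ∏ k, (C (g 0 - r k * g 2) * X + C (g 1 - r k * g 3))

theorem eval_moebiusPoly (r : Fin n → ℂ) (g : Fin 4 → ℂ) (c : ℂ) :
    (moebiusPoly r g).eval c = ∏ k, ((g 0 * c + g 1) - r k * (g 2 * c + g 3)) := by
  rw [moebiusPoly, eval_prod]
  refine Finset.prod_congr rfl fun k _ => ?_
  simp only [eval_add, eval_mul, eval_C, eval_X]
  ring

theorem natDegree_moebiusPoly_le (r : Fin n → ℂ) (g : Fin 4 → ℂ) :
    (moebiusPoly r g).natDegree ≤ n :=
  natDegree_prod_linear_le _ _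

theorem moebius_pairwise {r : Fin n → ℂ} (hr : Function.Injective r) {g : Fin 4 → ℂ}
    (hg : det₂ g ≠ 0) (k m : Fin n) (hkm : k ≠ m) :
    (g 0 - r k * g 2) * (g 1 - r m * g 3) ≠ (g 0 - r m * g 2) * (g 1 - r k * g 3) := by
  intro h
  apply mul_ne_zero hg (sub_ne_zero.2 (hr.ne hkm))
  rw [det₂]
  linear_combination h

theorem moebiusPoly_smul (r : Fin n → ℂ) (g : Fin 4 → ℂ) (a : ℂ) :
    moebiusPoly r (a • g) = C (a ^ n) * moebiusPoly r g := by
  have : C (a ^ n) = ∏ _k : Fin n, (C a : ℂ[X]) := by simp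
  rw [moebiusPoly, moebiusPoly, this, ← Finset.prod_mul_distrib]
  refine Finset.prod_congr rfl fun k _ => ?_
  simp only [Pi.smul_apply, smul_eq_mul, map_sub, map_mul]
  ring

/-- Uniqueness of the Möbius transformation. -/
theorem exists_eq_smul_of_moebiusPoly_eq {r : Fin n → ℂ} (hn : 3 ≤ n) (hr : Function.Injective r)
    (hT : HasTrivialStabilizer r) {g g' : Fin 4 → ℂ} (hg : det₂ g ≠ 0) (hg' : det₂ g' ≠ 0)
    (h : moebiusPoly r g = moebiusPoly r g') : ∃ a : ℂ, a ≠ 0 ∧ g' = a • g := by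
  -- The roots of the two polynomials are the preimages of the r_k under g and g'. Equal polynomials
  -- have equal roots, so g' ∘ g⁻¹ permutes the r_k; by triviality of the stabilizer it fixes them
  -- all.
  set c := mul₂ g' (adj₂ g) with hc
  have hcdet : det₂ c ≠ 0 := by
    rw [hc, det₂_mul₂, det₂_adj₂]
    exact mul_ne_zero hg' hg
  have hex : ∀ k, ∃ m, Sends c (r k) (r m) := by
    intro k
    -- Homogeneous coordinates of g⁻¹(r_k), which may be the point at infinity.
    have hxy : (g 3 * r k - g 1, -(g 2 * r k) + g 0) ≠ 0 := by
      intro h0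
      obtain ⟨h1, h2⟩ := Prod.mk_eq_zero.1 h0
      apply hg
      rw [det₂]
      linear_combination g 3 * h2 + g 2 * h1
    have h1 := (exists_linear_eq_zero_iff (fun k => g 0 - r k * g 2) (fun k => g 1 - r k * g 3)
      _ _ hxy).1 ⟨k, by ring⟩
    change (_ → (moebiusPoly r g).eval _ = 0) ∧ (_ → (moebiusPoly r g).coeff n = 0) at h1
    rw [h] at h1
    obtain ⟨m, hm⟩ := (exists_linear_eq_zero_iff (fun k => g' 0 - r k * g' 2)
      (fun k => g' 1 - r k * g' 3) _ _ hxy).2 h1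
    refine ⟨m, ?_⟩
    simp only [Sends, hc, mul₂, adj₂, Matrix.cons_val]
    linear_combination hm
  choose τ hτ using hex
  have hτi : Function.Injective τ := fun k m hkm =>
    hr ((hτ k).injective hcdet (hkm ▸ hτ m))
  have h1 := hT c (Equiv.ofBijective τ (Finite.injective_iff_bijective.1 hτi)) hcdet hτ
  have hτ1 : ∀ k, τ k = k := fun k => congrArg (fun σ : Equiv.Perm (Fin n) => σ k) h1
  have hfix : ∀ k, Sends c (r k) (r k) := fun k => by
    have := hτ k
    rwa [hτ1] at this
  obtain ⟨a, ha, hca⟩ := exists_eq_smul_of_sends (g := ![1, 0, 0, 1]) (h := c)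
    (x := r ∘ Fin.castLE hn) (y := r ∘ Fin.castLE hn) (by simp [det₂]) hcdet
    (hr.comp (Fin.castLE_injective hn)) (fun k => by simp [Sends]) (fun k => hfix _)
  refine ⟨a / det₂ g, div_ne_zero ha hg, ?_⟩
  have hgg : det₂ g • g' = mul₂ c g := by
    ext i
    fin_cases i <;> simp [hc, mul₂, adj₂, det₂] <;> ring
  have hcg : mul₂ c g = a • g := by
    rw [hca]
    ext i
    fin_cases i <;> simp [mul₂]
  rw [div_eq_inv_mul, mul_smul, ← hcg, ← hgg, smul_smul, inv_mul_cancel₀ hg, one_smul]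

end Moebius

/-! ### Passage from tangent spaces to coordinates in a standard basis -/

section Coordinates

variable {n : ℕ} {φ₁ φ₂ : QuadraticForm ℂ (Fin (n + 3) → ℂ)}
  {b : Module.Basis (Fin (n + 3)) ℂ (Fin (n + 3) → ℂ)} {l : Fin (n + 3) → ℂ}

theorem IsStandardBasis.apply (hb : IsStandardBasis φ₁ φ₂ b l) (u : Fin (n + 3) → ℂ) :
    φ₁ u = ∑ i, l i * b.repr u i ^ 2 ∧ φ₂ u = ∑ i, b.repr u i ^ 2 := by
  have := hb.2.2 (b.repr u)
  rwa [b.sum_repr] at this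

theorem IsStandardBasis.associated (hb : IsStandardBasis φ₁ φ₂ b l) (u w : Fin (n + 3) → ℂ) :
    associated φ₁ u w = ∑ i, l i * b.repr u i * b.repr w i ∧
      associated φ₂ u w = ∑ i, b.repr u i * b.repr w i := by
  constructor
  · have h := congrArg (fun B => B u w) (QuadraticMap.two_nsmul_associated ℂ φ₁)
    change 2 • QuadraticMap.associated φ₁ u w = φ₁ (u + w) - φ₁ u - φ₁ w at h
    rw [(hb.apply _).1, (hb.apply _).1, (hb.apply _).1, ← Finset.sum_sub_distrib,
      ← Finset.sum_sub_distrib, two_nsmul, ← two_mul] at h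
    refine mul_left_cancel₀ (two_ne_zero (α := ℂ)) (h.trans ?_)
    rw [Finset.mul_sum]
    refine Finset.sum_congr rfl fun i _ => ?_
    simp only [map_add, Finsupp.add_apply]
    ring
  · have h := congrArg (fun B => B u w) (QuadraticMap.two_nsmul_associated ℂ φ₂)
    change 2 • QuadraticMap.associated φ₂ u w = φ₂ (u + w) - φ₂ u - φ₂ w at h
    rw [(hb.apply _).2, (hb.apply _).2, (hb.apply _).2, ← Finset.sum_sub_distrib,
      ← Finset.sum_sub_distrib, two_nsmul, ← two_mul] at h
    refine mul_left_cancel₀ (two_ne_zero (α := ℂ)) (h.trans ?_)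
    rw [Finset.mul_sum]
    refine Finset.sum_congr rfl fun i _ => ?_
    simp only [map_add, Finsupp.add_apply]
    ring

theorem IsStandardBasis.mem_affineTangent_iff (hb : IsStandardBasis φ₁ φ₂ b l)
    (hX : IsNonsingularIntersection φ₁ φ₂) {u w : Fin (n + 3) → ℂ}
    (hu : u ∈ cone (quadricIntersection φ₁ φ₂)) :
    w ∈ affineTangent (quadricIntersection φ₁ φ₂) u ↔
      (b.repr w : Fin (n + 3) → ℂ) ∈ coordTangent l (b.repr u) := by
  rw [QuadricPencil.mem_affineTangent_iff hX hu, (hb.associated u w).1, (hb.associated u w).2,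
    mem_coordTangent]

theorem repr_ne_zero {u : Fin (n + 3) → ℂ} (hu : u ≠ 0) : (b.repr u : Fin (n + 3) → ℂ) ≠ 0 := by
  intro h
  apply hu
  apply b.repr.injective
  rw [map_zero]
  exact DFunLike.coe_injective h

/-- The form on `T_x X` induced by the first quadric. -/
abbrev firstForm (hX : IsNonsingularIntersection φ₁ φ₂) {x : ℙ ℂ (Fin (n + 3) → ℂ)}
    (hx : x ∈ quadricIntersection φ₁ φ₂) :
    QuadraticForm ℂ (TangentAt (quadricIntersection φ₁ φ₂) x) :=
  inducedForm _ x φ₁ (associated_rep_eq_zero hX hx).1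

/-- The form on `T_x X` induced by the second quadric. -/
abbrev secondForm (hX : IsNonsingularIntersection φ₁ φ₂) {x : ℙ ℂ (Fin (n + 3) → ℂ)}
    (hx : x ∈ quadricIntersection φ₁ φ₂) :
    QuadraticForm ℂ (TangentAt (quadricIntersection φ₁ φ₂) x) :=
  inducedForm _ x φ₂ (associated_rep_eq_zero hX hx).2

theorem isDegenerate_iff_coordDegenerate (hb : IsStandardBasis φ₁ φ₂ b l)
    (hX : IsNonsingularIntersection φ₁ φ₂) {x : ℙ ℂ (Fin (n + 3) → ℂ)}
    (hx : x ∈ quadricIntersection φ₁ φ₂) (s t : ℂ) :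
    IsDegenerate (s • firstForm hX hx + t • secondForm hX hx) ↔
      CoordDegenerate l (b.repr x.rep) s t := by
  have hu := rep_mem_cone hx
  have hassoc : ∀ w w' : affineTangent (quadricIntersection φ₁ φ₂) x.rep,
      associated (s • firstForm hX hx + t • secondForm hX hx) (tangentClass _ x w)
        (tangentClass _ x w') = ∑ i, (s * l i + t) * b.repr (w : Fin (n + 3) → ℂ) i *
          b.repr (w' : Fin (n + 3) → ℂ) i := by
    intro w w'
    rw [map_add, map_smul, map_smul]
    simp only [LinearMap.add_apply, LinearMap.smul_apply, smul_eq_mul]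
    rw [associated_inducedForm, associated_inducedForm, (hb.associated _ _).1,
      (hb.associated _ _).2, Finset.mul_sum, Finset.mul_sum, ← Finset.sum_add_distrib]
    refine Finset.sum_congr rfl fun i _ => ?_
    ring
  have hrep : ∀ z : Fin (n + 3) → ℂ, (b.repr (b.equivFun.symm z) : Fin (n + 3) → ℂ) = z :=
    fun z => b.equivFun.apply_symm_apply z
  constructor
  · rintro ⟨w, hw, H⟩
    obtain ⟨w, rfl⟩ := Submodule.Quotient.mk_surjective _ w
    refine ⟨b.repr (w : Fin (n + 3) → ℂ), (hb.mem_affineTangent_iff hX hu).1 w.2,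
      fun a ha => hw ?_, fun w' hw' => ?_⟩
    · refine (tangentClass_eq_zero_iff w).2 ⟨a, ?_⟩
      apply b.repr.injective
      rw [map_smul]
      exact DFunLike.coe_injective ha
    · have hmem : b.equivFun.symm w' ∈ affineTangent (quadricIntersection φ₁ φ₂) x.rep := by
        rw [hb.mem_affineTangent_iff hX hu, hrep]
        exact hw'
      have := H (tangentClass _ x ⟨_, hmem⟩)
      rwa [hassoc w ⟨_, hmem⟩, hrep] at this
  · rintro ⟨z, hz, hne, H⟩
    have hmem : b.equivFun.symm z ∈ affineTangent (quadricIntersection φ₁ φ₂) x.rep := by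
      rw [hb.mem_affineTangent_iff hX hu, hrep]
      exact hz
    refine ⟨tangentClass _ x ⟨_, hmem⟩, fun h0 => ?_, fun w' => ?_⟩
    · obtain ⟨a, ha⟩ := (tangentClass_eq_zero_iff _).1 h0
      apply hne a
      rw [← hrep z]
      simp only at ha
      rw [ha, map_smul]
      rfl
    · obtain ⟨w', rfl⟩ := Submodule.Quotient.mk_surjective _ w'
      rw [hassoc ⟨_, hmem⟩ w', hrep]
      exact H _ ((hb.mem_affineTangent_iff hX hu).1 w'.2)

theorem sum_of_mem (hb : IsStandardBasis φ₁ φ₂ b l) {u : Fin (n + 3) → ℂ}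
    (hu : u ∈ cone (quadricIntersection φ₁ φ₂)) :
    ∑ i, b.repr u i ^ 2 = 0 ∧ ∑ i, l i * b.repr u i ^ 2 = 0 := by
  obtain ⟨-, h1, h2⟩ := mem_cone_quadricIntersection.1 hu
  rw [← (hb.apply u).1, ← (hb.apply u).2]
  exact ⟨h2, h1⟩

theorem mem_cone_of_poly (hb : IsStandardBasis φ₁ φ₂ b l) {u : Fin (n + 3) → ℂ} (hu : u ≠ 0)
    {P : ℂ[X]} (hP : P.natDegree ≤ n)
    (hz : ∀ i, b.repr u i ^ 2 * nodeWeight l i = P.eval (l i)) :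
    u ∈ cone (quadricIntersection φ₁ φ₂) := by
  rw [mem_cone_quadricIntersection, (hb.apply u).1, (hb.apply u).2]
  exact ⟨hu, sum_node_mul_sq_eq_zero hb.1 hP hz, sum_sq_eq_zero hb.1 hP hz⟩

theorem hasRoots_of_poly (hb : IsStandardBasis φ₁ φ₂ b l)
    (hX : IsNonsingularIntersection φ₁ φ₂) {x : ℙ ℂ (Fin (n + 3) → ℂ)}
    (hx : x ∈ quadricIntersection φ₁ φ₂) {α β : Fin n → ℂ}
    (hpw : ∀ k m, k ≠ m → α k * β m ≠ α m * β k)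
    (hz : ∀ i, b.repr x.rep i ^ 2 * nodeWeight l i =
      (∏ k, (C (α k) * X + C (β k))).eval (l i)) :
    HasRoots (firstForm hX hx) (secondForm hX hx) α β := by
  refine ⟨hpw, fun s t hst => ?_⟩
  rw [isDegenerate_iff_coordDegenerate hb hX hx]
  have hdeg := natDegree_prod_linear_le α β
  have h := exists_linear_eq_zero_iff α β (-t) s (by
    intro h
    apply hst
    simpa [and_comm] using h)
  have hk : (∃ k, s * β k = t * α k) ↔ ∃ k, α k * -t + β k * s = 0 :=
    exists_congr fun k => by
      rw [← sub_eq_zero]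
      constructor <;> intro h <;> linear_combination h
  rw [hk, h]
  by_cases hs : s = 0
  · subst hs
    have ht : t ≠ 0 := by
      rintro rfl
      exact hst rfl
    rw [coordDegenerate_zero_iff hb.1 hdeg hz (repr_ne_zero x.rep_nonzero) ht]
    simp
  · rw [coordDegenerate_iff_of_ne hb.1 hdeg hz (repr_ne_zero x.rep_nonzero) hs]
    simp [hs]

/-- The interpolating polynomial of the squared coordinates has degree at most n because the point
lies on X, and has the prescribed roots, infinity included; such a polynomial is unique up to a
constant. -/
theorem exists_poly_of_hasRoots (hb : IsStandardBasis φ₁ φ₂ b l)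
    (hX : IsNonsingularIntersection φ₁ φ₂) {x : ℙ ℂ (Fin (n + 3) → ℂ)}
    (hx : x ∈ quadricIntersection φ₁ φ₂) {α β : Fin n → ℂ}
    (h : HasRoots (firstForm hX hx) (secondForm hX hx) α β) :
    ∃ κ : ℂ, κ ≠ 0 ∧ ∀ i, b.repr x.rep i ^ 2 * nodeWeight l i =
      κ * (∏ k, (C (α k) * X + C (β k))).eval (l i) := by
  obtain ⟨h0, h1⟩ := sum_of_mem hb (rep_mem_cone hx)
  set P := interp l fun i => b.repr x.rep i ^ 2 with hPdef
  have hP : P.natDegree ≤ n := natDegree_interp_le hb.1 h0 h1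
  have hz : ∀ i, b.repr x.rep i ^ 2 * nodeWeight l i = P.eval (l i) := fun i =>
    (eval_interp hb.1 (fun i => b.repr x.rep i ^ 2) i).symm
  have hz0 := repr_ne_zero (b := b) x.rep_nonzero
  obtain ⟨κ, hκ, hPκ⟩ := eq_C_mul_prod_linear (P := P) (α := α) (β := β) hP (by
    intro hP0
    obtain ⟨i, hi⟩ := Function.ne_iff.1 hz0
    have := hz i
    rw [hP0, eval_zero] at this
    exact mul_ne_zero (pow_ne_zero 2 hi) (nodeWeight_ne_zero hb.1 i) this) h.pairwise (by
    intro c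
    have h2 := coordDegenerate_iff_of_ne hb.1 hP hz hz0 (s := 1) (t := -c) one_ne_zero
    rw [neg_neg, div_one] at h2
    rw [← h2, ← isDegenerate_iff_coordDegenerate hb hX hx, h.degenerate_iff _ _ (by simp)]
    refine exists_congr fun k => ?_
    constructor <;> intro h <;> linear_combination h) (by
    have h2 := coordDegenerate_zero_iff hb.1 hP hz hz0 (t := 1) one_ne_zero
    rw [← h2, ← isDegenerate_iff_coordDegenerate hb hX hx, h.degenerate_iff _ _ (by simp)]
    refine exists_congr fun k => ?_
    simp [eq_comm])
  refine ⟨κ, hκ, fun i => ?_⟩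
  rw [hz, hPκ, eval_mul, eval_C]

end Coordinates

end QuadricPencil

namespace QuadricPencil

open QuadraticMap Polynomial

/-! ### The fibers of the moduli map -/

section Transport

variable {W W' W'' : Type*} [AddCommGroup W] [Module ℂ W] [AddCommGroup W'] [Module ℂ W']
  [AddCommGroup W''] [Module ℂ W''] {n : ℕ}

theorem map_pullback_trans (e : W ≃ₗ[ℂ] W') (f : W' ≃ₗ[ℂ] W'')
    (Φ : Submodule ℂ (QuadraticForm ℂ W'')) :
    (Φ.map (pullback (f : W' →ₗ[ℂ] W''))).map (pullback (e : W →ₗ[ℂ] W')) =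
      Φ.map (pullback (e.trans f : W →ₗ[ℂ] W'')) := by
  rw [← Submodule.map_comp]
  rfl

theorem map_pullback_refl (Φ : Submodule ℂ (QuadraticForm ℂ W)) :
    Φ.map (pullback (LinearEquiv.refl ℂ W : W →ₗ[ℂ] W)) = Φ := by
  ext q
  constructor
  · rintro ⟨q', hq', rfl⟩
    exact hq'
  · exact fun hq => ⟨q, hq, rfl⟩

theorem map_pullback_eq_iff (e : W ≃ₗ[ℂ] W') (Φ : Submodule ℂ (QuadraticForm ℂ W'))
    (Ψ : Submodule ℂ (QuadraticForm ℂ W)) : Φ.map (pullback (e : W →ₗ[ℂ] W')) = Ψ ↔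
      Φ = Ψ.map (pullback (e.symm : W' →ₗ[ℂ] W)) := by
  constructor
  · rintro rfl
    rw [map_pullback_trans, LinearEquiv.symm_trans_self, map_pullback_refl]
  · rintro rfl
    rw [map_pullback_trans, LinearEquiv.self_trans_symm, map_pullback_refl]

/-- Removes the arbitrary tangent frames from the definition of the moduli map. -/
theorem moduliMap_eq_iff {X : Set (ℙ ℂ (Fin (n + 3) → ℂ))} (x y : nonsingularLocus X) :
    moduliMap X y = moduliMap X x ↔ ∃ T : TangentAt X y.1 ≃ₗ[ℂ] TangentAt X x.1,
      secondFundamentalForm X y.1 =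
        (secondFundamentalForm X x.1).map (pullback (T : TangentAt X y.1 →ₗ[ℂ] TangentAt X x.1)) := by
  rw [eq_comm]
  refine (Quotient.eq (r := projectiveEquivalence n)).trans ?_
  change (∃ T : (Fin n → ℂ) ≃ₗ[ℂ] (Fin n → ℂ), _) ↔ _
  constructor
  · rintro ⟨T, hT⟩
    refine ⟨((tangentFrame X y).symm.trans T).trans (tangentFrame X x), ?_⟩
    dsimp only at hT
    rw [map_pullback_eq_iff, map_pullback_trans, map_pullback_trans] at hT
    rw [hT]
  · rintro ⟨T, hT⟩
    refine ⟨((tangentFrame X y).trans T).trans (tangentFrame X x).symm, ?_⟩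
    dsimp only
    rw [hT, map_pullback_trans, map_pullback_trans]
    congr 2
    ext u
    simp

theorem span_pair_change {q₁ q₂ : QuadraticForm ℂ W} {g : Fin 4 → ℂ} (hg : det₂ g ≠ 0) :
    Submodule.span ℂ {g 0 • q₁ + g 1 • q₂, g 2 • q₁ + g 3 • q₂} = Submodule.span ℂ {q₁, q₂} := by
  apply le_antisymm
  · rw [Submodule.span_le]
    rintro q (rfl | rfl)
    · exact Submodule.mem_span_pair.2 ⟨_, _, rfl⟩
    · exact Submodule.mem_span_pair.2 ⟨_, _, rfl⟩
  · rw [Submodule.span_le]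
    rintro q (rfl | rfl)
    · refine Submodule.mem_span_pair.2 ⟨g 3 / det₂ g, -g 1 / det₂ g, ?_⟩
      have e1 : g 3 / det₂ g * g 0 + -g 1 / det₂ g * g 2 = 1 := by
        field_simp
        rw [det₂]; ring
      have e2 : g 3 / det₂ g * g 1 + -g 1 / det₂ g * g 3 = 0 := by
        field_simp
        ring
      rw [smul_add, smul_add, smul_smul, smul_smul, smul_smul, smul_smul, add_add_add_comm,
        ← add_smul, ← add_smul, e1, e2, one_smul, zero_smul, add_zero]
    · refine Submodule.mem_span_pair.2 ⟨-g 2 / det₂ g, g 0 / det₂ g, ?_⟩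
      have e1 : -g 2 / det₂ g * g 0 + g 0 / det₂ g * g 2 = 0 := by
        field_simp
        ring
      have e2 : -g 2 / det₂ g * g 1 + g 0 / det₂ g * g 3 = 1 := by
        field_simp
        rw [det₂]; ring
      rw [smul_add, smul_add, smul_smul, smul_smul, smul_smul, smul_smul, add_add_add_comm,
        ← add_smul, ← add_smul, e1, e2, one_smul, zero_smul, zero_add]

theorem exists_change_of_span_eq {p₁ p₂ q₁ q₂ : QuadraticForm ℂ W}
    (hp : LinearIndependent ℂ ![p₁, p₂]) (h : Submodule.span ℂ {p₁, p₂} = Submodule.span ℂ {q₁, q₂}) :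
    ∃ g : Fin 4 → ℂ, det₂ g ≠ 0 ∧ p₁ = g 0 • q₁ + g 1 • q₂ ∧ p₂ = g 2 • q₁ + g 3 • q₂ := by
  have h1 : p₁ ∈ Submodule.span ℂ {q₁, q₂} := h ▸ Submodule.subset_span (Set.mem_insert _ _)
  have h2 : p₂ ∈ Submodule.span ℂ {q₁, q₂} :=
    h ▸ Submodule.subset_span (Set.mem_insert_of_mem _ rfl)
  obtain ⟨a, c, hac⟩ := Submodule.mem_span_pair.1 h1
  obtain ⟨d, e, hde⟩ := Submodule.mem_span_pair.1 h2
  refine ⟨![a, c, d, e], fun h0 => ?_, hac.symm, hde.symm⟩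
  have hli := LinearIndependent.pair_iff.1 hp
  have h0' : a * e - c * d = 0 := h0
  have k1 := hli e (-c) (by
    rw [← hac, ← hde]
    have : e • (a • q₁ + c • q₂) + -c • (d • q₁ + e • q₂) = (a * e - c * d) • q₁ := by module
    rw [this, h0', zero_smul])
  have k2 := hli (-d) a (by
    rw [← hac, ← hde]
    have : -d • (a • q₁ + c • q₂) + a • (d • q₁ + e • q₂) = (a * e - c * d) • q₂ := by module
    rw [this, h0', zero_smul])
  have k3 := hli 1 0 (by
    rw [← hac, k2.2, neg_eq_zero.1 k1.2]
    simp)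
  exact one_ne_zero k3.1

theorem HasRoots.normalize {q₁ q₂ : QuadraticForm ℂ W} {α β : Fin n → ℂ} (h : HasRoots q₁ q₂ α β)
    (hα : ∀ k, α k ≠ 0) : HasRoots q₁ q₂ (fun _ => 1) (fun k => -(-β k / α k)) := by
  refine ⟨fun k m hkm h0 => h.pairwise k m hkm ?_, fun s t hst => ?_⟩
  · have hk := hα k
    have hm := hα m
    field_simp at h0
    linear_combination h0
  · rw [h.degenerate_iff s t hst]
    refine exists_congr fun k => ?_
    have hk := hα k
    field_simp

theorem HasRoots.of_change {q₁ q₂ : QuadraticForm ℂ W} {g : Fin 4 → ℂ} {r : Fin n → ℂ}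
    (hg : det₂ g ≠ 0) (hr : Function.Injective r)
    (h : HasRoots (g 0 • q₁ + g 1 • q₂) (g 2 • q₁ + g 3 • q₂) (fun _ => 1) (fun k => -r k)) :
    HasRoots q₁ q₂ (fun k => g 0 - r k * g 2) (fun k => g 1 - r k * g 3) := by
  refine ⟨moebius_pairwise hr hg, fun s t hst => ?_⟩
  rw [← isDegenerate_smul_iff hg]
  have e : det₂ g • (s • q₁ + t • q₂) = (s * g 3 - t * g 2) • (g 0 • q₁ + g 1 • q₂) +
      (t * g 0 - s * g 1) • (g 2 • q₁ + g 3 • q₂) := by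
    rw [det₂]
    module
  rw [e, h.degenerate_iff]
  · refine exists_congr fun k => ?_
    constructor <;> intro h <;> linear_combination h
  · intro h0
    obtain ⟨h1, h2⟩ := Prod.mk_eq_zero.1 h0
    apply hst
    have h3 : det₂ g * s = 0 := by
      rw [det₂]; linear_combination g 0 * h1 + g 2 * h2
    have h4 : det₂ g * t = 0 := by
      rw [det₂]; linear_combination g 1 * h1 + g 3 * h2
    exact Prod.mk_eq_zero.2 ⟨(mul_eq_zero.1 h3).resolve_left hg, (mul_eq_zero.1 h4).resolve_left hg⟩

/-- A Möbius transformation permuting the roots acts linearly on the pencil and preserves its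
degenerate elements. It is then scalar on the pencil, so g is scalar and the permutation is trivial.
-/
theorem HasRoots.hasTrivialStabilizer {q₁ q₂ : QuadraticForm ℂ W} {r : Fin n → ℂ}
    [FiniteDimensional ℂ W] (hn : 2 ≤ n) (hr : Function.Injective r)
    (h : HasRoots q₁ q₂ (fun _ => 1) (fun k => -r k))
    (H : HasTrivialAutomorphisms (Submodule.span ℂ {q₁, q₂})) : HasTrivialStabilizer r := by
  intro g τ hg hτ
  have hli := h.linearIndependent hn
  let f : ℂ × ℂ →ₗ[ℂ] Submodule.span ℂ {q₁, q₂} :=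
    { toFun := fun p => ⟨p.1 • q₁ + p.2 • q₂, Submodule.mem_span_pair.2 ⟨_, _, rfl⟩⟩
      map_add' := fun p p' => Subtype.ext (by
        change (p.1 + p'.1) • q₁ + (p.2 + p'.2) • q₂ =
          (p.1 • q₁ + p.2 • q₂) + (p'.1 • q₁ + p'.2 • q₂)
        module)
      map_smul' := fun a p => Subtype.ext (by
        change (a * p.1) • q₁ + (a * p.2) • q₂ = a • (p.1 • q₁ + p.2 • q₂)
        module) }
  have hf : Function.Bijective f := by
    constructor
    · rw [← LinearMap.ker_eq_bot, LinearMap.ker_eq_bot']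
      intro p hp
      exact Prod.mk_eq_zero.2 (LinearIndependent.pair_iff.1 hli _ _ (congrArg Subtype.val hp))
    · rintro ⟨q, hq⟩
      obtain ⟨s, t, rfl⟩ := Submodule.mem_span_pair.1 hq
      exact ⟨(s, t), rfl⟩
  let e := LinearEquiv.ofBijective f hf
  -- Chosen so that (1, -r_k) goes to the multiple of (1, -r_{τ k}) by the denominator g₂ r_k + g₃.
  let M : ℂ × ℂ →ₗ[ℂ] ℂ × ℂ :=
    { toFun := fun p => (p.1 * g 3 - p.2 * g 2, p.2 * g 0 - p.1 * g 1)
      map_add' := fun p p' => by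
        simp only [Prod.fst_add, Prod.snd_add, Prod.mk_add_mk]
        congr 1 <;> ring
      map_smul' := fun a p => by
        simp only [Prod.smul_fst, Prod.smul_snd, smul_eq_mul, RingHom.id_apply, Prod.smul_mk]
        congr 1 <;> ring }
  have hM : Function.Injective M := by
    rw [← LinearMap.ker_eq_bot, LinearMap.ker_eq_bot']
    rintro ⟨s, t⟩ hp
    obtain ⟨h1, h2⟩ := Prod.mk_eq_zero.1 (show (s * g 3 - t * g 2, t * g 0 - s * g 1) = 0 from hp)
    have h3 : det₂ g * s = 0 := by
      rw [det₂]; linear_combination g 0 * h1 + g 2 * h2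
    have h4 : det₂ g * t = 0 := by
      rw [det₂]; linear_combination g 1 * h1 + g 3 * h2
    exact Prod.mk_eq_zero.2 ⟨(mul_eq_zero.1 h3).resolve_left hg, (mul_eq_zero.1 h4).resolve_left hg⟩
  let A := (e.symm.trans (LinearEquiv.ofInjectiveEndo M hM)).trans e
  have hA : ∀ p, A (f p) = f (M p) := by
    intro p
    change e (M (e.symm (e p))) = f (M p)
    rw [LinearEquiv.symm_apply_apply]
    rfl
  obtain ⟨a, ha⟩ := H A (by
    intro q
    obtain ⟨p, rfl⟩ := hf.2 q
    rw [hA]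
    by_cases hp : p = 0
    · rw [hp, map_zero, map_zero]
    have hp' : M p ≠ 0 := fun h0 => hp (hM (by rw [h0, map_zero]))
    change IsDegenerate ((p.1 * g 3 - p.2 * g 2) • q₁ + (p.2 * g 0 - p.1 * g 1) • q₂) ↔
      IsDegenerate (p.1 • q₁ + p.2 • q₂)
    rw [h.degenerate_iff _ _ hp', h.degenerate_iff _ _ hp]
    rw [← τ.exists_congr_right]
    refine exists_congr fun k => ?_
    have hd := (hτ k).den_ne_zero hg
    have hk := hτ k
    rw [Sends] at hk
    rw [← mul_right_inj' hd, ← mul_right_inj' hg (b := p.1 * -r k), det₂]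
    constructor
    · intro h; linear_combination h - (p.1 * g 3 - p.2 * g 2) * hk
    · intro h; linear_combination h + (p.1 * g 3 - p.2 * g 2) * hk)
  have hMa : ∀ p, M p = a • p := by
    intro p
    apply hf.1
    rw [← hA, ha, map_smul]
  have h1 := hMa (1, 0)
  have h2 := hMa (0, 1)
  simp only [M, LinearMap.coe_mk, AddHom.coe_mk, Prod.smul_mk, Prod.mk.injEq, smul_eq_mul, one_mul,
    zero_mul, sub_zero, zero_sub, mul_one, mul_zero, neg_eq_zero] at h1 h2
  have ha0 : a ≠ 0 := by
    rintro rfl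
    apply hg
    rw [det₂, h1.1, h1.2]
    ring
  ext k
  have hk := hτ k
  rw [Sends, h2.2, h1.2, h2.1, h1.1] at hk
  have : r k = r (τ k) := mul_left_cancel₀ ha0 (by linear_combination hk)
  rw [← hr this]
  rfl

end Transport

/-! ### The fiber through a regular point, described by Möbius transformations -/

section Fiber

variable {n : ℕ} {φ₁ φ₂ : QuadraticForm ℂ (Fin (n + 3) → ℂ)}
  {x : nonsingularLocus (quadricIntersection φ₁ φ₂)}
  {b : Module.Basis (Fin (n + 3)) ℂ (Fin (n + 3) → ℂ)} {l : Fin (n + 3) → ℂ} {r : Fin n → ℂ}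

/-- The coordinates of `v` and the Möbius transformation `g` are related by
`z_i² ∏_{j ≠ i} (l_i - l_j) = ∏_k ((g₀ l_i + g₁) - r_k (g₂ l_i + g₃))`. -/
def MoebiusRel (b : Module.Basis (Fin (n + 3)) ℂ (Fin (n + 3) → ℂ)) (l : Fin (n + 3) → ℂ)
    (r : Fin n → ℂ) (v : Fin (n + 3) → ℂ) (g : Fin 4 → ℂ) : Prop :=
  det₂ g ≠ 0 ∧ ∀ i, b.repr v i ^ 2 * nodeWeight l i = (moebiusPoly r g).eval (l i)

/-- A standard basis and the degenerate elements of the second fundamental form at a point. -/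
structure IsChart (φ₁ φ₂ : QuadraticForm ℂ (Fin (n + 3) → ℂ))
    (x : nonsingularLocus (quadricIntersection φ₁ φ₂))
    (b : Module.Basis (Fin (n + 3)) ℂ (Fin (n + 3) → ℂ)) (l : Fin (n + 3) → ℂ)
    (r : Fin n → ℂ) : Prop where
  three_le : 3 ≤ n
  nonsingular : IsNonsingularIntersection φ₁ φ₂
  standard : IsStandardBasis φ₁ φ₂ b l
  injective : Function.Injective r
  trivialStabilizer : HasTrivialStabilizer r
  hasRoots : HasRoots (firstForm nonsingular x.2.1) (secondForm nonsingular x.2.1)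
    (fun _ => 1) (fun k => -r k)
  ne_root : ∀ i k, l i ≠ r k
  exists_moebiusRel : ∃ μ : ℂ, μ ≠ 0 ∧ MoebiusRel b l r x.1.rep ![μ, 0, 0, μ]

theorem isInducedForm_eq {X : Set (ℙ ℂ (Fin (n + 3) → ℂ))} {x : ℙ ℂ (Fin (n + 3) → ℂ)}
    {φ : QuadraticForm ℂ (Fin (n + 3) → ℂ)} {q : QuadraticForm ℂ (TangentAt X x)}
    (hq : IsInducedForm X x φ q) (h : ∀ w ∈ affineTangent X x.rep, associated φ x.rep w = 0) :
    q = inducedForm X x φ h := by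
  ext w
  obtain ⟨w, rfl⟩ := Submodule.Quotient.mk_surjective _ w
  exact (hq w).trans (inducedForm_apply w).symm

/-- Nondegeneracy of φ₂ on the tangent space excludes a root at infinity. Nonzero coordinates mean
that P does not vanish at the nodes, so no node is a root. The remaining constant is absorbed into
an n-th root μ, as P is homogeneous of degree n in g. -/
theorem IsRegularPoint.exists_isChart (hn : 3 ≤ n) (hX : IsNonsingularIntersection φ₁ φ₂)
    (hx : IsRegularPoint φ₁ φ₂ x.1) : ∃ b l r, IsChart φ₁ φ₂ x b l r := by
  obtain ⟨b, l, hb, hz⟩ := hx.general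
  have hII := secondFundamentalForm_eq_span hX x.2.1
  have hns := x.2.2
  rw [hII] at hns
  obtain ⟨α, β, h⟩ := hns.exists_hasRoots
  have hα : ∀ k, α k ≠ 0 := by
    intro k hk
    obtain ⟨q, hq, hqd⟩ := hx.nondegenerate₂
    apply hqd
    rw [isInducedForm_eq hq (associated_rep_eq_zero hX x.2.1).2]
    have := (h.degenerate_iff 0 1 (by simp)).2 ⟨k, by rw [hk]; ring⟩
    simpa using this
  obtain ⟨r, hr⟩ : ∃ r : Fin n → ℂ, HasRoots (firstForm hX x.2.1) (secondForm hX x.2.1)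
      (fun _ => 1) (fun k => -r k) := ⟨_, h.normalize hα⟩
  have hri : Function.Injective r := by
    intro k m hkm
    by_contra hne
    exact hr.pairwise k m hne (by simp [hkm])
  obtain ⟨κ, hκ, hκz⟩ := exists_poly_of_hasRoots hb hX x.2.1 hr
  obtain ⟨μ, hμ⟩ := IsAlgClosed.exists_pow_nat_eq κ (show 0 < n by omega)
  have hμ0 : μ ≠ 0 := by
    rintro rfl
    apply hκ
    rw [← hμ, zero_pow (by omega)]
  refine ⟨b, l, r, hn, hX, hb, hri, hr.hasTrivialStabilizer (by omega) hri
    (hII ▸ hx.trivialAutomorphisms), hr, fun i k hik => ?_, μ, hμ0, by simp [det₂, hμ0], fun i => ?_⟩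
  · have := hκz i
    rw [eval_prod, Finset.prod_eq_zero (Finset.mem_univ k) (by simp [hik]), mul_zero] at this
    exact mul_ne_zero (pow_ne_zero 2 (hz i)) (nodeWeight_ne_zero hb.1 i) this
  · rw [hκz, ← hμ]
    have : (![μ, 0, 0, μ] : Fin 4 → ℂ) = μ • ![1, 0, 0, 1] := by simp
    rw [this, moebiusPoly_smul, eval_mul, eval_C]
    simp [moebiusPoly]

/-- The relation has degree 2 in the vector and degree n in the matrix, so scaling v by a is matched
by scaling g by an n-th root of a². -/
theorem MoebiusRel.smul {v : Fin (n + 3) → ℂ} {g : Fin 4 → ℂ} (hn : 0 < n)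
    (h : MoebiusRel b l r v g) {a : ℂ} (ha : a ≠ 0) :
    ∃ ν : ℂ, ν ≠ 0 ∧ MoebiusRel b l r (a • v) (ν • g) := by
  obtain ⟨ν, hν⟩ := IsAlgClosed.exists_pow_nat_eq (a ^ 2) hn
  have hν0 : ν ≠ 0 := by
    rintro rfl
    rw [zero_pow hn.ne'] at hν
    exact pow_ne_zero 2 ha hν.symm
  refine ⟨ν, hν0, ?_, fun i => ?_⟩
  · rw [det₂_smul]
    exact mul_ne_zero (pow_ne_zero 2 hν0) h.1
  · rw [moebiusPoly_smul, eval_mul, eval_C, hν, ← h.2, map_smul, Finsupp.smul_apply, smul_eq_mul]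
    ring

namespace IsChart

/-- The relation says that the roots at y are the preimages of the r_k under g. Changing the basis
of the pencil at y by g makes its roots equal to those at x, and pencils with equal roots are
isomorphic. -/
theorem isNonsingularPencil_of_moebiusRel (hc : IsChart φ₁ φ₂ x b l r) {y : ℙ ℂ (Fin (n + 3) → ℂ)}
    {g : Fin 4 → ℂ} (h : MoebiusRel b l r y.rep g) : y ∈ moduliFiber (quadricIntersection φ₁ φ₂) x := by
  have hX := hc.nonsingular
  have hn := hc.three_le
  have hy : y ∈ quadricIntersection φ₁ φ₂ := by
    obtain ⟨hu, hmem⟩ := mem_cone_of_poly hc.standard y.rep_nonzero (natDegree_moebiusPoly_le r g) h.2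
    rwa [y.mk_rep] at hmem
  have hroots := hasRoots_of_poly hc.standard hX hy (moebius_pairwise hc.injective h.1) h.2
  have hII := secondFundamentalForm_eq_span hX hy
  have hyo : y ∈ nonsingularLocus (quadricIntersection φ₁ φ₂) :=
    ⟨hy, hII ▸ hroots.isNonsingularPencil (by omega) (finrank_tangentAt hX hy)⟩
  refine ⟨hyo, (moduliMap_eq_iff x ⟨y, hyo⟩).2 ?_⟩
  obtain ⟨T, hT₁, hT₂⟩ := hc.hasRoots.exists_equiv (by omega) (finrank_tangentAt hX x.2.1)
    (finrank_tangentAt hX hy) (hroots.change h.1)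
  refine ⟨T, ?_⟩
  rw [hII, secondFundamentalForm_eq_span hX x.2.1, Submodule.map_span, Set.image_pair, hT₁, hT₂,
    span_pair_change h.1]

/-- An isomorphism of the pencils at y and x carries one basis to another, and the matrix relating
them is g up to normalization; an n-th root again absorbs the constant. -/
theorem exists_moebiusRel_of_mem (hc : IsChart φ₁ φ₂ x b l r) {y : ℙ ℂ (Fin (n + 3) → ℂ)}
    (hy : y ∈ moduliFiber (quadricIntersection φ₁ φ₂) x) : ∃ g, MoebiusRel b l r y.rep g := by
  have hX := hc.nonsingular
  have hn := hc.three_le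
  obtain ⟨hyo, hy⟩ := hy
  obtain ⟨T, hT⟩ := (moduliMap_eq_iff x ⟨y, hyo⟩).1 hy
  have hyX : y ∈ quadricIntersection φ₁ φ₂ := hyo.1
  have hr := hc.hasRoots.pullback T
  rw [secondFundamentalForm_eq_span hX hyX, secondFundamentalForm_eq_span hX x.2.1,
    Submodule.map_span, Set.image_pair] at hT
  set p₁ := QuadricPencil.pullback (T : TangentAt (quadricIntersection φ₁ φ₂) y →ₗ[ℂ]
    TangentAt (quadricIntersection φ₁ φ₂) x.1) (firstForm hX x.2.1) with hp₁
  set p₂ := QuadricPencil.pullback (T : TangentAt (quadricIntersection φ₁ φ₂) y →ₗ[ℂ]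
    TangentAt (quadricIntersection φ₁ φ₂) x.1) (secondForm hX x.2.1) with hp₂
  obtain ⟨g, hg, hg₁, hg₂⟩ := exists_change_of_span_eq (hr.linearIndependent (by omega)) hT.symm
  have hr' : HasRoots (g 0 • firstForm hX hyX + g 1 • secondForm hX hyX)
      (g 2 • firstForm hX hyX + g 3 • secondForm hX hyX) (fun _ => 1) (fun k => -r k) := by
    rw [← hg₁, ← hg₂]
    exact hr
  obtain ⟨κ, hκ, hκz⟩ := exists_poly_of_hasRoots hc.standard hX hyX
    (HasRoots.of_change hg hc.injective hr')
  obtain ⟨ν, hν⟩ := IsAlgClosed.exists_pow_nat_eq κ (show 0 < n by omega)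
  have hν0 : ν ≠ 0 := by
    rintro rfl
    apply hκ
    rw [← hν, zero_pow (by omega)]
  refine ⟨ν • g, ?_, fun i => ?_⟩
  · rw [det₂_smul]
    exact mul_ne_zero (pow_ne_zero 2 hν0) hg
  · rw [hκz, moebiusPoly_smul, eval_mul, eval_C, hν]
    rfl

theorem mk_mem_moduliFiber_iff (hc : IsChart φ₁ φ₂ x b l r) {v : Fin (n + 3) → ℂ} (hv : v ≠ 0) :
    Projectivization.mk ℂ v hv ∈ moduliFiber (quadricIntersection φ₁ φ₂) x ↔
      ∃ g, MoebiusRel b l r v g := by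
  have hn := hc.three_le
  obtain ⟨a, ha⟩ := Projectivization.exists_smul_eq_mk_rep ℂ v hv
  rw [Units.smul_def] at ha
  constructor
  · intro h
    obtain ⟨g, hg⟩ := hc.exists_moebiusRel_of_mem h
    rw [← ha] at hg
    obtain ⟨ν, -, h⟩ := hg.smul (by omega) (inv_ne_zero a.ne_zero)
    rw [smul_smul, inv_mul_cancel₀ a.ne_zero, one_smul] at h
    exact ⟨_, h⟩
  · rintro ⟨g, hg⟩
    obtain ⟨ν, -, h⟩ := hg.smul (by omega) a.ne_zero
    rw [ha] at h
    exact hc.isNonsingularPencil_of_moebiusRel h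

theorem mem_cone_moduliFiber_iff (hc : IsChart φ₁ φ₂ x b l r) {v : Fin (n + 3) → ℂ} :
    v ∈ cone (moduliFiber (quadricIntersection φ₁ φ₂) x) ↔ v ≠ 0 ∧ ∃ g, MoebiusRel b l r v g :=
  ⟨fun ⟨hv, h⟩ => ⟨hv, (hc.mk_mem_moduliFiber_iff hv).1 h⟩,
    fun ⟨hv, h⟩ => ⟨hv, (hc.mk_mem_moduliFiber_iff hv).2 h⟩⟩

theorem moebiusRel_unique (hc : IsChart φ₁ φ₂ x b l r) {v v' : Fin (n + 3) → ℂ} {g g' : Fin 4 → ℂ}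
    (h : MoebiusRel b l r v g) (h' : MoebiusRel b l r v' g')
    (hv : ∀ i, b.repr v' i ^ 2 = b.repr v i ^ 2) : ∃ a : ℂ, a ≠ 0 ∧ g' = a • g := by
  refine exists_eq_smul_of_moebiusPoly_eq hc.three_le hc.injective hc.trivialStabilizer h.1 h'.1 ?_
  refine eq_of_eval_nodes_eq hc.standard.1 ((natDegree_moebiusPoly_le r g).trans (by omega))
    ((natDegree_moebiusPoly_le r g').trans (by omega)) fun i => ?_
  rw [← h.2, ← h'.2, hv]

theorem exists_moebiusRel_vector (hc : IsChart φ₁ φ₂ x b l r) {g : Fin 4 → ℂ} (hg : det₂ g ≠ 0) :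
    ∃ v, v ≠ 0 ∧ MoebiusRel b l r v g := by
  have h : ∀ i, ∃ z : ℂ, z ^ 2 = (moebiusPoly r g).eval (l i) / nodeWeight l i := fun i =>
    IsAlgClosed.exists_pow_nat_eq _ (by norm_num)
  choose z hz using h
  have hrel : MoebiusRel b l r (b.equivFun.symm z) g := by
    refine ⟨hg, fun i => ?_⟩
    have : b.repr (b.equivFun.symm z) i = z i := congrFun (b.equivFun.apply_symm_apply z) i
    rw [this, hz, div_mul_cancel₀ _ (nodeWeight_ne_zero hc.standard.1 i)]
  refine ⟨_, ?_, hrel⟩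
  intro h0
  have h1 : moebiusPoly r g = 0 := by
    refine eq_of_eval_nodes_eq hc.standard.1 ((natDegree_moebiusPoly_le r g).trans (by omega))
      (by simp) fun i => ?_
    rw [← hrel.2, h0]
    simp
  obtain ⟨k, -, hk⟩ := Finset.prod_eq_zero_iff.1 h1
  have h2 := congrArg (fun p => p.coeff 0) hk
  have h3 := congrArg (fun p => p.coeff 1) hk
  simp at h2 h3
  apply hg
  rw [det₂]
  linear_combination g 3 * h3 - g 2 * h2

end IsChart

end Fiber

end QuadricPencil

namespace QuadricPencil

open Polynomial

/-! ### Recovering a Möbius transformation from a polynomial -/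

section Recovery

variable {n : ℕ} {r : Fin n → ℂ} {σ : Type*}

/-- The projective change of variables `m` in the homogenization of degree `n` of `P`. -/
def rotate (n : ℕ) (m : Fin 4 → ℂ) (P : ℂ[X]) : ℂ[X] :=
  ∑ j ∈ Finset.range (n + 1),
    C (P.coeff j) * ((C (m 0) * X + C (m 1)) ^ j * (C (m 2) * X + C (m 3)) ^ (n - j))

theorem eval_rotate {P : ℂ[X]} (hP : P.natDegree ≤ n) (m : Fin 4 → ℂ) {t : ℂ}
    (ht : m 2 * t + m 3 ≠ 0) : (rotate n m P).eval t =
      (m 2 * t + m 3) ^ n * P.eval ((m 0 * t + m 1) / (m 2 * t + m 3)) := by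
  rw [eval_eq_sum_range' (show P.natDegree < n + 1 by omega), rotate, eval_finsetSum,
    Finset.mul_sum]
  refine Finset.sum_congr rfl fun j hj => ?_
  have hj' : j ≤ n := Finset.mem_range_succ_iff.1 hj
  simp only [eval_mul, eval_pow, eval_add, eval_C, eval_X]
  have : (m 2 * t + m 3) ^ n = (m 2 * t + m 3) ^ (n - j) * (m 2 * t + m 3) ^ j := by
    rw [← pow_add, Nat.sub_add_cancel hj']
  rw [this, div_pow]
  generalize m 2 * t + m 3 = B at ht
  field_simp

/-- Both sides agree wherever m₂ t + m₃ does not vanish, hence at infinitely many points. -/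
theorem rotate_moebiusPoly {m : Fin 4 → ℂ} (hm : det₂ m ≠ 0) (h : Fin 4 → ℂ) :
    rotate n m (moebiusPoly r h) = moebiusPoly r (mul₂ h m) := by
  apply eq_of_infinite_eval_eq
  have hfin : {t : ℂ | m 2 * t + m 3 = 0}.Finite := by
    apply Set.Subsingleton.finite
    intro t ht t' ht'
    rw [Set.mem_ofPred_eq] at ht ht'
    have h2 : m 2 ≠ 0 := by
      intro h2
      apply hm
      rw [h2, zero_mul, zero_add] at ht
      rw [det₂, h2, ht]
      ring
    exact mul_left_cancel₀ h2 (by linear_combination ht - ht')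
  refine hfin.infinite_compl.mono fun t ht => ?_
  have ht' : m 2 * t + m 3 ≠ 0 := ht
  rw [Set.mem_ofPred_eq, eval_rotate (natDegree_moebiusPoly_le r h) m ht', eval_moebiusPoly,
    eval_moebiusPoly]
  have : (m 2 * t + m 3) ^ n = ∏ _k : Fin n, (m 2 * t + m 3) := by simp
  rw [this, ← Finset.prod_mul_distrib]
  refine Finset.prod_congr rfl fun k _ => ?_
  simp only [mul₂, Matrix.cons_val]
  field_simp
  ring

theorem isPolyFamily_rotate {P : (σ → ℂ) → ℂ[X]} (hP : IsPolyFamily P) (m : Fin 4 → ℂ) :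
    IsPolyFamily fun v => rotate n m (P v) :=
  IsPolyFamily.sum _ fun j => (IsPolyFamily.C (hP j)).mul (IsPolyFamily.fixed _)

theorem moebiusPoly_eq_C_mul_prod {g : Fin 4 → ℂ} (hg : ∀ k, g 0 - r k * g 2 ≠ 0) :
    ∃ w : Fin n → ℂ, (∀ k, Sends g (w k) (r k)) ∧
      moebiusPoly r g = C (∏ k, (g 0 - r k * g 2)) * ∏ k, (X - C (w k)) := by
  refine ⟨fun k => -(g 1 - r k * g 3) / (g 0 - r k * g 2), fun k => ?_, ?_⟩
  · have := hg k
    rw [Sends]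
    field_simp
    ring
  · rw [map_prod, ← Finset.prod_mul_distrib]
    refine Finset.prod_congr rfl fun k _ => ?_
    have := hg k
    rw [mul_sub, ← C_mul, mul_div_cancel₀ _ this, C_neg, sub_neg_eq_add]

/-- Locally around g, the matrix h is a polynomial function, up to a scalar, of the polynomial it
defines; this is what makes the map to PGL₂ a morphism. The roots w are only known without order,
but the separating polynomial ψ, evaluated at their cross ratios, singles out the ordering
corresponding to r, because cross ratios are Möbius invariant. Symmetrizing ψ times the normalizing
matrix of w thus yields this matrix for the right ordering and remains polynomial in the
coefficients. -/
theorem exists_recovery (hn : 3 ≤ n) (hr : Function.Injective r) (hT : HasTrivialStabilizer r)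
    {P : (σ → ℂ) → ℂ[X]} (hP : IsPolyFamily P) {g : Fin 4 → ℂ} (hg : det₂ g ≠ 0) :
    ∃ (G : (σ → ℂ) → Fin 4 → ℂ) (e : (σ → ℂ) → ℂ), (∀ i, IsPoly fun u => G u i) ∧ IsPoly e ∧
      (∀ u, P u = moebiusPoly r g → e u ≠ 0) ∧
      ∀ u h, det₂ h ≠ 0 → P u = moebiusPoly r h → e u ≠ 0 → ∃ a : ℂ, a ≠ 0 ∧ G u = a • h := by
  have hadj : det₂ (adj₂ g) ≠ 0 := by rwa [det₂_adj₂]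
  let i₀ : Fin n := ⟨0, by omega⟩
  let j₀ : Fin n := ⟨1, by omega⟩
  let k₀ : Fin n := ⟨2, by omega⟩
  have hij : i₀ ≠ j₀ := by simp [i₀, j₀]
  have hik : i₀ ≠ k₀ := by simp [i₀, k₀]
  have hjk : j₀ ≠ k₀ := by simp [j₀, k₀]
  obtain ⟨ψ, hψ1, hψ0⟩ := exists_separating hr hT hij hik hjk
  obtain ⟨H, N, hH⟩ := exists_eval_crossRatio_eq (k := k₀) hij ψ
  have hstd : ∀ i, ∃ p : MvPolynomial (Fin n) ℂ, ∀ w, stdMatrix i₀ j₀ k₀ w i = MvPolynomial.eval w p := by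
    have hc : ∀ j, IsPoly fun w : Fin n → ℂ => w j := IsPoly.coord
    intro i
    fin_cases i
    · exact (hc j₀).sub (hc k₀)
    · exact ((hc i₀).mul ((hc j₀).sub (hc k₀))).neg
    · exact (hc j₀).sub (hc i₀)
    · exact ((hc k₀).mul ((hc j₀).sub (hc i₀))).neg
  choose p hp using hstd
  -- The rotation by the adjugate of g replaces h by c = h · adj g, a scalar matrix when h = g. The
  -- roots are then finite near g, and the leading coefficient e records this.
  have hQ := isPolyFamily_rotate (n := n) hP (adj₂ g)
  obtain ⟨S, M, hS, hSM⟩ := exists_isPoly_symmetrization_family hQ fun i => H * p i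
  set A := adj₂ (stdMatrix i₀ j₀ k₀ r) with hA
  refine ⟨fun u => mul₂ (mul₂ A fun i => S i u) g, fun u => (rotate n (adj₂ g) (P u)).coeff n, ?_,
    hQ n, fun u hu => ?_, fun u h hh hu he => ?_⟩
  · intro i
    fin_cases i <;> simp only [mul₂, Fin.zero_eta, Fin.mk_one, Fin.reduceFinMk, Matrix.cons_val] <;>
      exact ((((IsPoly.const _).mul (hS _)).add ((IsPoly.const _).mul (hS _))).mul
        (IsPoly.const _)).add ((((IsPoly.const _).mul (hS _)).add
        ((IsPoly.const _).mul (hS _))).mul (IsPoly.const _))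
  · dsimp only
    rw [hu, rotate_moebiusPoly hadj, moebiusPoly, coeff_prod_linear]
    refine Finset.prod_ne_zero_iff.2 fun k _ => ?_
    have : mul₂ g (adj₂ g) 0 - r k * mul₂ g (adj₂ g) 2 = det₂ g := by
      simp only [mul₂, adj₂, det₂, Matrix.cons_val]
      ring
    rwa [this]
  · set c := mul₂ h (adj₂ g) with hc
    have hcdet : det₂ c ≠ 0 := by
      rw [hc, det₂_mul₂]
      exact mul_ne_zero hh hadj
    dsimp only at he
    rw [hu, rotate_moebiusPoly hadj, moebiusPoly, coeff_prod_linear] at he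
    obtain ⟨w, hw, hcw⟩ := moebiusPoly_eq_C_mul_prod (r := r) (g := c) fun k =>
      Finset.prod_ne_zero_iff.1 he k (Finset.mem_univ k)
    set a := ∏ k, (c 0 - r k * c 2) with ha
    have ha0 : a ≠ 0 := he
    have hwi : Function.Injective w := fun k m hkm =>
      hr ((hw k).functional hcdet (hkm ▸ hw m))
    have hval := hSM u a w (by rw [hu, rotate_moebiusPoly hadj, hcw])
    have hcr : ∀ τ : Equiv.Perm (Fin n), crossRatio i₀ j₀ k₀ (w ∘ τ) = crossRatio i₀ j₀ k₀ (r ∘ τ) :=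
      fun τ => (crossRatio_eq_of_sends hcdet fun m => hw (τ m)).symm
    -- Only the identity permutation survives in the symmetrization.
    have hval' : (fun i => S i u) = (a ^ M * discProd w ^ N) • stdMatrix i₀ j₀ k₀ w := by
      ext i
      rw [hval, Finset.sum_eq_single 1]
      · rw [map_mul, hH _ (hwi.comp (Equiv.injective _)), hcr, Equiv.Perm.coe_one, Function.comp_id,
          Function.comp_id, hψ1, ← hp, Pi.smul_apply, smul_eq_mul]
        ring
      · intro τ _ hτ
        rw [map_mul, hH _ (hwi.comp τ.injective), hcr, hψ0 τ hτ]
        ring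
      · simp
    have hd0 := discProd_ne_zero hwi
    have hrw : crossRatio i₀ j₀ k₀ r = crossRatio i₀ j₀ k₀ w := crossRatio_eq_of_sends hcdet hw
    -- The matrix A · stdMatrix(w) sends w to r, as c does, so the two are proportional. Multiplying
    -- by g turns c back into a multiple of h.
    have hsend := sends_of_crossRatio_eq hij hwi hr hrw
    obtain ⟨a', ha', hca⟩ := exists_eq_smul_of_sends (g := c) (h := mul₂ A (stdMatrix i₀ j₀ k₀ w))
      (x := w ∘ Fin.castLE hn) (y := r ∘ Fin.castLE hn) hcdet (by
        rw [det₂_mul₂, det₂_adj₂]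
        exact mul_ne_zero (det₂_stdMatrix_ne_zero hij hik hjk hr)
          (det₂_stdMatrix_ne_zero hij hik hjk hwi)) (hwi.comp (Fin.castLE_injective hn))
      (fun k => hw _) (fun k => hsend _)
    refine ⟨a ^ M * discProd w ^ N * a' * det₂ g, mul_ne_zero (mul_ne_zero (mul_ne_zero
      (pow_ne_zero _ ha0) (pow_ne_zero _ hd0)) ha') hg, ?_⟩
    have hmul : ∀ (t : ℂ) (x : Fin 4 → ℂ), mul₂ A (t • x) = t • mul₂ A x := by
      intro t x
      ext i
      fin_cases i <;> simp [mul₂] <;> ring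
    have hmul' : ∀ (t : ℂ) (x : Fin 4 → ℂ), mul₂ (t • x) g = t • mul₂ x g := by
      intro t x
      ext i
      fin_cases i <;> simp [mul₂] <;> ring
    have hcg : mul₂ c g = det₂ g • h := by
      ext i
      fin_cases i <;> simp [hc, mul₂, adj₂, det₂] <;> ring
    dsimp only
    rw [hval', hmul, hca, smul_smul, hmul', hcg, smul_smul]

end Recovery

/-! ### Polynomials in squares -/

/-- Summation over all signs multiplies a monomial with even exponents by the number of signs and
kills every other monomial. -/
theorem exists_sum_signs {m : ℕ} (p : MvPolynomial (Fin m) ℂ) : ∃ q : MvPolynomial (Fin m) ℂ,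
    ∀ z : Fin m → ℂ, ∑ ε : Fin m → ℤˣ, MvPolynomial.eval (fun i => ((ε i : ℤ) : ℂ) * z i) p =
      MvPolynomial.eval (fun i => z i ^ 2) q := by
  induction p using MvPolynomial.induction_on' with
  | monomial d a =>
    by_cases hd : ∀ i, Even (d i)
    · refine ⟨MvPolynomial.C ((Fintype.card (Fin m → ℤˣ) : ℂ) * a) * ∏ i, MvPolynomial.X i ^ (d i / 2),
        fun z => ?_⟩
      have h1 : ∀ ε : Fin m → ℤˣ, MvPolynomial.eval (fun i => ((ε i : ℤ) : ℂ) * z i)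
          (MvPolynomial.monomial d a) = a * ∏ i, z i ^ d i := by
        intro ε
        rw [MvPolynomial.eval_monomial, Finsupp.prod_fintype _ _ (by simp)]
        congr 1
        refine Finset.prod_congr rfl fun i _ => ?_
        rw [mul_pow]
        have : (((ε i : ℤ) : ℂ)) ^ d i = 1 := by
          obtain ⟨k, hk⟩ := hd i
          rcases Int.units_eq_one_or (ε i) with h | h <;> rw [h, hk] <;> simp
        rw [this, one_mul]
      rw [Finset.sum_congr rfl fun ε _ => h1 ε, Finset.sum_const, Finset.card_univ]
      simp only [map_mul, map_prod, map_pow, MvPolynomial.eval_C, MvPolynomial.eval_X, nsmul_eq_mul]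
      rw [mul_assoc]
      congr 2
      refine Finset.prod_congr rfl fun i _ => ?_
      rw [← pow_mul, Nat.two_mul_div_two_of_even (hd i)]
    · push Not at hd
      obtain ⟨i, hi⟩ := hd
      refine ⟨0, fun z => ?_⟩
      rw [map_zero]
      -- Flipping the sign at an index with odd exponent pairs terms that cancel.
      refine Finset.sum_involution (fun ε _ => Function.update ε i (-ε i)) ?_ ?_ ?_ ?_
      · intro ε _
        rw [MvPolynomial.eval_monomial, MvPolynomial.eval_monomial,
          Finsupp.prod_fintype _ _ (by simp), Finsupp.prod_fintype _ _ (by simp),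
          ← Finset.mul_prod_erase _ _ (Finset.mem_univ i),
          ← Finset.mul_prod_erase (f := fun x => _ ^ d x) _ (Finset.mem_univ i)]
        have h2 : ∏ x ∈ Finset.univ.erase i,
            ((((Function.update ε i (-ε i)) x : ℤˣ) : ℤ) : ℂ) ^ d x * z x ^ d x =
            ∏ x ∈ Finset.univ.erase i, (((ε x : ℤ) : ℂ)) ^ d x * z x ^ d x := by
          refine Finset.prod_congr rfl fun x hx => ?_
          rw [Function.update_of_ne (Finset.ne_of_mem_erase hx)]
        simp only [mul_pow] at h2 ⊢
        rw [h2, Function.update_self]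
        have : (((-ε i : ℤˣ) : ℤ) : ℂ) ^ d i = -(((ε i : ℤ) : ℂ) ^ d i) := by
          push_cast
          exact (Nat.not_even_iff_odd.1 hi).neg_pow _
        rw [this]
        ring
      · intro ε _ _ h
        have := congrFun h i
        rw [Function.update_self] at this
        exact (units_ne_neg_self (ε i)).symm this
      · intro ε _
        exact Finset.mem_univ _
      · intro ε _
        simp
  | add p q hp hq =>
    obtain ⟨p', hp'⟩ := hp
    obtain ⟨q', hq'⟩ := hq
    exact ⟨p' + q', fun z => by simp only [map_add, Finset.sum_add_distrib, hp', hq']⟩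

/-- A combination of polynomials which does not vanish at the given points. -/
theorem exists_combination_ne_zero {ι : Type*} [Fintype ι] (M : ι → ι → ℂ) (hM : ∀ i, M i i ≠ 0) :
    ∃ t : ι → ℂ, ∀ i, ∑ j, t j * M j i ≠ 0 := by
  classical
  let p : ι → MvPolynomial ι ℂ := fun i => ∑ j, MvPolynomial.X j * MvPolynomial.C (M j i)
  have hp : ∀ i t, MvPolynomial.eval t (p i) = ∑ j, t j * M j i := fun i t => by simp [p]
  have hp0 : ∏ i, p i ≠ 0 := by
    refine Finset.prod_ne_zero_iff.2 fun i _ h => hM i ?_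
    have := hp i (Pi.single i 1)
    rw [h, map_zero, Finset.sum_eq_single i] at this
    · simpa using this.symm
    · intro j _ hj
      simp [hj]
    · simp
  by_contra! hcon
  apply hp0
  apply MvPolynomial.funext
  intro t
  obtain ⟨i, hi⟩ := hcon t
  rw [map_prod, map_zero]
  exact Finset.prod_eq_zero (Finset.mem_univ i) (by rw [hp, hi])

end QuadricPencil

namespace QuadricPencil

open Polynomial

/-! ### The dimension of the fibers of the moduli map -/

section Dimension

variable {n : ℕ} {φ₁ φ₂ : QuadraticForm ℂ (Fin (n + 3) → ℂ)}
  {x : nonsingularLocus (quadricIntersection φ₁ φ₂)}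
  {b : Module.Basis (Fin (n + 3)) ℂ (Fin (n + 3) → ℂ)} {l : Fin (n + 3) → ℂ} {r : Fin n → ℂ}

/-- The change of the signs of the coordinates with respect to a basis. -/
def signMap (b : Module.Basis (Fin (n + 3)) ℂ (Fin (n + 3) → ℂ)) (ε : Fin (n + 3) → ℤˣ) :
    (Fin (n + 3) → ℂ) →ₗ[ℂ] (Fin (n + 3) → ℂ) where
  toFun v := b.equivFun.symm fun i => ((ε i : ℤ) : ℂ) * b.repr v i
  map_add' v w := by
    rw [← map_add]
    congr 1
    ext i
    simp [mul_add]
  map_smul' a v := by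
    rw [RingHom.id_apply, ← map_smul]
    congr 1
    ext i
    simp
    ring

theorem repr_signMap (ε : Fin (n + 3) → ℤˣ) (v : Fin (n + 3) → ℂ) (i : Fin (n + 3)) :
    b.repr (signMap b ε v) i = ((ε i : ℤ) : ℂ) * b.repr v i :=
  congrFun (b.equivFun.apply_symm_apply _) i

theorem repr_signMap_sq (ε : Fin (n + 3) → ℤˣ) (v : Fin (n + 3) → ℂ) (i : Fin (n + 3)) :
    b.repr (signMap b ε v) i ^ 2 = b.repr v i ^ 2 := by
  rw [repr_signMap, mul_pow]
  have : (((ε i : ℤ) : ℂ)) ^ 2 = 1 := by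
    rcases Int.units_eq_one_or (ε i) with h | h <;> rw [h] <;> simp
  rw [this, one_mul]

theorem signMap_signMap (ε : Fin (n + 3) → ℤˣ) (v : Fin (n + 3) → ℂ) :
    signMap b ε (signMap b ε v) = v := by
  apply b.repr.injective
  ext i
  rw [repr_signMap, repr_signMap, ← mul_assoc]
  have : (((ε i : ℤ) : ℂ)) * ((ε i : ℤ) : ℂ) = 1 := by
    rcases Int.units_eq_one_or (ε i) with h | h <;> rw [h] <;> simp
  rw [this, one_mul]

theorem signMap_injective (ε : Fin (n + 3) → ℤˣ) : Function.Injective (signMap b ε) :=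
  fun v w h => by rw [← signMap_signMap (b := b) ε v, h, signMap_signMap]

theorem exists_signMap_eq {v v' : Fin (n + 3) → ℂ}
    (h : ∀ i, b.repr v' i ^ 2 = b.repr v i ^ 2) : ∃ ε, signMap b ε v = v' := by
  have : ∀ i, ∃ ε : ℤˣ, ((ε : ℤ) : ℂ) * b.repr v i = b.repr v' i := by
    intro i
    rcases sq_eq_sq_iff_eq_or_eq_neg.1 (h i) with h | h
    · exact ⟨1, by simp [h]⟩
    · exact ⟨-1, by simp [h]⟩
  choose ε hε using this
  refine ⟨ε, ?_⟩
  apply b.repr.injective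
  ext i
  rw [repr_signMap, hε]

theorem MoebiusRel.of_sq_eq {v v' : Fin (n + 3) → ℂ} {g : Fin 4 → ℂ} (h : MoebiusRel b l r v g)
    (hv : ∀ i, b.repr v' i ^ 2 = b.repr v i ^ 2) : MoebiusRel b l r v' g :=
  ⟨h.1, fun i => by rw [hv, h.2]⟩

theorem MoebiusRel.exists_smul {v : Fin (n + 3) → ℂ} {g : Fin 4 → ℂ}
    (h : MoebiusRel b l r v g) {a : ℂ} (ha : a ≠ 0) :
    ∃ c : ℂ, c ≠ 0 ∧ MoebiusRel b l r (c • v) (a • g) := by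
  obtain ⟨c, hc⟩ := IsAlgClosed.exists_pow_nat_eq (a ^ n) (show 0 < 2 by norm_num)
  have hc0 : c ≠ 0 := by
    rintro rfl
    rw [zero_pow (by norm_num)] at hc
    exact pow_ne_zero n ha hc.symm
  refine ⟨c, hc0, ?_, fun i => ?_⟩
  · rw [det₂_smul]
    exact mul_ne_zero (pow_ne_zero 2 ha) h.1
  · rw [moebiusPoly_smul, eval_mul, eval_C, ← hc, ← h.2, map_smul, Finsupp.smul_apply, smul_eq_mul]
    ring

theorem isPoly_repr (i : Fin (n + 3)) : IsPoly fun v => b.repr v i :=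
  IsPoly.linear (b.coord i)

theorem isPolyFamily_interp (l : Fin (n + 3) → ℂ) :
    IsPolyFamily fun u : Fin (n + 3) → ℂ => interp l fun i => b.repr u i ^ 2 := by
  simp only [interp, Lagrange.interpolate_apply]
  exact IsPolyFamily.sum _ fun i =>
    (IsPolyFamily.C (((isPoly_repr i).pow 2).mul (IsPoly.const _))).mul (IsPolyFamily.fixed _)

theorem MoebiusRel.interp_eq (hl : Function.Injective l) {v : Fin (n + 3) → ℂ} {g : Fin 4 → ℂ}
    (h : MoebiusRel b l r v g) : interp l (fun i => b.repr v i ^ 2) = moebiusPoly r g := by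
  refine eq_of_eval_nodes_eq hl (natDegree_interp_le' hl _)
    ((natDegree_moebiusPoly_le r g).trans (by omega)) fun i => ?_
  rw [← h.2, eval_interp hl]

namespace IsChart

/-- The Möbius transformation of a point of the fiber. -/
def toPGL (hc : IsChart φ₁ φ₂ x b l r) (y : moduliFiber (quadricIntersection φ₁ φ₂) x) : PGL₂ :=
  ⟨Projectivization.mk ℂ (hc.exists_moebiusRel_of_mem y.2).choose
    (ne_zero_of_det₂_ne_zero (hc.exists_moebiusRel_of_mem y.2).choose_spec.1),
    (mk_mem_PGL₂ _).2 (hc.exists_moebiusRel_of_mem y.2).choose_spec.1⟩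

theorem toPGL_mk (hc : IsChart φ₁ φ₂ x b l r) {v : Fin (n + 3) → ℂ} (hv : v ≠ 0)
    (hS : Projectivization.mk ℂ v hv ∈ moduliFiber (quadricIntersection φ₁ φ₂) x) {g : Fin 4 → ℂ}
    (h : MoebiusRel b l r v g) :
    (hc.toPGL ⟨_, hS⟩).1 = Projectivization.mk ℂ g (ne_zero_of_det₂_ne_zero h.1) := by
  have hn := hc.three_le
  obtain ⟨a, ha⟩ := Projectivization.exists_smul_eq_mk_rep ℂ v hv
  rw [Units.smul_def] at ha
  obtain ⟨ν, hν, h'⟩ := h.smul (by omega) a.ne_zero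
  rw [ha] at h'
  have hch := (hc.exists_moebiusRel_of_mem hS).choose_spec
  obtain ⟨c, hc0, hcg⟩ := hc.moebiusRel_unique h' hch fun i => rfl
  change Projectivization.mk ℂ (hc.exists_moebiusRel_of_mem hS).choose _ = _
  rw [Projectivization.mk_eq_mk_iff']
  exact ⟨c * ν, by rw [hcg, mul_smul]⟩

/-- The coefficients of the interpolating polynomial are polynomial in the vector, and from them g
is recovered locally by polynomials. -/
theorem continuous_toPGL (hc : IsChart φ₁ φ₂ x b l r) :
    @Continuous _ _ (zariskiOn (moduliFiber (quadricIntersection φ₁ φ₂) x)) (zariskiOn PGL₂)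
      hc.toPGL := by
  apply continuous_zariskiOn
  intro v hv hS
  obtain ⟨g, hg⟩ := (hc.mk_mem_moduliFiber_iff hv).1 hS
  obtain ⟨G, e, hG, he, he0, hGe⟩ := exists_recovery hc.three_le hc.injective hc.trivialStabilizer
    (isPolyFamily_interp (b := b) l) hg.1
  refine ⟨G, e, hG, he, he0 v (hg.interp_eq hc.standard.1), fun u hu hS' heu => ?_⟩
  obtain ⟨h, hh⟩ := (hc.mk_mem_moduliFiber_iff hu).1 hS'
  obtain ⟨a, ha, hGu⟩ := hGe u h hh.1 (hh.interp_eq hc.standard.1) heu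
  have h0 : G u ≠ 0 := by
    rw [hGu]
    exact smul_ne_zero ha (ne_zero_of_det₂_ne_zero hh.1)
  refine ⟨h0, ?_⟩
  rw [hc.toPGL_mk hu hS' hh, Projectivization.mk_eq_mk_iff']
  exact ⟨a, hGu.symm⟩

theorem surjective_toPGL (hc : IsChart φ₁ φ₂ x b l r) : Function.Surjective hc.toPGL := by
  rintro ⟨y, hy⟩
  induction y using Projectivization.ind with
  | h g hg =>
    obtain ⟨v, hv, hrel⟩ := hc.exists_moebiusRel_vector ((mk_mem_PGL₂ hg).1 hy)
    exact ⟨⟨_, (hc.mk_mem_moduliFiber_iff hv).2 ⟨g, hrel⟩⟩, Subtype.ext (hc.toPGL_mk hv _ hrel)⟩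

/-- The change of signs on the fiber. -/
def signFiber (hc : IsChart φ₁ φ₂ x b l r) (ε : Fin (n + 3) → ℤˣ)
    (y : moduliFiber (quadricIntersection φ₁ φ₂) x) : moduliFiber (quadricIntersection φ₁ φ₂) x :=
  ⟨Projectivization.map (signMap b ε) (signMap_injective ε) y.1, by
    obtain ⟨y, hy⟩ := y
    induction y using Projectivization.ind with
    | h v hv =>
      obtain ⟨g, hg⟩ := (hc.mk_mem_moduliFiber_iff hv).1 hy
      rw [Projectivization.map_mk]
      exact (hc.mk_mem_moduliFiber_iff _).2 ⟨g, hg.of_sq_eq (repr_signMap_sq ε v)⟩⟩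

theorem signFiber_mk (hc : IsChart φ₁ φ₂ x b l r) (ε : Fin (n + 3) → ℤˣ) {v : Fin (n + 3) → ℂ}
    (hv : v ≠ 0) (hS : Projectivization.mk ℂ v hv ∈ moduliFiber (quadricIntersection φ₁ φ₂) x) :
    (hc.signFiber ε ⟨_, hS⟩).1 = Projectivization.mk ℂ (signMap b ε v)
      ((signMap_injective ε).ne_iff' (map_zero _) |>.2 hv) :=
  rfl

theorem continuous_signFiber (hc : IsChart φ₁ φ₂ x b l r) (ε : Fin (n + 3) → ℤˣ) :
    @Continuous _ _ (zariskiOn (moduliFiber (quadricIntersection φ₁ φ₂) x))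
      (zariskiOn (moduliFiber (quadricIntersection φ₁ φ₂) x)) (hc.signFiber ε) := by
  apply continuous_zariskiOn
  intro v hv hS
  refine ⟨fun u => signMap b ε u, fun _ => 1,
    fun i => IsPoly.linear (LinearMap.proj i ∘ₗ signMap b ε), IsPoly.const 1, one_ne_zero,
    fun u hu hS' _ => ⟨(signMap_injective ε).ne_iff' (map_zero _) |>.2 hu, rfl⟩⟩

theorem signFiber_signFiber (hc : IsChart φ₁ φ₂ x b l r) (ε : Fin (n + 3) → ℤˣ)
    (y : moduliFiber (quadricIntersection φ₁ φ₂) x) : hc.signFiber ε (hc.signFiber ε y) = y := by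
  obtain ⟨y, hy⟩ := y
  apply Subtype.ext
  induction y using Projectivization.ind with
  | h v hv =>
    have hne : signMap b ε v ≠ 0 := (signMap_injective ε).ne_iff' (map_zero _) |>.2 hv
    have hmem : Projectivization.mk ℂ (signMap b ε v) hne ∈
        moduliFiber (quadricIntersection φ₁ φ₂) x := (hc.signFiber ε ⟨_, hy⟩).2
    have h : hc.signFiber ε ⟨_, hy⟩ = ⟨_, hmem⟩ := rfl
    rw [h]
    refine (hc.signFiber_mk ε hne hmem).trans ((Projectivization.mk_eq_mk_iff' ℂ _ _ _ _).2 ⟨1, ?_⟩)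
    rw [one_smul, signMap_signMap]

theorem toPGL_signFiber (hc : IsChart φ₁ φ₂ x b l r) (ε : Fin (n + 3) → ℤˣ)
    (y : moduliFiber (quadricIntersection φ₁ φ₂) x) : hc.toPGL (hc.signFiber ε y) = hc.toPGL y := by
  obtain ⟨y, hy⟩ := y
  apply Subtype.ext
  induction y using Projectivization.ind with
  | h v hv =>
    obtain ⟨g, hg⟩ := (hc.mk_mem_moduliFiber_iff hv).1 hy
    rw [hc.toPGL_mk hv hy hg]
    exact hc.toPGL_mk ((signMap_injective ε).ne_iff' (map_zero _) |>.2 hv) (hc.signFiber ε ⟨_, hy⟩).2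
      (hg.of_sq_eq (repr_signMap_sq ε v))

theorem exists_signFiber_eq (hc : IsChart φ₁ φ₂ x b l r)
    (y y' : moduliFiber (quadricIntersection φ₁ φ₂) x) (h : hc.toPGL y = hc.toPGL y') :
    ∃ ε, hc.signFiber ε y = y' := by
  obtain ⟨y, hy⟩ := y
  obtain ⟨y', hy'⟩ := y'
  induction y using Projectivization.ind with
  | h v hv =>
  induction y' using Projectivization.ind with
  | h v' hv' =>
    obtain ⟨g, hg⟩ := (hc.mk_mem_moduliFiber_iff hv).1 hy
    obtain ⟨g', hg'⟩ := (hc.mk_mem_moduliFiber_iff hv').1 hy'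
    have h1 := congrArg Subtype.val h
    rw [hc.toPGL_mk hv hy hg, hc.toPGL_mk hv' hy' hg', Projectivization.mk_eq_mk_iff'] at h1
    obtain ⟨a, ha⟩ := h1
    have ha0 : a ≠ 0 := by
      rintro rfl
      exact ne_zero_of_det₂_ne_zero hg.1 (by rw [← ha, zero_smul])
    obtain ⟨c, hc0, hrel⟩ := hg'.exists_smul ha0
    rw [ha] at hrel
    obtain ⟨ε, hε⟩ := exists_signMap_eq (b := b) (v := v) (v' := c • v') fun i =>
      mul_right_cancel₀ (nodeWeight_ne_zero hc.standard.1 i) ((hrel.2 i).trans (hg.2 i).symm)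
    refine ⟨ε, Subtype.ext ?_⟩
    rw [hc.signFiber_mk, Projectivization.mk_eq_mk_iff']
    exact ⟨c, hε.symm⟩

/-- A norm argument. If g is not in the image of Z, a function nonvanishing on all points over g and
vanishing on the cone over Z is made invariant by taking the product over all signs. It is then a
polynomial in the squares of the coordinates, and on the fiber these are polynomials in g. -/
theorem isClosedMap_toPGL (hc : IsChart φ₁ φ₂ x b l r) :
    @IsClosedMap _ _ (zariskiOn (moduliFiber (quadricIntersection φ₁ φ₂) x)) (zariskiOn PGL₂)
      hc.toPGL := by
  let _ := zariskiOn (moduliFiber (quadricIntersection φ₁ φ₂) x)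
  let _ := zariskiOn PGL₂
  intro Z hZ
  rw [← isOpen_compl_iff, isOpen_zariskiOn_iff]
  intro g hg hS hgZ
  obtain ⟨v, hv, hrel⟩ := hc.exists_moebiusRel_vector ((mk_mem_PGL₂ hg).1 hS)
  have hZo := isOpen_zariskiOn_iff.1 (isOpen_compl_iff.2 hZ)
  have hne : ∀ ε, signMap b ε v ≠ 0 := fun ε => (signMap_injective ε).ne_iff' (map_zero _) |>.2 hv
  have hrelε : ∀ ε, MoebiusRel b l r (signMap b ε v) g := fun ε =>
    hrel.of_sq_eq (repr_signMap_sq ε v)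
  have hmem := fun ε => (hc.mk_mem_moduliFiber_iff (hne ε)).2 ⟨g, hrelε ε⟩
  have hex : ∀ ε : Fin (n + 3) → ℤˣ, ∃ f : (Fin (n + 3) → ℂ) → ℂ, IsPoly f ∧
      f (signMap b ε v) ≠ 0 ∧ ∀ (u : Fin (n + 3) → ℂ) (hu : u ≠ 0)
        (hS' : Projectivization.mk ℂ u hu ∈ moduliFiber (quadricIntersection φ₁ φ₂) x),
        f u ≠ 0 → (⟨_, hS'⟩ : moduliFiber (quadricIntersection φ₁ φ₂) x) ∈ Zᶜ := by
    intro ε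
    refine hZo _ (hne ε) (hmem ε) fun hmemZ => hgZ ⟨_, hmemZ, ?_⟩
    exact Subtype.ext (hc.toPGL_mk (hne ε) (hmem ε) (hrelε ε))
  choose f hf hfv hfZ using hex
  -- A combination that is nonzero at every sign change of v; wherever it is nonzero, some f δ is
  -- nonzero, so the point is outside Z.
  obtain ⟨t, ht⟩ := exists_combination_ne_zero (fun δ ε => f δ (signMap b ε v)) hfv
  let F : (Fin (n + 3) → ℂ) → ℂ := fun z =>
    ∏ ε : Fin (n + 3) → ℤˣ, ∑ δ, t δ * f δ (b.equivFun.symm fun i => ((ε i : ℤ) : ℂ) * z i)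
  have hF : IsPoly F := by
    refine IsPoly.prod _ fun ε => IsPoly.sum _ fun δ => (IsPoly.const _).mul ((hf δ).comp fun i => ?_)
    refine IsPoly.comp (IsPoly.linear (LinearMap.proj i ∘ₗ
      (b.equivFun.symm : (Fin (n + 3) → ℂ) →ₗ[ℂ] (Fin (n + 3) → ℂ)))) fun j => ?_
    exact (IsPoly.const _).mul (IsPoly.coord j)
  have hFinv : ∀ (ε : Fin (n + 3) → ℤˣ) z, F (fun i => ((ε i : ℤ) : ℂ) * z i) = F z := by
    intro ε z
    refine Fintype.prod_equiv (Equiv.mulRight ε) _ _ fun ε' => ?_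
    refine Finset.sum_congr rfl fun δ _ => ?_
    congr 3
    ext i
    simp
    ring
  obtain ⟨p, hp⟩ := hF
  obtain ⟨q, hq⟩ := exists_sum_signs p
  -- As F is invariant under signs, averaging over signs only multiplies it by their number, and so
  -- exhibits it as a polynomial in squares.
  have hqF : ∀ z : Fin (n + 3) → ℂ, MvPolynomial.eval (fun i => z i ^ 2) q =
      (Fintype.card (Fin (n + 3) → ℤˣ) : ℂ) * F z := by
    intro z
    rw [← hq]
    simp only [← hp, hFinv, Finset.sum_const, Finset.card_univ, nsmul_eq_mul]
  have hcard : (Fintype.card (Fin (n + 3) → ℤˣ) : ℂ) ≠ 0 := Nat.cast_ne_zero.2 Fintype.card_ne_zero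
  have hsq : ∀ {u h}, MoebiusRel b l r u h → (fun i => (moebiusPoly r h).eval (l i) / nodeWeight l i) =
      fun i => b.repr u i ^ 2 := by
    intro u h hu
    ext i
    rw [← hu.2, mul_div_cancel_right₀ _ (nodeWeight_ne_zero hc.standard.1 i)]
  refine ⟨fun h => MvPolynomial.eval (fun i => (moebiusPoly r h).eval (l i) / nodeWeight l i) q,
    ?_, ?_, ?_⟩
  · apply IsPoly.eval
    intro i
    simp only [eval_moebiusPoly, div_eq_mul_inv]
    refine (IsPoly.prod _ fun k => ?_).mul (IsPoly.const _)
    exact (((IsPoly.coord 0).mul (IsPoly.const _)).add (IsPoly.coord 1)).sub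
      ((IsPoly.const _).mul (((IsPoly.coord 2).mul (IsPoly.const _)).add (IsPoly.coord 3)))
  · dsimp only
    rw [hsq hrel, hqF]
    exact mul_ne_zero hcard (Finset.prod_ne_zero_iff.2 fun ε _ => ht ε)
  · rintro h hh hS' hne' ⟨⟨y, hy⟩, hyZ, hyh⟩
    induction y using Projectivization.ind with
    | h u hu =>
      obtain ⟨h', hh'⟩ := (hc.mk_mem_moduliFiber_iff hu).1 hy
      have h1 := congrArg Subtype.val hyh
      rw [hc.toPGL_mk hu hy hh', Projectivization.mk_eq_mk_iff'] at h1
      obtain ⟨a, ha⟩ := h1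
      have ha0 : a ≠ 0 := by
        rintro rfl
        rw [zero_smul] at ha
        exact ne_zero_of_det₂_ne_zero hh'.1 ha.symm
      obtain ⟨c, hc0, hrel'⟩ := hh'.exists_smul (inv_ne_zero ha0)
      rw [← ha, smul_smul, inv_mul_cancel₀ ha0, one_smul] at hrel'
      dsimp only at hne'
      rw [hsq hrel', hqF] at hne'
      have h2 := Finset.prod_ne_zero_iff.1 (right_ne_zero_of_mul hne') 1 (Finset.mem_univ _)
      obtain ⟨δ, -, hδ⟩ := Finset.exists_ne_zero_of_sum_ne_zero h2
      have h3 : (b.equivFun.symm fun i => (((1 : Fin (n + 3) → ℤˣ) i : ℤ) : ℂ) *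
          b.repr (c • u) i) = c • u := by
        rw [LinearEquiv.symm_apply_eq]
        ext i
        simp
      rw [h3] at hδ
      have hmk : Projectivization.mk ℂ (c • u) (smul_ne_zero hc0 hu) = Projectivization.mk ℂ u hu :=
        (Projectivization.mk_eq_mk_iff' ℂ _ _ _ _).2 ⟨c, rfl⟩
      refine hfZ δ (c • u) (smul_ne_zero hc0 hu) (hmk ▸ hy) (right_ne_zero_of_mul hδ) ?_
      convert hyZ

theorem topologicalKrullDim_eq_three (hc : IsChart φ₁ φ₂ x b l r) :
    IsOfPureDimension (moduliFiber (quadricIntersection φ₁ φ₂) x) 3 := by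
  let _ := zariskiOn (moduliFiber (quadricIntersection φ₁ φ₂) x)
  let _ := zariskiOn PGL₂
  have hirr : IrreducibleSpace PGL₂ := by
    have := isIrreducible_univ_PGL₂
    exact { isPreirreducible_univ := this.2, toNonempty := ⟨this.1.choose⟩ }
  intro C hC
  rw [topologicalKrullDim_component_eq hc.continuous_toPGL hc.isClosedMap_toPGL hc.surjective_toPGL
    hc.continuous_signFiber hc.signFiber_signFiber hc.toPGL_signFiber hc.exists_signFiber_eq C hC]
  exact topologicalKrullDim_PGL₂

end IsChart

theorem localDimension_eq_of_isOfPureDimension {σ : Type*} {S : Set (ℙ ℂ (σ → ℂ))} {d : ℕ}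
    (h : IsOfPureDimension S d) (x : S) : localDimension S x = d := by
  let _ := zariskiOn S
  have hx : Nonempty {C : Set S // C ∈ irreducibleComponents S ∧ x ∈ C} :=
    ⟨⟨_, irreducibleComponent_mem_irreducibleComponents x, mem_irreducibleComponent⟩⟩
  have : ∀ C : {C : Set S // C ∈ irreducibleComponents S ∧ x ∈ C}, topologicalKrullDim C.1 = d :=
    fun C => h C.1 C.2.1
  change (⨆ C : {C : Set S // C ∈ irreducibleComponents S ∧ x ∈ C}, topologicalKrullDim C.1) = d
  simp only [this]
  exact ciSup_const

end Dimension

end QuadricPencil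

namespace QuadricPencil

open Polynomial

/-! ### Curves with moving roots -/

section Curves

variable {n : ℕ} {φ₁ φ₂ : QuadraticForm ℂ (Fin (n + 3) → ℂ)}
  {x : nonsingularLocus (quadricIntersection φ₁ φ₂)}
  {b : Module.Basis (Fin (n + 3)) ℂ (Fin (n + 3) → ℂ)} {l : Fin (n + 3) → ℂ} {r : Fin n → ℂ}

theorem eventually_one_add_mul_mem_slitPlane (a : ℂ) :
    ∀ᶠ t in nhds (0 : ℂ), 1 + t * a ∈ Complex.slitPlane := by
  have hc : ContinuousAt (fun t : ℂ => 1 + t * a) 0 := by fun_prop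
  exact hc.eventually (Complex.isOpen_slitPlane.mem_nhds (by simp))

/-- The square root of the product is taken as the exponential of half the sum of logarithms, which
is analytic because all factors are close to 1. -/
theorem exists_sqrt_curve (b : Module.Basis (Fin (n + 3)) ℂ (Fin (n + 3) → ℂ))
    (v : Fin (n + 3) → ℂ) (a : Fin (n + 3) → Fin n → ℂ) :
    ∃ c : ℂ → Fin (n + 3) → ℂ, AnalyticAt ℂ c 0 ∧ c 0 = v ∧
      HasDerivAt c (b.equivFun.symm fun i => b.repr v i * ((∑ k, a i k) / 2)) 0 ∧
      ∀ᶠ t in nhds (0 : ℂ), ∀ i, b.repr (c t) i ^ 2 = b.repr v i ^ 2 * ∏ k, (1 + t * a i k) := by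
  let e : ℂ → Fin (n + 3) → ℂ := fun t i =>
    b.repr v i * Complex.exp ((∑ k, Complex.log (1 + t * a i k)) / 2)
  let B : (Fin (n + 3) → ℂ) →L[ℂ] (Fin (n + 3) → ℂ) :=
    LinearMap.toContinuousLinearMap (b.equivFun.symm : (Fin (n + 3) → ℂ) →ₗ[ℂ] (Fin (n + 3) → ℂ))
  have he : AnalyticAt ℂ e 0 := by
    rw [analyticAt_pi_iff]
    intro i
    refine analyticAt_const.mul (AnalyticAt.cexp ?_)
    refine AnalyticAt.div_const ?_
    refine Finset.analyticAt_fun_sum _ fun k _ => ?_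
    refine AnalyticAt.clog (analyticAt_const.add (analyticAt_id.mul analyticAt_const)) ?_
    simp
  have he0 : e 0 = b.repr v := by
    ext i
    simp [e]
  have hed : HasDerivAt e (fun i => b.repr v i * ((∑ k, a i k) / 2)) 0 := by
    rw [hasDerivAt_pi]
    intro i
    have h1 : ∀ k, HasDerivAt (fun t : ℂ => Complex.log (1 + t * a i k)) (a i k) 0 := by
      intro k
      have h2 : HasDerivAt (fun t : ℂ => 1 + t * a i k) (a i k) 0 := by
        simpa using ((hasDerivAt_id (0 : ℂ)).mul_const (a i k)).const_add 1
      have h3 := h2.clog (by simp)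
      simpa using h3
    have h4 := ((HasDerivAt.fun_sum (u := Finset.univ) fun k _ => h1 k).div_const 2).cexp.const_mul
      (b.repr v i)
    simpa using h4
  refine ⟨fun t => B (e t), ?_, ?_, ?_, ?_⟩
  · exact (B.analyticAt _).comp he
  · change b.equivFun.symm (e 0) = v
    rw [he0, LinearEquiv.symm_apply_eq]
    rfl
  · exact B.hasFDerivAt.comp_hasDerivAt 0 hed
  · have h : ∀ᶠ t in nhds (0 : ℂ), ∀ i k, 1 + t * a i k ∈ Complex.slitPlane :=
      Filter.eventually_all.2 fun i => Filter.eventually_all.2 fun k =>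
        eventually_one_add_mul_mem_slitPlane _
    filter_upwards [h] with t ht i
    have : b.repr (B (e t)) i = e t i := congrFun (b.equivFun.apply_symm_apply (e t)) i
    rw [this]
    simp only [e]
    rw [mul_pow, ← Complex.exp_nat_mul]
    have h5 : ((2 : ℕ) : ℂ) * ((∑ k, Complex.log (1 + t * a i k)) / 2) =
        ∑ k, Complex.log (1 + t * a i k) := by
      push_cast
      ring
    rw [h5, Complex.exp_sum]
    congr 1
    exact Finset.prod_congr rfl fun k _ => Complex.exp_log (Complex.slitPlane_ne_zero (ht i k))

/-- The tangent vector for which the roots `r_k` move with velocities `δ_k`. -/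
def rootMotion (b : Module.Basis (Fin (n + 3)) ℂ (Fin (n + 3) → ℂ)) (l : Fin (n + 3) → ℂ)
    (r : Fin n → ℂ) (v : Fin (n + 3) → ℂ) : (Fin n → ℂ) →ₗ[ℂ] (Fin (n + 3) → ℂ) where
  -- Half the logarithmic derivative at t = 0 of ∏_k (l_i - r_k - t δ_k), since z_i² is proportional
  -- to this product.
  toFun δ := b.equivFun.symm fun i => b.repr v i * ((∑ k, -δ k / (l i - r k)) / 2)
  map_add' δ δ' := by
    rw [← map_add]
    congr 1
    ext i
    rw [Pi.add_apply, ← mul_add, ← add_div, ← Finset.sum_add_distrib]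
    congr 3
    ext k
    rw [Pi.add_apply]
    ring
  map_smul' a δ := by
    rw [RingHom.id_apply, ← map_smul]
    congr 1
    ext i
    have : ∑ k, -(a • δ) k / (l i - r k) = a * ∑ k, -δ k / (l i - r k) := by
      rw [Finset.mul_sum]
      refine Finset.sum_congr rfl fun k _ => ?_
      rw [Pi.smul_apply, smul_eq_mul]
      ring
    rw [this, Pi.smul_apply, smul_eq_mul]
    ring

theorem repr_rootMotion (v : Fin (n + 3) → ℂ) (δ : Fin n → ℂ) (i : Fin (n + 3)) :
    b.repr (rootMotion b l r v δ) i = b.repr v i * ((∑ k, -δ k / (l i - r k)) / 2) :=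
  congrFun (b.equivFun.apply_symm_apply _) i

/-- The roots of `u` are `w`. -/
def HasRootVector (b : Module.Basis (Fin (n + 3)) ℂ (Fin (n + 3) → ℂ)) (l : Fin (n + 3) → ℂ)
    (w : Fin n → ℂ) (u : Fin (n + 3) → ℂ) : Prop :=
  ∃ κ : ℂ, κ ≠ 0 ∧ ∀ i, b.repr u i ^ 2 * nodeWeight l i = κ * ∏ k, (l i - w k)

namespace IsChart

theorem hasRootVector (hc : IsChart φ₁ φ₂ x b l r) : HasRootVector b l r x.1.rep := by
  obtain ⟨μ, hμ, hrel⟩ := hc.exists_moebiusRel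
  refine ⟨μ ^ n, pow_ne_zero n hμ, fun i => ?_⟩
  rw [hrel.2, eval_moebiusPoly]
  have : μ ^ n = ∏ _k : Fin n, μ := by simp
  rw [this, ← Finset.prod_mul_distrib]
  refine Finset.prod_congr rfl fun k _ => ?_
  simp
  ring

theorem sub_ne_zero (hc : IsChart φ₁ φ₂ x b l r) (i : Fin (n + 3)) (k : Fin n) : l i - r k ≠ 0 :=
  _root_.sub_ne_zero.2 (hc.ne_root i k)

theorem repr_rep_ne_zero (hc : IsChart φ₁ φ₂ x b l r) (i : Fin (n + 3)) : b.repr x.1.rep i ≠ 0 := by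
  obtain ⟨κ, hκ, h⟩ := hc.hasRootVector
  intro h0
  have := h i
  rw [h0, zero_pow (by norm_num), zero_mul] at this
  exact mul_ne_zero hκ (Finset.prod_ne_zero_iff.2 fun k _ => hc.sub_ne_zero i k) this.symm

theorem exists_rootMotion_curve (hc : IsChart φ₁ φ₂ x b l r) (δ : Fin n → ℂ) :
    ∃ c : ℂ → Fin (n + 3) → ℂ, AnalyticAt ℂ c 0 ∧ c 0 = x.1.rep ∧
      HasDerivAt c (rootMotion b l r x.1.rep δ) 0 ∧
      ∀ᶠ t in nhds (0 : ℂ), HasRootVector b l (fun k => r k + t * δ k) (c t) := by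
  obtain ⟨c, hca, hc0, hcd, hcs⟩ := exists_sqrt_curve b x.1.rep fun i k => -δ k / (l i - r k)
  obtain ⟨κ, hκ, h⟩ := hc.hasRootVector
  refine ⟨c, hca, hc0, hcd, hcs.mono fun t ht => ⟨κ, hκ, fun i => ?_⟩⟩
  rw [ht, mul_right_comm, h, mul_assoc, ← Finset.prod_mul_distrib]
  congr 1
  refine Finset.prod_congr rfl fun k _ => ?_
  have := hc.sub_ne_zero i k
  field_simp
  ring

/-- Follows the polynomials of the matrices μ (1 + t m). Their roots move by the infinitesimal
Möbius motion of -m, while the change of the leading coefficient contributes the radial term s. -/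
theorem exists_moebius_curve (hc : IsChart φ₁ φ₂ x b l r) (m : Fin 4 → ℂ) :
    ∃ (c : ℂ → Fin (n + 3) → ℂ) (s : ℂ), AnalyticAt ℂ c 0 ∧ c 0 = x.1.rep ∧
      HasDerivAt c (rootMotion b l r x.1.rep
        (fun k => -(m 1 + (m 0 - m 3) * r k - m 2 * r k ^ 2)) + s • x.1.rep) 0 ∧
      ∀ᶠ t in nhds (0 : ℂ), ∃ g, MoebiusRel b l r (c t) g := by
  obtain ⟨c, hca, hc0, hcd, hcs⟩ := exists_sqrt_curve b x.1.rep fun i k =>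
    ((m 0 * l i + m 1) - r k * (m 2 * l i + m 3)) / (l i - r k)
  obtain ⟨μ, hμ, hrel⟩ := hc.exists_moebiusRel
  refine ⟨c, (∑ k, (m 0 - r k * m 2)) / 2, hca, hc0, ?_, ?_⟩
  · convert hcd using 1
    apply b.repr.injective
    ext i
    have h1 : b.repr (b.equivFun.symm fun i => b.repr x.1.rep i *
        ((∑ k, ((m 0 * l i + m 1) - r k * (m 2 * l i + m 3)) / (l i - r k)) / 2)) i =
        b.repr x.1.rep i *
          ((∑ k, ((m 0 * l i + m 1) - r k * (m 2 * l i + m 3)) / (l i - r k)) / 2) :=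
      congrFun (b.equivFun.apply_symm_apply _) i
    rw [h1, map_add, Finsupp.add_apply, repr_rootMotion, map_smul, Finsupp.smul_apply, smul_eq_mul]
    have h2 : ∑ k, ((m 0 * l i + m 1) - r k * (m 2 * l i + m 3)) / (l i - r k) =
        ∑ k, -(-(m 1 + (m 0 - m 3) * r k - m 2 * r k ^ 2)) / (l i - r k) +
          ∑ k, (m 0 - r k * m 2) := by
      rw [← Finset.sum_add_distrib]
      refine Finset.sum_congr rfl fun k _ => ?_
      have := hc.sub_ne_zero i k
      field_simp
      ring
    rw [h2]
    ring
  · have hdet : ∀ᶠ t in nhds (0 : ℂ),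
        det₂ (μ • ![1 + t * m 0, t * m 1, t * m 2, 1 + t * m 3]) ≠ 0 := by
      have hcont : ContinuousAt (fun t : ℂ =>
          det₂ (μ • ![1 + t * m 0, t * m 1, t * m 2, 1 + t * m 3])) 0 := by
        simp only [det₂]
        fun_prop
      refine hcont.eventually_ne ?_
      simp [det₂, hμ]
    filter_upwards [hcs, hdet] with t ht hdt
    refine ⟨_, hdt, fun i => ?_⟩
    rw [ht, mul_right_comm, hrel.2, eval_moebiusPoly, eval_moebiusPoly, ← Finset.prod_mul_distrib]
    refine Finset.prod_congr rfl fun k _ => ?_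
    have := hc.sub_ne_zero i k
    simp only [Pi.smul_apply, smul_eq_mul, Matrix.cons_val]
    field_simp
    ring

/-- Clearing denominators gives a polynomial of degree at most n + 2 that vanishes at the n + 3
nodes, hence is zero; its value at r_k is δ_k times a nonzero factor. -/
theorem rootMotion_eq_smul (hc : IsChart φ₁ φ₂ x b l r) {δ : Fin n → ℂ} {s : ℂ}
    (h : rootMotion b l r x.1.rep δ = s • x.1.rep) : δ = 0 := by
  have hi : ∀ i, (∑ k, -δ k / (l i - r k)) = 2 * s := by
    intro i
    have h1 := congrArg (fun w => b.repr w i) h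
    simp only [repr_rootMotion, map_smul, Finsupp.smul_apply, smul_eq_mul] at h1
    apply mul_left_cancel₀ (hc.repr_rep_ne_zero i)
    linear_combination 2 * h1
  let P : ℂ[X] := ∑ k, C (-δ k) * ∏ m ∈ Finset.univ.erase k, (X - C (r m)) -
    C (2 * s) * ∏ m, (X - C (r m))
  have hdeg : ∀ S : Finset (Fin n), (∏ m ∈ S, (X - C (r m))).natDegree ≤ n + 2 := by
    intro S
    rw [natDegree_prod_of_monic _ _ fun m _ => monic_X_sub_C _]
    have := S.card_le_univ
    simp at this ⊢
    omega
  have hP : P = 0 := by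
    refine eq_of_eval_nodes_eq hc.standard.1 ?_ (by simp) fun i => ?_
    · refine (natDegree_sub_le _ _).trans (max_le ?_ ((natDegree_C_mul_le _ _).trans (hdeg _)))
      exact natDegree_sum_le_of_forall_le _ _ fun k _ => (natDegree_C_mul_le _ _).trans (hdeg _)
    · simp only [P, eval_sub, eval_mul, eval_C, eval_finsetSum, eval_prod, eval_X, eval_zero]
      rw [← hi i, Finset.sum_mul, ← Finset.sum_sub_distrib]
      refine Finset.sum_eq_zero fun k _ => ?_
      rw [← Finset.mul_prod_erase _ (fun m => l i - r m) (Finset.mem_univ k)]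
      have := hc.sub_ne_zero i k
      field_simp
      ring
  ext k
  have h1 := congrArg (fun p => p.eval (r k)) hP
  simp only [P, eval_sub, eval_mul, eval_C, eval_finsetSum, eval_prod, eval_X, eval_zero] at h1
  rw [Finset.prod_eq_zero (Finset.mem_univ k) (sub_self _), mul_zero, sub_zero,
    Finset.sum_eq_single k] at h1
  · have h2 : ∏ m ∈ Finset.univ.erase k, (r k - r m) ≠ 0 :=
      Finset.prod_ne_zero_iff.2 fun m hm =>
        _root_.sub_ne_zero.2 (hc.injective.ne (Finset.ne_of_mem_erase hm).symm)
    exact neg_eq_zero.1 ((mul_eq_zero.1 h1).resolve_right h2)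
  · intro m _ hmk
    rw [Finset.prod_eq_zero (Finset.mem_erase.2 ⟨hmk.symm, Finset.mem_univ k⟩) (sub_self _),
      mul_zero]
  · simp

theorem mem_cone_of_hasRootVector (hb : IsStandardBasis φ₁ φ₂ b l) {w : Fin n → ℂ}
    {u : Fin (n + 3) → ℂ} (hu : u ≠ 0) (h : HasRootVector b l w u) :
    u ∈ cone (quadricIntersection φ₁ φ₂) := by
  obtain ⟨κ, hκ, h⟩ := h
  refine mem_cone_of_poly hb hu (P := C κ * ∏ k, (C 1 * X + C (-w k))) ?_ fun i => ?_
  · exact (natDegree_C_mul_le _ _).trans (natDegree_prod_linear_le _ _)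
  · rw [h, eval_mul, eval_C, eval_prod]
    congr 1
    refine Finset.prod_congr rfl fun k _ => ?_
    simp
    ring

theorem eventually_ne_zero {c : ℂ → Fin (n + 3) → ℂ} (hca : ContinuousAt c 0) (hc0 : c 0 = x.1.rep) :
    ∀ᶠ t in nhds (0 : ℂ), c t ≠ 0 :=
  hca.eventually_ne (by rw [hc0]; exact x.1.rep_nonzero)

theorem rootMotion_mem (hc : IsChart φ₁ φ₂ x b l r) (δ : Fin n → ℂ) :
    rootMotion b l r x.1.rep δ ∈ affineTangent (quadricIntersection φ₁ φ₂) x.1.rep := by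
  obtain ⟨c, hca, hc0, hcd, hcr⟩ := hc.exists_rootMotion_curve δ
  rw [← hc0]
  rw [← hc0] at hcd
  refine mem_affineTangent_of_curve hcd ?_
  filter_upwards [hcr, eventually_ne_zero hca.continuousAt hc0] with t ht ht0
  exact mem_cone_of_hasRootVector hc.standard ht0 ht

/-- A dimension count: root motions and the radial direction are independent and contribute n + 1
dimensions, as many as the affine tangent space has. -/
theorem exists_rootMotion_eq (hc : IsChart φ₁ φ₂ x b l r) {w : Fin (n + 3) → ℂ}
    (hw : w ∈ affineTangent (quadricIntersection φ₁ φ₂) x.1.rep) :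
    ∃ (δ : Fin n → ℂ) (s : ℂ), w = rootMotion b l r x.1.rep δ + s • x.1.rep := by
  have hX := hc.nonsingular
  have hself := self_mem_affineTangent hX (rep_mem_cone x.2.1)
  let f : (Fin n → ℂ) × ℂ →ₗ[ℂ] affineTangent (quadricIntersection φ₁ φ₂) x.1.rep :=
    LinearMap.coprod
      (LinearMap.codRestrict _ (rootMotion b l r x.1.rep) hc.rootMotion_mem)
      (LinearMap.toSpanSingleton ℂ _ ⟨x.1.rep, hself⟩)
  have hf : ∀ p, (f p : Fin (n + 3) → ℂ) = rootMotion b l r x.1.rep p.1 + p.2 • x.1.rep := by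
    intro p
    simp [f]
  have hinj : Function.Injective f := by
    rw [← LinearMap.ker_eq_bot, LinearMap.ker_eq_bot']
    rintro ⟨δ, s⟩ h
    have h1 := hf (δ, s)
    rw [h] at h1
    have h2 : rootMotion b l r x.1.rep δ = (-s) • x.1.rep := by
      rw [neg_smul]
      exact eq_neg_of_add_eq_zero_left h1.symm
    have hδ := hc.rootMotion_eq_smul h2
    rw [hδ, map_zero, eq_comm, smul_eq_zero, neg_eq_zero] at h2
    rw [hδ, h2.resolve_right x.1.rep_nonzero]
    rfl
  have hsurj : Function.Surjective f := by
    rw [← LinearMap.injective_iff_surjective_of_finrank_eq_finrank]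
    · exact hinj
    · rw [finrank_affineTangent hX (rep_mem_cone x.2.1)]
      simp
  obtain ⟨⟨δ, s⟩, h⟩ := hsurj ⟨w, hw⟩
  exact ⟨δ, s, by rw [← hf (δ, s), h]⟩

end IsChart

end Curves

/-! ### Derivatives of cross ratios -/

section CrossRatio

variable {n : ℕ}

theorem hasDerivAt_crossRatio {i j k : Fin n} {r δ : Fin n → ℂ} (hr : Function.Injective r)
    (hij : i ≠ j) (m : Fin n) (hm : m ≠ k) :
    HasDerivAt (fun t : ℂ => crossRatio i j k (fun p => r p + t * δ p) m)
      ((((δ m - δ i) * (r j - r k) + (r m - r i) * (δ j - δ k)) * ((r m - r k) * (r j - r i)) -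
        (r m - r i) * (r j - r k) * ((δ m - δ k) * (r j - r i) + (r m - r k) * (δ j - δ i))) /
        ((r m - r k) * (r j - r i)) ^ 2) 0 := by
  have h : ∀ p q, HasDerivAt (fun t : ℂ => (r p + t * δ p) - (r q + t * δ q)) (δ p - δ q) 0 := by
    intro p q
    have h1 : ∀ p, HasDerivAt (fun t : ℂ => r p + t * δ p) (δ p) 0 := fun p => by
      simpa using ((hasDerivAt_id (0 : ℂ)).mul_const (δ p)).const_add (r p)
    exact (h1 p).fun_sub (h1 q)
  have hd := ((h m i).fun_mul (h j k)).fun_div ((h m k).fun_mul (h j i)) (by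
    simpa using ⟨sub_ne_zero.2 (hr.ne hm), sub_ne_zero.2 (hr.ne hij.symm)⟩)
  simpa [crossRatio] using hd

theorem exists_quadratic_interpolation {r δ : Fin n → ℂ} (hr : Function.Injective r) {i j k : Fin n}
    (hij : i ≠ j) (hik : i ≠ k) (hjk : j ≠ k) : ∃ A B C : ℂ, ∀ p, (p = i ∨ p = j ∨ p = k) →
      δ p = A + B * r p + C * r p ^ 2 := by
  have h1 := sub_ne_zero.2 (hr.ne hij)
  have h2 := sub_ne_zero.2 (hr.ne hik)
  have h3 := sub_ne_zero.2 (hr.ne hjk)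
  have h1' := sub_ne_zero.2 (hr.ne hij.symm)
  have h2' := sub_ne_zero.2 (hr.ne hik.symm)
  have h3' := sub_ne_zero.2 (hr.ne hjk.symm)
  let a := δ i / ((r i - r j) * (r i - r k))
  let b := δ j / ((r j - r i) * (r j - r k))
  let c := δ k / ((r k - r i) * (r k - r j))
  have ha : a * ((r i - r j) * (r i - r k)) = δ i := div_mul_cancel₀ _ (mul_ne_zero h1 h2)
  have hb : b * ((r j - r i) * (r j - r k)) = δ j := div_mul_cancel₀ _ (mul_ne_zero h1' h3)
  have hc : c * ((r k - r i) * (r k - r j)) = δ k := div_mul_cancel₀ _ (mul_ne_zero h2' h3')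
  refine ⟨a * (r j * r k) + b * (r i * r k) + c * (r i * r j),
    -(a * (r j + r k) + b * (r i + r k) + c * (r i + r j)), a + b + c, ?_⟩
  rintro p (rfl | rfl | rfl)
  · rw [← ha]; ring
  · rw [← hb]; ring
  · rw [← hc]; ring

/-- If the first order variation of all cross ratios vanishes, the variation of the points is
infinitesimally projective. -/
theorem exists_quadratic_of_variation_eq_zero {r δ : Fin n → ℂ} (hr : Function.Injective r)
    {i j k : Fin n} (hij : i ≠ j) (hik : i ≠ k) (hjk : j ≠ k)
    (h : ∀ m, m ≠ k → ((δ m - δ i) * (r j - r k) + (r m - r i) * (δ j - δ k)) *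
        ((r m - r k) * (r j - r i)) -
      (r m - r i) * (r j - r k) * ((δ m - δ k) * (r j - r i) + (r m - r k) * (δ j - δ i)) = 0) :
    ∃ A B C : ℂ, ∀ m, δ m = A + B * r m + C * r m ^ 2 := by
  obtain ⟨A, B, C, hABC⟩ := exists_quadratic_interpolation (δ := δ) hr hij hik hjk
  refine ⟨A, B, C, fun m => ?_⟩
  by_cases hm : m = k
  · exact hABC m (by simp [hm])
  have hi := hABC i (by simp)
  have hj := hABC j (by simp)
  have hk := hABC k (by simp)
  have hmm := h m hm
  have h1 := sub_ne_zero.2 (hr.ne hij.symm)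
  have h2 := sub_ne_zero.2 (hr.ne hik)
  have h3 := sub_ne_zero.2 (hr.ne hjk)
  rw [hi, hj, hk] at hmm
  -- The quadratic interpolates δ at i, j, k. The variation of the m-th cross ratio is affine linear
  -- in δ m with this nonzero coefficient and vanishes at the value of the quadratic, so δ m is that
  -- value.
  apply mul_left_cancel₀ (mul_ne_zero (mul_ne_zero h1 h2) h3)
  linear_combination hmm

end CrossRatio

end QuadricPencil

namespace QuadricPencil

open QuadraticMap Polynomial

/-! ### Regular functions on the moduli space -/

section ModuliFunction

variable {n : ℕ}

theorem HasRoots.injective {W : Type*} [AddCommGroup W] [Module ℂ W] {q₁ q₂ : QuadraticForm ℂ W}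
    {r : Fin n → ℂ} (h : HasRoots q₁ q₂ (fun _ => 1) (fun k => -r k)) : Function.Injective r := by
  intro k m hkm
  by_contra hne
  exact h.pairwise k m hne (by simp [hkm])

theorem HasRoots.exists_perm_sends {W : Type*} [AddCommGroup W] [Module ℂ W]
    {q₁ q₂ : QuadraticForm ℂ W} {r r' : Fin n → ℂ} {g : Fin 4 → ℂ} (hn : 2 ≤ n) (hg : det₂ g ≠ 0)
    (h : HasRoots q₁ q₂ (fun _ => 1) (fun k => -r k))
    (h' : HasRoots (g 0 • q₁ + g 1 • q₂) (g 2 • q₁ + g 3 • q₂) (fun _ => 1) (fun k => -r' k)) :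
    ∃ τ : Equiv.Perm (Fin n), ∀ k, Sends g (r (τ k)) (r' k) := by
  have hex : ∀ k, ∃ m, Sends g (r m) (r' k) := by
    intro k
    have hd := h'.isDegenerate_root hn k
    have e : (1 : ℂ) • (g 0 • q₁ + g 1 • q₂) + -r' k • (g 2 • q₁ + g 3 • q₂) =
        (g 0 - r' k * g 2) • q₁ + (g 1 - r' k * g 3) • q₂ := by module
    rw [e, h.degenerate_iff] at hd
    · obtain ⟨m, hm⟩ := hd
      refine ⟨m, ?_⟩
      rw [Sends]
      linear_combination -hm
    · intro h0
      obtain ⟨h1, h2⟩ := Prod.mk_eq_zero.1 h0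
      apply hg
      rw [det₂]
      linear_combination g 3 * h1 - g 2 * h2
  choose τ hτ using hex
  have hτi : Function.Injective τ := fun k m hkm =>
    h'.injective ((hτ k).functional hg (hkm ▸ hτ m))
  exact ⟨Equiv.ofBijective τ (Finite.injective_iff_bijective.1 hτi), hτ⟩

/-- The symmetrization of a function of the cross ratios. -/
def crossRatioSum (i j k : Fin n) (h : MvPolynomial (Fin n) ℂ) (r : Fin n → ℂ) : ℂ :=
  ∑ τ : Equiv.Perm (Fin n), MvPolynomial.eval (crossRatio i j k (r ∘ τ)) h

/-- The function on the moduli space given by the symmetrization of a function of the cross ratios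
of the degenerate elements. -/
def moduliFunction (i j k : Fin n) (h : MvPolynomial (Fin n) ℂ) (m : Moduli n) : ℂ :=
  Classical.epsilon fun y => ∃ (Φ : NonsingularPencil n) (q₁ q₂ : QuadraticForm ℂ (Fin n → ℂ))
    (r : Fin n → ℂ), Quotient.mk (projectiveEquivalence n) Φ = m ∧ Φ.1 = Submodule.span ℂ {q₁, q₂} ∧
      HasRoots q₁ q₂ (fun _ => 1) (fun k => -r k) ∧ y = crossRatioSum i j k h r

/-- The value is independent of the choices: bases of equivalent pencils differ by a Möbius
transformation, invisible to cross ratios, and by the ordering of the roots, removed by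
symmetrization. -/
theorem moduliFunction_mk (hn : 2 ≤ n) (i j k : Fin n) (h : MvPolynomial (Fin n) ℂ)
    (Φ : NonsingularPencil n) {q₁ q₂ : QuadraticForm ℂ (Fin n → ℂ)} {r : Fin n → ℂ}
    (hΦ : Φ.1 = Submodule.span ℂ {q₁, q₂}) (hr : HasRoots q₁ q₂ (fun _ => 1) (fun k => -r k)) :
    moduliFunction i j k h (Quotient.mk (projectiveEquivalence n) Φ) = crossRatioSum i j k h r := by
  obtain ⟨Φ', q₁', q₂', r', hm, hΦ', hr', hy⟩ := Classical.epsilon_spec (p := fun y =>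
    ∃ (Φ' : NonsingularPencil n) (q₁ q₂ : QuadraticForm ℂ (Fin n → ℂ)) (r : Fin n → ℂ),
      Quotient.mk (projectiveEquivalence n) Φ' = Quotient.mk (projectiveEquivalence n) Φ ∧
      Φ'.1 = Submodule.span ℂ {q₁, q₂} ∧ HasRoots q₁ q₂ (fun _ => 1) (fun k => -r k) ∧
      y = crossRatioSum i j k h r) ⟨_, Φ, q₁, q₂, r, rfl, hΦ, hr, rfl⟩
  refine hy.trans ?_
  obtain ⟨T, hT⟩ := Quotient.exact hm
  have hpr := hr'.pullback T
  rw [hΦ, hΦ', Submodule.map_span, Set.image_pair] at hT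
  obtain ⟨g, hg, hg₁, hg₂⟩ := exists_change_of_span_eq (hpr.linearIndependent hn) hT.symm
  rw [hg₁, hg₂] at hpr
  obtain ⟨τ, hτ⟩ := HasRoots.exists_perm_sends hn hg hr hpr
  refine Fintype.sum_equiv (Equiv.mulLeft τ) _ _ fun σ => ?_
  congr 1
  congr 1
  exact crossRatio_eq_of_sends hg fun m => hτ (σ m)

theorem isDegenerate_iff_det_eq_zero (q : QuadraticForm ℂ (Fin n → ℂ)) : IsDegenerate q ↔
    (Matrix.of fun i j => associated q (Pi.single i 1) (Pi.single j 1)).det = 0 := by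
  rw [← Matrix.exists_vecMul_eq_zero_iff]
  refine exists_congr fun u => and_congr_right fun _ => ?_
  have hu : ∀ j, (Matrix.vecMul u
      (Matrix.of fun i j => associated q (Pi.single i 1) (Pi.single j 1))) j =
      associated q u (Pi.single j 1) := by
    intro j
    conv_rhs => rw [pi_eq_sum_univ' u]
    simp [Matrix.vecMul, dotProduct, map_sum]
  constructor
  · intro h
    ext j
    rw [hu, h]
    rfl
  · intro h v
    rw [pi_eq_sum_univ' v, map_sum]
    refine Finset.sum_eq_zero fun j _ => ?_
    rw [map_smul, ← hu, h]
    simp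

/-- The matrix of one of the forms of a frame, after a change of basis of the pencil. -/
def frameMatrix (a c : ℂ) (C : Fin 2 × Fin n × Fin n → ℂ) : Matrix (Fin n) (Fin n) ℂ :=
  Matrix.of fun i j => a * C (0, i, j) + c * C (1, i, j)

theorem frameMatrix_coord (s : PencilFrame n) (a c : ℂ) : frameMatrix a c s.coord =
    Matrix.of fun i j =>
      associated (a • s.1 0 + c • s.1 1) (Pi.single i 1) (Pi.single j 1) := by
  ext i j
  simp [frameMatrix, PencilFrame.coord]

/-- The characteristic polynomial `det (X q₂ - q₁)` of a pencil. -/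
def pencilPoly (g : Fin 4 → ℂ) (C : Fin 2 × Fin n × Fin n → ℂ) : ℂ[X] :=
  ((X : ℂ[X]) • (frameMatrix (g 2) (g 3) C).map Polynomial.C +
    (frameMatrix (-g 0) (-g 1) C).map Polynomial.C).det

theorem isPolyFamily_pencilPoly (g : Fin 4 → ℂ) : IsPolyFamily (pencilPoly (n := n) g) := by
  have hF : ∀ (a c : ℂ) (i j : Fin n),
      IsPoly fun C : Fin 2 × Fin n × Fin n → ℂ => frameMatrix a c C i j := fun a c i j =>
    ((IsPoly.const a).mul (IsPoly.coord _)).add ((IsPoly.const c).mul (IsPoly.coord _))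
  refine IsPolyFamily.det fun i j => ?_
  simp only [Matrix.add_apply, Matrix.smul_apply, Matrix.map_apply, smul_eq_mul]
  exact ((IsPolyFamily.fixed X).mul (IsPolyFamily.C (hF _ _ _ _))).add
    (IsPolyFamily.C (hF _ _ _ _))

theorem natDegree_pencilPoly_le (g : Fin 4 → ℂ) (C : Fin 2 × Fin n × Fin n → ℂ) :
    (pencilPoly g C).natDegree ≤ n := by
  have := natDegree_det_X_add_C_le (frameMatrix (g 2) (g 3) C) (frameMatrix (-g 0) (-g 1) C)
  rwa [Fintype.card_fin] at this

theorem coeff_pencilPoly (g : Fin 4 → ℂ) (C : Fin 2 × Fin n × Fin n → ℂ) :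
    (pencilPoly g C).coeff n = (frameMatrix (g 2) (g 3) C).det := by
  have := coeff_det_X_add_C_card (frameMatrix (g 2) (g 3) C) (frameMatrix (-g 0) (-g 1) C)
  rwa [Fintype.card_fin] at this

theorem eval_pencilPoly (g : Fin 4 → ℂ) (C : Fin 2 × Fin n × Fin n → ℂ) (c : ℂ) :
    (pencilPoly g C).eval c = (frameMatrix (c * g 2 - g 0) (c * g 3 - g 1) C).det := by
  rw [← coe_evalRingHom, pencilPoly, RingHom.map_det]
  congr 1
  ext i j
  simp [frameMatrix]
  ring

theorem exists_hasRoots_of_coeff_pencilPoly_ne_zero {g : Fin 4 → ℂ} (hg : det₂ g ≠ 0)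
    (t : PencilFrame n) (he : (pencilPoly g t.coord).coeff n ≠ 0) :
    ∃ w : Fin n → ℂ, Submodule.span ℂ (Set.range t.1) = Submodule.span ℂ
        {g 0 • t.1 0 + g 1 • t.1 1, g 2 • t.1 0 + g 3 • t.1 1} ∧
      HasRoots (g 0 • t.1 0 + g 1 • t.1 1) (g 2 • t.1 0 + g 3 • t.1 1) (fun _ => 1)
        (fun k => -w k) ∧
      pencilPoly g t.coord = C ((pencilPoly g t.coord).coeff n) * ∏ k, (X - C (w k)) := by
  have hrange : Set.range t.1 = {t.1 0, t.1 1} := by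
    ext q
    simp [Fin.exists_fin_two, eq_comm]
  have hspan : Submodule.span ℂ (Set.range t.1) = Submodule.span ℂ
      {g 0 • t.1 0 + g 1 • t.1 1, g 2 • t.1 0 + g 3 • t.1 1} := by
    rw [span_pair_change hg, hrange]
  obtain ⟨α, β, h⟩ := IsNonsingularPencil.exists_hasRoots (hspan ▸ t.2.2)
  have hα : ∀ k, α k ≠ 0 := by
    intro k hk
    apply he
    rw [coeff_pencilPoly, frameMatrix_coord, ← isDegenerate_iff_det_eq_zero]
    have := (h.degenerate_iff 0 1 (by simp)).2 ⟨k, by rw [hk]; ring⟩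
    simpa using this
  obtain ⟨w, hw⟩ : ∃ w : Fin n → ℂ, HasRoots (g 0 • t.1 0 + g 1 • t.1 1)
    (g 2 • t.1 0 + g 3 • t.1 1) (fun _ => 1) (fun k => -w k) := ⟨_, h.normalize hα⟩
  refine ⟨w, hspan, hw, ?_⟩
  obtain ⟨κ, hκ, hP⟩ := eq_C_mul_prod_linear (P := pencilPoly g t.coord)
    (natDegree_pencilPoly_le g t.coord) (by
      intro h0
      rw [h0, coeff_zero] at he
      exact he rfl) hw.pairwise (by
      intro c
      rw [eval_pencilPoly, frameMatrix_coord, ← isDegenerate_iff_det_eq_zero]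
      have e : (c * g 2 - g 0) • t.1 0 + (c * g 3 - g 1) • t.1 1 =
          (-1 : ℂ) • (g 0 • t.1 0 + g 1 • t.1 1) + c • (g 2 • t.1 0 + g 3 • t.1 1) := by module
      rw [e, hw.degenerate_iff _ _ (by simp)]
      refine exists_congr fun k => ?_
      constructor <;> intro h <;> linear_combination -h) (by simp [he])
  have hcoef : (pencilPoly g t.coord).coeff n = κ := by
    rw [hP, coeff_C_mul, coeff_prod_linear]
    simp
  rw [hcoef]
  refine hP.trans ?_
  congr 1
  refine Finset.prod_congr rfl fun k _ => ?_
  rw [C_1, one_mul, C_neg, sub_eq_add_neg]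

/-- Symmetric functions of the roots are polynomial in the coefficients of the characteristic
polynomial, hence in the matrix entries, up to a power of the leading coefficient. Numerator and
denominator are treated as one family so that this power cancels. -/
theorem isRegularOn_moduliFunction (hn : 2 ≤ n) {i j : Fin n} (hij : i ≠ j) (k : Fin n)
    (h : MvPolynomial (Fin n) ℂ) : IsRegularOn Set.univ (moduliFunction i j k h) := by
  intro s _
  obtain ⟨H, N, hH⟩ := exists_eval_crossRatio_eq (k := k) hij h
  obtain ⟨V, hV⟩ : ∃ V : MvPolynomial (Fin n) ℂ, ∀ w, MvPolynomial.eval w V = discProd w ^ N := by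
    refine ⟨(∏ r ∈ (Finset.univ : Finset (Fin n)).offDiag,
      (MvPolynomial.X r.1 - MvPolynomial.X r.2)) ^ N, fun w => ?_⟩
    simp [discProd]
  -- A basis change of the pencil making the second form nondegenerate at s, so that the roots are
  -- finite near s.
  obtain ⟨g, hg, hgs⟩ : ∃ g : Fin 4 → ℂ, det₂ g ≠ 0 ∧ (pencilPoly g s.coord).coeff n ≠ 0 := by
    obtain ⟨q, hq, hqd⟩ := s.2.2.nondegenerate
    have hrange : Set.range s.1 = {s.1 0, s.1 1} := by
      ext q
      simp [Fin.exists_fin_two, eq_comm]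
    rw [hrange] at hq
    obtain ⟨a, c, rfl⟩ := Submodule.mem_span_pair.1 hq
    have hac : ∀ g : Fin 4 → ℂ, g 2 = a → g 3 = c → (pencilPoly g s.coord).coeff n ≠ 0 := by
      intro g h2 h3
      rw [coeff_pencilPoly, frameMatrix_coord, Ne, ← isDegenerate_iff_det_eq_zero, h2, h3]
      exact hqd
    by_cases ha : a = 0
    · have hc : c ≠ 0 := by
        rintro rfl
        apply hqd
        have : Nontrivial (Fin n → ℂ) := by
          have : Nonempty (Fin n) := ⟨i⟩
          infer_instance
        rw [ha, zero_smul, zero_smul, add_zero]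
        exact isDegenerate_zero
      exact ⟨![1, 0, a, c], by simp [det₂, hc], hac _ rfl rfl⟩
    · exact ⟨![0, 1, a, c], by simp [det₂, ha], hac _ rfl rfl⟩
  -- Symmetrizing the denominator, which is already symmetric, multiplies it by n!; this explains
  -- the factorial in the quotient below.
  obtain ⟨S, M, hS, hSM⟩ := exists_isPoly_symmetrization_family (isPolyFamily_pencilPoly (n := n) g)
    ![H, V]
  have hval : ∀ t : PencilFrame n, (pencilPoly g t.coord).coeff n ≠ 0 →
      S 1 t.coord ≠ 0 ∧ moduliFunction i j k h t.toModuli =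
        (Fintype.card (Equiv.Perm (Fin n)) : ℂ) * S 0 t.coord / S 1 t.coord := by
    intro t ht
    obtain ⟨w, hspan, hw, hP⟩ := exists_hasRoots_of_coeff_pencilPoly_ne_zero hg t ht
    have hwi := hw.injective
    have hd := pow_ne_zero N (discProd_ne_zero hwi)
    have h0 := hSM _ _ _ hP 0
    have h1 := hSM _ _ _ hP 1
    simp only [Matrix.cons_val] at h0 h1
    have h0' : ∀ τ : Equiv.Perm (Fin n), MvPolynomial.eval (w ∘ τ) H =
        discProd w ^ N * MvPolynomial.eval (crossRatio i j k (w ∘ τ)) h := fun τ => by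
      rw [hH _ (hwi.comp τ.injective), discProd_comp]
    simp only [h0', hV, discProd_comp, ← Finset.mul_sum, Finset.sum_const, Finset.card_univ,
      nsmul_eq_mul] at h0 h1
    have hcard : (Fintype.card (Equiv.Perm (Fin n)) : ℂ) ≠ 0 :=
      Nat.cast_ne_zero.2 Fintype.card_ne_zero
    have hcoef := pow_ne_zero M ht
    refine ⟨by rw [h1]; exact mul_ne_zero hcoef (mul_ne_zero hcard hd), ?_⟩
    have hf := moduliFunction_mk hn i j k h ⟨_, t.2.2⟩ hspan hw
    rw [PencilFrame.toModuli, hf, h0, h1, crossRatioSum]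
    field_simp
  -- The additional factor in numerator and denominator makes nonvanishing of the denominator
  -- include finiteness of the roots.
  obtain ⟨p, hp⟩ := (isPolyFamily_pencilPoly (n := n) g n).mul
    ((IsPoly.const (Fintype.card (Equiv.Perm (Fin n)) : ℂ)).mul (hS 0))
  obtain ⟨q, hq⟩ := (isPolyFamily_pencilPoly (n := n) g n).mul (hS 1)
  refine ⟨p, q, ?_, fun t _ ht => ?_⟩
  · rw [← hq]
    exact mul_ne_zero hgs (hval s hgs).1
  · rw [← hq] at ht
    have ht1 := left_ne_zero_of_mul ht
    rw [(hval t ht1).2, ← hp, ← hq, mul_div_mul_left _ _ ht1]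

theorem isRegularGermAt_moduliFunction (hn : 2 ≤ n) {i j : Fin n} (hij : i ≠ j) (k : Fin n)
    (h : MvPolynomial (Fin n) ℂ) (m : Moduli n) : IsRegularGermAt m (moduliFunction i j k h) :=
  ⟨Set.univ, isOpen_univ, Set.mem_univ _, isRegularOn_moduliFunction hn hij k h⟩

end ModuliFunction

end QuadricPencil

namespace QuadricPencil

open QuadraticMap Topology

/-! ### Local representations of functions on the moduli space -/

section LocalRepresentation

variable {n : ℕ}

theorem moduliMap_eq_mk {X : Set (ℙ ℂ (Fin (n + 3) → ℂ))} (y : nonsingularLocus X)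
    (J : (Fin n → ℂ) ≃ₗ[ℂ] TangentAt X y.1) : moduliMap X y =
      Quotient.mk (projectiveEquivalence n) ⟨_, y.2.2.pullback J⟩ := by
  refine Quotient.sound (s := projectiveEquivalence n) ⟨J.trans (tangentFrame X y).symm, ?_⟩
  dsimp only
  rw [map_pullback_trans]
  congr 2
  ext u
  simp

theorem associated_pullback {W W' : Type*} [AddCommGroup W] [Module ℂ W] [AddCommGroup W']
    [Module ℂ W'] (h : W →ₗ[ℂ] W') (q : QuadraticForm ℂ W') (u v : W) :
    associated (pullback h q) u v = associated q (h u) (h v) := by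
  simp [pullback_apply, associated_apply]

theorem IsPoly.bilin {σ τ : Type*} [Fintype τ] (B : (τ → ℂ) →ₗ[ℂ] (τ → ℂ) →ₗ[ℂ] ℂ)
    {G G' : (σ → ℂ) → τ → ℂ} (hG : ∀ i, IsPoly fun u => G u i) (hG' : ∀ i, IsPoly fun u => G' u i) :
    IsPoly fun u => B (G u) (G' u) := by
  classical
  have h : (fun u => B (G u) (G' u)) = fun u => ∑ i, G u i * B (Pi.single i 1) (G' u) := by
    ext u
    conv_lhs => rw [pi_eq_sum_univ' (G u)]
    simp [map_sum]
  rw [h]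
  exact IsPoly.sum _ fun i => (hG i).mul ((IsPoly.linear (B (Pi.single i 1))).comp hG')

variable {φ₁ φ₂ : QuadraticForm ℂ (Fin (n + 3) → ℂ)}

/-- Vectors forming a basis of the tangent space modulo the point give a frame of the pencil whose
coordinates are their Gram matrices, with no reference to the chosen tangent frames. -/
theorem exists_pencilFrame (hX : IsNonsingularIntersection φ₁ φ₂)
    (y : nonsingularLocus (quadricIntersection φ₁ φ₂)) (e : Fin n → Fin (n + 3) → ℂ)
    (he : ∀ j, e j ∈ affineTangent (quadricIntersection φ₁ φ₂) y.1.rep)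
    (hli : ∀ (c : Fin n → ℂ) (a : ℂ), ∑ j, c j • e j = a • y.1.rep → c = 0) :
    ∃ t : PencilFrame n, t.toModuli = moduliMap (quadricIntersection φ₁ φ₂) y ∧
      ∀ i j k, t.coord (i, j, k) = associated (![φ₁, φ₂] i) (e j) (e k) := by
  let e' : Fin n → affineTangent (quadricIntersection φ₁ φ₂) y.1.rep := fun j => ⟨e j, he j⟩
  let f : (Fin n → ℂ) →ₗ[ℂ] TangentAt (quadricIntersection φ₁ φ₂) y.1 :=
    Submodule.mkQ _ ∘ₗ Fintype.linearCombination ℂ e'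
  have hf : ∀ c, f c = tangentClass _ y.1 (∑ j, c j • e' j) := fun c => rfl
  have hinj : Function.Injective f := by
    rw [← LinearMap.ker_eq_bot, LinearMap.ker_eq_bot']
    intro c hc
    rw [hf] at hc
    obtain ⟨a, ha⟩ := (tangentClass_eq_zero_iff _).1 hc
    refine hli c a ?_
    rw [← ha, Submodule.coe_sum]
    rfl
  let J := LinearEquiv.ofInjectiveOfFinrankEq f hinj (by
    rw [finrank_tangentAt hX y.2.1, Module.finrank_fin_fun])
  have hJ : ∀ j, J (Pi.single j 1) = tangentClass _ y.1 (e' j) := by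
    intro j
    change f (Pi.single j 1) = _
    rw [hf]
    congr 1
    rw [Finset.sum_eq_single j]
    · simp
    · intro m _ hm
      simp [hm]
    · simp
  let ψ : Fin 2 → QuadraticForm ℂ (Fin n → ℂ) :=
    ![pullback (J : (Fin n → ℂ) →ₗ[ℂ] _) (firstForm hX y.2.1),
      pullback (J : (Fin n → ℂ) →ₗ[ℂ] _) (secondForm hX y.2.1)]
  have hspan : Submodule.span ℂ (Set.range ψ) =
      (secondFundamentalForm (quadricIntersection φ₁ φ₂) y.1).map
        (pullback (J : (Fin n → ℂ) →ₗ[ℂ] _)) := by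
    rw [secondFundamentalForm_eq_span hX y.2.1, Submodule.map_span, Set.image_pair]
    simp only [ψ, Matrix.range_cons, Matrix.range_empty, Set.union_empty, Set.singleton_union]
  have hns : IsNonsingularPencil n (Submodule.span ℂ (Set.range ψ)) := by
    rw [hspan]
    exact y.2.2.pullback J
  have hind : LinearIndependent ℂ ψ := by
    rw [linearIndependent_iff_card_eq_finrank_span, Set.finrank, hns.finrank_eq, Fintype.card_fin]
  refine ⟨⟨ψ, hind, hns⟩, ?_, ?_⟩
  · rw [moduliMap_eq_mk y J]
    refine congrArg (Quotient.mk (projectiveEquivalence n)) (Subtype.ext hspan)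
  · intro i j k
    change associated (ψ i) (Pi.single j 1) (Pi.single k 1) = _
    fin_cases i
    · change associated (pullback (J : (Fin n → ℂ) →ₗ[ℂ] _) (firstForm hX y.2.1)) _ _ =
        associated φ₁ _ _
      rw [associated_pullback, LinearEquiv.coe_coe, hJ, hJ, associated_inducedForm]
    · change associated (pullback (J : (Fin n → ℂ) →ₗ[ℂ] _) (secondForm hX y.2.1)) _ _ =
        associated φ₂ _ _
      rw [associated_pullback, LinearEquiv.coe_coe, hJ, hJ, associated_inducedForm]

/-- The projection of `w` to the tangent space at `u`, along `p` and `q`, without denominators. -/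
def tangentProjection (φ₁ φ₂ : QuadraticForm ℂ (Fin (n + 3) → ℂ)) (p q u w : Fin (n + 3) → ℂ) :
    Fin (n + 3) → ℂ :=
  (associated φ₁ u p * associated φ₂ u q - associated φ₁ u q * associated φ₂ u p) • w -
    (associated φ₂ u q * associated φ₁ u w - associated φ₁ u q * associated φ₂ u w) • p -
    (associated φ₁ u p * associated φ₂ u w - associated φ₂ u p * associated φ₁ u w) • q

theorem associated_tangentProjection (p q u w : Fin (n + 3) → ℂ) :
    associated φ₁ u (tangentProjection φ₁ φ₂ p q u w) = 0 ∧
      associated φ₂ u (tangentProjection φ₁ φ₂ p q u w) = 0 := by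
  constructor <;> simp only [tangentProjection, map_sub, map_smul, smul_eq_mul] <;> ring

theorem isPoly_tangentProjection (p q w : Fin (n + 3) → ℂ) (i : Fin (n + 3)) :
    IsPoly fun u => tangentProjection φ₁ φ₂ p q u w i := by
  have hB : ∀ (φ : QuadraticForm ℂ (Fin (n + 3) → ℂ)) w, IsPoly fun u => associated φ u w :=
    fun φ w => IsPoly.linear ((associated φ).flip w)
  exact ((((hB _ _).mul (hB _ _)).sub ((hB _ _).mul (hB _ _))).mul (IsPoly.const (w i))).sub
    ((((hB _ _).mul (hB _ _)).sub ((hB _ _).mul (hB _ _))).mul (IsPoly.const (p i))) |>.sub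
    ((((hB _ _).mul (hB _ _)).sub ((hB _ _).mul (hB _ _))).mul (IsPoly.const (q i)))

/-- A tangent frame at x is carried to nearby points by the denominator-free projection. The Gram
matrices, hence numerator and denominator of f, become polynomial in the vector u. -/
theorem exists_local_representation (hX : IsNonsingularIntersection φ₁ φ₂)
    (x : nonsingularLocus (quadricIntersection φ₁ φ₂)) {f : Moduli n → ℂ}
    (hf : IsRegularGermAt (moduliMap (quadricIntersection φ₁ φ₂) x) f) :
    ∃ N E : (Fin (n + 3) → ℂ) → ℂ, IsPoly N ∧ IsPoly E ∧ E x.1.rep ≠ 0 ∧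
      ∀ (u : Fin (n + 3) → ℂ) (hu : u ≠ 0)
        (hm : Projectivization.mk ℂ u hu ∈ nonsingularLocus (quadricIntersection φ₁ φ₂)), E u ≠ 0 →
        f (moduliMap (quadricIntersection φ₁ φ₂) ⟨_, hm⟩) = N u / E u := by
  obtain ⟨U, hU, hxU, hfU⟩ := hf
  set v := x.1.rep with hv
  obtain ⟨p, q, hp₁, hp₂, hq₁, hq₂⟩ := exists_dual_vectors hX (rep_mem_cone x.2.1)
  have hlift : ∀ j, ∃ e : affineTangent (quadricIntersection φ₁ φ₂) v,
      tangentClass _ x.1 e = tangentFrame _ x (Pi.single j 1) := fun j =>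
    Submodule.Quotient.mk_surjective _ _
  choose e he using hlift
  let E : (Fin (n + 3) → ℂ) → Fin n → Fin (n + 3) → ℂ := fun u j =>
    tangentProjection φ₁ φ₂ p q u (e j)
  have hEv : ∀ j, E v j = e j := by
    intro j
    obtain ⟨h1, h2⟩ := (mem_affineTangent_iff hX (rep_mem_cone x.2.1)).1 (e j).2
    simp only [E, tangentProjection]
    rw [h1, h2, hp₁, hp₂, hq₁, hq₂]
    simp
  let y : (Fin (n + 3) → ℂ) → Fin (n + 1) → Fin (n + 3) → ℂ := fun u => Fin.cons u (E u)
  have hy0 : ∀ u, y u 0 = u := fun u => rfl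
  have hys : ∀ u j, y u (Fin.succ j) = E u j := fun u j => rfl
  have hinj : Function.Injective (Fintype.linearCombination ℂ (y v)) := by
    rw [← LinearMap.ker_eq_bot, LinearMap.ker_eq_bot']
    intro c hc
    rw [Fintype.linearCombination_apply, Fin.sum_univ_succ, hy0] at hc
    simp only [hys, hEv] at hc
    have h1 : tangentClass (quadricIntersection φ₁ φ₂) x.1 (∑ j, c (Fin.succ j) • e j) = 0 := by
      refine (tangentClass_eq_zero_iff _).2 ⟨-c 0, ?_⟩
      rw [neg_smul, Submodule.coe_sum]
      exact eq_neg_of_add_eq_zero_right hc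
    have h2 : tangentFrame (quadricIntersection φ₁ φ₂) x (fun j => c (Fin.succ j)) = 0 := by
      rw [← h1, pi_eq_sum_univ' (fun j => c (Fin.succ j)), map_sum]
      simp only [map_smul, ← he]
      exact (map_sum (Submodule.mkQ _) _ _).symm
    have h3 : ∀ j, c (Fin.succ j) = 0 := by
      rw [LinearEquiv.map_eq_zero_iff] at h2
      exact congrFun h2
    simp only [h3, zero_smul, Finset.sum_const_zero, add_zero] at hc
    have h4 := (smul_eq_zero.1 hc).resolve_right x.1.rep_nonzero
    ext j
    refine Fin.cases h4 h3 j
  obtain ⟨Λ, hΛ⟩ := LinearMap.exists_leftInverse_of_injective _ (LinearMap.ker_eq_bot.2 hinj)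
  have hΛy : ∀ j, Λ (y v j) = Pi.single j 1 := by
    intro j
    have := LinearMap.congr_fun hΛ (Pi.single j 1)
    rw [LinearMap.comp_apply, Fintype.linearCombination_apply_single, one_smul] at this
    exact this
  -- Equal to 1 at v; where it is nonzero, u and the transported frame are linearly independent, so
  -- the frame is a basis of the tangent space.
  let Δ : (Fin (n + 3) → ℂ) → ℂ := fun u => (Matrix.of fun i j => Λ (y u j) i).det
  have hEp : ∀ j i, IsPoly fun u => E u j i := fun j i => isPoly_tangentProjection _ _ _ _
  have hyp : ∀ j i, IsPoly fun u => y u j i := by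
    intro j i
    refine Fin.cases ?_ (fun j => ?_) j
    · exact IsPoly.coord i
    · exact hEp j i
  have hΔ : IsPoly Δ := IsPoly.det fun i j =>
    (IsPoly.linear (LinearMap.proj i ∘ₗ Λ)).comp (hyp j)
  have hΔv : Δ v = 1 := by
    have : (Matrix.of fun i j => Λ (y v j) i) = 1 := by
      ext i j
      rw [Matrix.of_apply, hΛy, Matrix.one_apply, Pi.single_apply]
    simp only [Δ, this, Matrix.det_one]
  have hframe : ∀ (u : Fin (n + 3) → ℂ) (hu : u ≠ 0)
      (hm : Projectivization.mk ℂ u hu ∈ nonsingularLocus (quadricIntersection φ₁ φ₂)), Δ u ≠ 0 →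
      ∃ t : PencilFrame n, t.toModuli = moduliMap (quadricIntersection φ₁ φ₂) ⟨_, hm⟩ ∧
        t.coord = fun m => associated (![φ₁, φ₂] m.1) (E u m.2.1) (E u m.2.2) := by
    intro u hu hm hΔu
    obtain ⟨a, ha⟩ := Projectivization.exists_smul_eq_mk_rep ℂ u hu
    rw [Units.smul_def] at ha
    obtain ⟨t, ht, htc⟩ := exists_pencilFrame hX ⟨_, hm⟩ (E u) (fun j => by
      rw [mem_affineTangent_iff hX (rep_mem_cone hm.1), ← ha, map_smul, map_smul]
      obtain ⟨h1, h2⟩ := associated_tangentProjection (φ₁ := φ₁) (φ₂ := φ₂) p q u (e j)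
      simp only [LinearMap.smul_apply]
      exact ⟨by rw [h1, smul_zero], by rw [h2, smul_zero]⟩) (fun c s hcs => by
      rw [← ha, smul_smul] at hcs
      have h0 : Matrix.mulVec (Matrix.of fun i j => Λ (y u j) i)
          (Fin.cons (-(s * a)) c : Fin (n + 1) → ℂ) = 0 := by
        have h1 : ∑ j, (Fin.cons (-(s * a)) c : Fin (n + 1) → ℂ) j • y u j = 0 := by
          rw [Fin.sum_univ_succ]
          simp only [Fin.cons_zero, Fin.cons_succ, hy0, hys]
          rw [hcs, neg_smul, neg_add_cancel]
        have h2 := congrArg Λ h1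
        rw [map_sum, map_zero] at h2
        ext i
        have h3 := congrFun h2 i
        simp only [map_smul, Finset.sum_apply, Pi.smul_apply, smul_eq_mul] at h3
        rw [← h3]
        simp only [Matrix.mulVec, dotProduct, Matrix.of_apply]
        exact Finset.sum_congr rfl fun j _ => mul_comm _ _
      have h4 := Matrix.eq_zero_of_mulVec_eq_zero hΔu h0
      ext j
      exact congrFun h4 (Fin.succ j))
    exact ⟨t, ht, funext fun m => htc m.1 m.2.1 m.2.2⟩
  let Cf : (Fin (n + 3) → ℂ) → Fin 2 × Fin n × Fin n → ℂ := fun u m =>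
    associated (![φ₁, φ₂] m.1) (E u m.2.1) (E u m.2.2)
  have hCf : ∀ m, IsPoly fun u => Cf u m := fun m =>
    IsPoly.bilin (associated (![φ₁, φ₂] m.1)) (hEp m.2.1) (hEp m.2.2)
  have hxv : Projectivization.mk ℂ v x.1.rep_nonzero = x.1 := x.1.mk_rep
  obtain ⟨s, hs, hsc⟩ := hframe v x.1.rep_nonzero (by rw [hxv]; exact x.2) (by rw [hΔv]; exact one_ne_zero)
  have hsx : s.toModuli = moduliMap (quadricIntersection φ₁ φ₂) x := by
    rw [hs]
    congr 1
    exact Subtype.ext hxv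
  have hsU : s.toModuli ∈ U := hsx ▸ hxU
  have hU' : IsOpen[(zariski (Fin 2 × Fin n × Fin n)).induced PencilFrame.coord]
      (PencilFrame.toModuli ⁻¹' U) := isOpen_coinduced.1 hU
  obtain ⟨O, hO, hOU⟩ := (@isOpen_induced_iff _ _ (zariski (Fin 2 × Fin n × Fin n)) _ _).1 hU'
  have hsO : s.coord ∈ O := by
    have : s ∈ PencilFrame.coord ⁻¹' O := by
      rw [hOU]
      exact hsU
    exact this
  obtain ⟨ω, hω, hωs, hωO⟩ := zariski_exists_principal hO hsO
  obtain ⟨P, R, hR, hPR⟩ := hfU s hsU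
  -- The common factor restricts the formula to vectors where the frame is valid and the class of
  -- its pencil lies in U.
  refine ⟨fun u => Δ u * ω (Cf u) * MvPolynomial.eval (Cf u) P,
    fun u => Δ u * ω (Cf u) * MvPolynomial.eval (Cf u) R,
    (hΔ.mul (hω.comp hCf)).mul (IsPoly.eval P hCf), (hΔ.mul (hω.comp hCf)).mul (IsPoly.eval R hCf),
    ?_, ?_⟩
  · have hsc' : Cf v = s.coord := hsc.symm
    dsimp only
    rw [hsc', hΔv, one_mul]
    exact mul_ne_zero hωs hR
  · intro u hu hm hE
    have hΔu := left_ne_zero_of_mul (left_ne_zero_of_mul hE)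
    have hωu := right_ne_zero_of_mul (left_ne_zero_of_mul hE)
    have hRu := right_ne_zero_of_mul hE
    obtain ⟨t, ht, htc⟩ := hframe u hu hm hΔu
    have htc' : Cf u = t.coord := htc.symm
    dsimp only
    rw [mul_div_mul_left _ _ (left_ne_zero_of_mul hE)]
    rw [htc'] at hωu hRu ⊢
    have htU : t.toModuli ∈ U := by
      have : t ∈ PencilFrame.toModuli ⁻¹' U := by
        rw [← hOU]
        exact hωO _ hωu
      exact this
    rw [← ht]
    exact hPR t htU hRu

end LocalRepresentation

end QuadricPencil

namespace QuadricPencil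

open QuadraticMap

/-! ### The kernel of the differential of the moduli map -/

section Variation

variable {n : ℕ}

theorem exists_hasDerivAt_crossRatio {i j k : Fin n} {r δ : Fin n → ℂ} (hr : Function.Injective r)
    (hij : i ≠ j) : ∃ d : Fin n → ℂ, HasDerivAt
      (fun t : ℂ => crossRatio i j k (fun p => r p + t * δ p)) d 0 ∧ ∀ m, m ≠ k → d m =
      (((δ m - δ i) * (r j - r k) + (r m - r i) * (δ j - δ k)) * ((r m - r k) * (r j - r i)) -
        (r m - r i) * (r j - r k) * ((δ m - δ k) * (r j - r i) + (r m - r k) * (δ j - δ i))) /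
        ((r m - r k) * (r j - r i)) ^ 2 := by
  have h : ∀ m, ∃ d : ℂ,
      HasDerivAt (fun t : ℂ => crossRatio i j k (fun p => r p + t * δ p) m) d 0 := by
    intro m
    by_cases hm : m = k
    · refine ⟨0, ?_⟩
      simp only [crossRatio, hm, sub_self, zero_mul, div_zero]
      exact hasDerivAt_const _ _
    · exact ⟨_, hasDerivAt_crossRatio hr hij m hm⟩
  choose d hd using h
  exact ⟨d, hasDerivAt_pi.2 hd, fun m hm => (hd m).unique (hasDerivAt_crossRatio hr hij m hm)⟩

/-- The function of the cross ratios whose symmetrization has the first order variation of the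
`m`-th cross ratio. -/
def testPolynomial (i j k : Fin n) (r : Fin n → ℂ) (ψ : MvPolynomial (Fin n) ℂ) (m : Fin n) :
    MvPolynomial (Fin n) ℂ :=
  ψ ^ 2 * (MvPolynomial.X m - MvPolynomial.C (crossRatio i j k r m))

/-- In the term of the identity, ψ is 1 and the linear factor vanishes at t = 0, so only the
derivative of the cross ratio remains. In the other terms ψ² has derivative zero, because ψ itself
vanishes; this is why the square is taken. -/
theorem hasDerivAt_crossRatioSum {i j k : Fin n} {r δ : Fin n → ℂ} (hr : Function.Injective r)
    (hij : i ≠ j) {ψ : MvPolynomial (Fin n) ℂ} (h1 : MvPolynomial.eval (crossRatio i j k r) ψ = 1)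
    (h0 : ∀ τ : Equiv.Perm (Fin n), τ ≠ 1 →
      MvPolynomial.eval (crossRatio i j k (r ∘ τ)) ψ = 0) (m : Fin n) (hm : m ≠ k) :
    HasDerivAt (fun t : ℂ => crossRatioSum i j k (testPolynomial i j k r ψ m)
      (fun p => r p + t * δ p))
      ((((δ m - δ i) * (r j - r k) + (r m - r i) * (δ j - δ k)) * ((r m - r k) * (r j - r i)) -
        (r m - r i) * (r j - r k) * ((δ m - δ k) * (r j - r i) + (r m - r k) * (δ j - δ i))) /
        ((r m - r k) * (r j - r i)) ^ 2) 0 := by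
  classical
  have hτ : ∀ τ : Equiv.Perm (Fin n), ∃ (d : Fin n → ℂ) (e : ℂ),
      HasDerivAt (fun t : ℂ => crossRatio i j k ((fun p => r p + t * δ p) ∘ τ)) d 0 ∧
      HasDerivAt (fun t : ℂ =>
        MvPolynomial.eval (crossRatio i j k ((fun p => r p + t * δ p) ∘ τ)) ψ) e 0 := by
    intro τ
    obtain ⟨d, hd, -⟩ := exists_hasDerivAt_crossRatio (k := k) (δ := δ ∘ τ) (hr.comp τ.injective) hij
    exact ⟨d, _, hd, hasDerivAt_mvPolynomial ψ hd⟩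
  choose d e hd he using hτ
  have hterm : ∀ τ : Equiv.Perm (Fin n), HasDerivAt (fun t : ℂ =>
      MvPolynomial.eval (crossRatio i j k ((fun p => r p + t * δ p) ∘ τ))
        (testPolynomial i j k r ψ m)) (if τ = 1 then d 1 m else 0) 0 := by
    intro τ
    have h2 := (((he τ).fun_pow 2).fun_mul ((hasDerivAt_pi.1 (hd τ) m).sub_const
      (crossRatio i j k r m)))
    have hfun : (fun t : ℂ =>
        MvPolynomial.eval (crossRatio i j k ((fun p => r p + t * δ p) ∘ τ))
          (testPolynomial i j k r ψ m)) = fun t : ℂ =>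
        MvPolynomial.eval (crossRatio i j k ((fun p => r p + t * δ p) ∘ τ)) ψ ^ 2 *
          (crossRatio i j k ((fun p => r p + t * δ p) ∘ τ) m - crossRatio i j k r m) := by
      ext t
      simp [testPolynomial]
    rw [hfun]
    refine h2.congr_deriv ?_
    have hr0 : (fun p => r p + 0 * δ p) = r := by
      ext p
      simp
    simp only [hr0]
    split_ifs with hτ
    · subst hτ
      have : r ∘ ((1 : Equiv.Perm (Fin n)) : Fin n → Fin n) = r := rfl
      rw [this, h1]
      ring
    · rw [h0 τ hτ]
      ring
  have hsum := HasDerivAt.fun_sum (u := Finset.univ) fun τ _ => hterm τ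
  rw [Finset.sum_ite_eq' Finset.univ (1 : Equiv.Perm (Fin n)), if_pos (Finset.mem_univ _)] at hsum
  obtain ⟨d', hd', hdm⟩ := exists_hasDerivAt_crossRatio (k := k) (δ := δ) hr hij
  have hdd : d 1 = d' := (hd 1).unique hd'
  rw [hdd, hdm m hm] at hsum
  exact hsum

theorem exists_differential {σ : Type*} [Fintype σ] (p q : MvPolynomial σ ℂ) {v : σ → ℂ}
    (hq : MvPolynomial.eval v q ≠ 0) : ∃ L : (σ → ℂ) →ₗ[ℂ] ℂ, ∀ (c : ℂ → σ → ℂ) (c' : σ → ℂ),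
      c 0 = v → HasDerivAt c c' 0 →
      HasDerivAt (fun t => MvPolynomial.eval (c t) p / MvPolynomial.eval (c t) q) (L c') 0 := by
  let D : MvPolynomial σ ℂ → (σ → ℂ) →ₗ[ℂ] ℂ := fun p =>
    ∑ i, MvPolynomial.eval v (MvPolynomial.pderiv i p) • LinearMap.proj i
  have hD : ∀ p w, D p w = ∑ i, MvPolynomial.eval v (MvPolynomial.pderiv i p) * w i := by
    intro p w
    simp [D]
  refine ⟨(MvPolynomial.eval v q ^ 2)⁻¹ •
    (MvPolynomial.eval v q • D p - MvPolynomial.eval v p • D q), fun c c' hc hc' => ?_⟩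
  have h1 := hasDerivAt_mvPolynomial p hc'
  have h2 := hasDerivAt_mvPolynomial q hc'
  rw [hc, ← hD] at h1 h2
  have h3 := h1.fun_div h2 (by rwa [hc])
  rw [hc] at h3
  refine h3.congr_deriv ?_
  simp only [LinearMap.smul_apply, LinearMap.sub_apply, smul_eq_mul]
  field_simp

theorem eventually_injective {r δ : Fin n → ℂ} (hr : Function.Injective r) :
    ∀ᶠ t in nhds (0 : ℂ), Function.Injective fun p => r p + t * δ p := by
  have h : ∀ᶠ t in nhds (0 : ℂ), ∀ p q, p ≠ q → r p + t * δ p - (r q + t * δ q) ≠ 0 := by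
    refine Filter.eventually_all.2 fun p => Filter.eventually_all.2 fun q => ?_
    by_cases hpq : p = q
    · exact Filter.Eventually.of_forall fun t h => absurd hpq h
    · have hc : ContinuousAt (fun t : ℂ => r p + t * δ p - (r q + t * δ q)) 0 := by fun_prop
      refine (hc.eventually_ne ?_).mono fun t ht _ => ht
      simpa using sub_ne_zero.2 (hr.ne hpq)
  filter_upwards [h] with t ht p q hpq
  by_contra hne
  exact ht p q hne (sub_eq_zero.2 hpq)

/-- The values at the points `r_k` of quadratic polynomials. -/
def quadraticValues (r : Fin n → ℂ) : (Fin 3 → ℂ) →ₗ[ℂ] (Fin n → ℂ) where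
  toFun a p := a 0 + a 1 * r p + a 2 * r p ^ 2
  map_add' a a' := by
    ext p
    simp
    ring
  map_smul' s a := by
    ext p
    simp
    ring

theorem quadraticValues_injective (hn : 3 ≤ n) {r : Fin n → ℂ} (hr : Function.Injective r) :
    Function.Injective (quadraticValues r) := by
  rw [← LinearMap.ker_eq_bot, LinearMap.ker_eq_bot']
  intro a ha
  have h : ∀ p, a 0 + a 1 * r p + a 2 * r p ^ 2 = 0 := fun p => congrFun ha p
  have h01 : r ⟨0, by omega⟩ - r ⟨1, by omega⟩ ≠ 0 := sub_ne_zero.2 (hr.ne (by simp))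
  have h02 : r ⟨0, by omega⟩ - r ⟨2, by omega⟩ ≠ 0 := sub_ne_zero.2 (hr.ne (by simp))
  have h12 : r ⟨1, by omega⟩ - r ⟨2, by omega⟩ ≠ 0 := sub_ne_zero.2 (hr.ne (by simp))
  have e0 := h ⟨0, by omega⟩
  have e1 := h ⟨1, by omega⟩
  have e2 := h ⟨2, by omega⟩
  generalize r ⟨0, by omega⟩ = x at *
  generalize r ⟨1, by omega⟩ = y at *
  generalize r ⟨2, by omega⟩ = z at *
  have k1 : a 1 + a 2 * (x + y) = 0 := by
    apply mul_left_cancel₀ h01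
    linear_combination e0 - e1
  have k2 : a 1 + a 2 * (x + z) = 0 := by
    apply mul_left_cancel₀ h02
    linear_combination e0 - e2
  have a2 : a 2 = 0 := by
    apply mul_left_cancel₀ h12
    linear_combination k1 - k2
  have a1 : a 1 = 0 := by
    rw [a2] at k1
    linear_combination k1
  have a0 : a 0 = 0 := by
    rw [a1, a2] at e0
    linear_combination e0
  ext p
  fin_cases p
  · exact a0
  · exact a1
  · exact a2

end Variation

/-! ### The kernel of the differential and the tangent space of the fiber -/

section Kernel

variable {n : ℕ} {φ₁ φ₂ : QuadraticForm ℂ (Fin (n + 3) → ℂ)}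
  {x : nonsingularLocus (quadricIntersection φ₁ φ₂)}
  {b : Module.Basis (Fin (n + 3)) ℂ (Fin (n + 3) → ℂ)} {l : Fin (n + 3) → ℂ} {r : Fin n → ℂ}

theorem moduliFunction_moduliMap (hn : 2 ≤ n) (hX : IsNonsingularIntersection φ₁ φ₂)
    (hb : IsStandardBasis φ₁ φ₂ b l) {w : Fin n → ℂ} (hw : Function.Injective w)
    {u : Fin (n + 3) → ℂ} (hu : u ≠ 0) (h : HasRootVector b l w u) :
    ∃ hm : Projectivization.mk ℂ u hu ∈ nonsingularLocus (quadricIntersection φ₁ φ₂),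
      ∀ (i j k : Fin n) (p : MvPolynomial (Fin n) ℂ),
        moduliFunction i j k p (moduliMap (quadricIntersection φ₁ φ₂) ⟨_, hm⟩) =
          crossRatioSum i j k p w := by
  obtain ⟨κ, hκ, hκu⟩ := h
  obtain ⟨a, ha⟩ := Projectivization.exists_smul_eq_mk_rep ℂ u hu
  rw [Units.smul_def] at ha
  obtain ⟨hu', hX'⟩ := IsChart.mem_cone_of_hasRootVector hb hu ⟨κ, hκ, hκu⟩
  obtain ⟨ν, hν⟩ := IsAlgClosed.exists_pow_nat_eq ((a : ℂ) ^ 2 * κ) (show 0 < n by omega)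
  have hν0 : ν ≠ 0 := by
    rintro rfl
    rw [zero_pow (by omega)] at hν
    exact mul_ne_zero (pow_ne_zero 2 a.ne_zero) hκ hν.symm
  have hroots := hasRoots_of_poly (α := fun _ => ν) (β := fun k => -(ν * w k)) hb hX hX' (by
    intro k m hkm h0
    apply hkm
    apply hw
    apply mul_left_cancel₀ (pow_ne_zero 2 hν0)
    linear_combination h0) (by
    intro i
    rw [← ha, map_smul, Finsupp.smul_apply, smul_eq_mul, mul_pow, mul_assoc, hκu, ← mul_assoc, ← hν,
      Polynomial.eval_prod]
    have : ν ^ n = ∏ _k : Fin n, ν := by simp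
    rw [this, ← Finset.prod_mul_distrib]
    refine Finset.prod_congr rfl fun k _ => ?_
    simp only [Polynomial.eval_add, Polynomial.eval_mul, Polynomial.eval_C, Polynomial.eval_X]
    ring)
  have hr : HasRoots (firstForm hX hX') (secondForm hX hX') (fun _ => 1) (fun k => -w k) := by
    have := hroots.normalize fun _ => hν0
    convert this using 2 with k
    field_simp
  have hII := secondFundamentalForm_eq_span hX hX'
  have hm : Projectivization.mk ℂ u hu ∈ nonsingularLocus (quadricIntersection φ₁ φ₂) :=
    ⟨hX', hII ▸ hr.isNonsingularPencil hn (finrank_tangentAt hX hX')⟩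
  refine ⟨hm, fun i j k p => ?_⟩
  refine moduliFunction_mk hn i j k p _ ?_ (hr.pullback (tangentFrame _ ⟨_, hm⟩))
  dsimp only
  rw [hII, Submodule.map_span, Set.image_pair]

namespace IsChart

/-- A curve in the nonsingular locus. -/
theorem exists_lift {X : Set (ℙ ℂ (Fin (n + 3) → ℂ))} (x : nonsingularLocus X)
    {c : ℂ → Fin (n + 3) → ℂ}
    (h : ∀ᶠ t in nhds (0 : ℂ), ∃ hu : c t ≠ 0, Projectivization.mk ℂ (c t) hu ∈ nonsingularLocus X) :
    ∃ γ : ℂ → nonsingularLocus X,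
      ∀ᶠ t in nhds (0 : ℂ), ∃ h : c t ≠ 0, (γ t).1 = Projectivization.mk ℂ (c t) h := by
  classical
  refine ⟨fun t => if h : ∃ hu : c t ≠ 0, Projectivization.mk ℂ (c t) hu ∈ nonsingularLocus X then
    ⟨Projectivization.mk ℂ (c t) h.1, h.2⟩ else x, h.mono fun t ht => ⟨ht.1, ?_⟩⟩
  dsimp only
  rw [dif_pos ht]

theorem eventually_moduliFunction (hc : IsChart φ₁ φ₂ x b l r) {δ : Fin n → ℂ}
    {c : ℂ → Fin (n + 3) → ℂ} (hca : AnalyticAt ℂ c 0) (hc0 : c 0 = x.1.rep)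
    (hcr : ∀ᶠ t in nhds (0 : ℂ), HasRootVector b l (fun k => r k + t * δ k) (c t)) :
    ∀ᶠ t in nhds (0 : ℂ), ∃ (hu : c t ≠ 0)
      (hm : Projectivization.mk ℂ (c t) hu ∈ nonsingularLocus (quadricIntersection φ₁ φ₂)),
      ∀ (i j k : Fin n) (p : MvPolynomial (Fin n) ℂ),
        moduliFunction i j k p (moduliMap (quadricIntersection φ₁ φ₂) ⟨_, hm⟩) =
          crossRatioSum i j k p fun k => r k + t * δ k := by
  have hn := hc.three_le
  filter_upwards [hcr, eventually_ne_zero hca.continuousAt hc0, eventually_injective hc.injective]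
    with t ht hu hi
  exact ⟨hu, moduliFunction_moduliMap (by omega) hc.nonsingular hc.standard hi hu ht⟩

/-- The derivative of each test function along the curve with root velocities δ is the variation of
one cross ratio. All of them vanish, so δ is quadratic in r. -/
theorem quadratic_of_mem_kernel (hc : IsChart φ₁ φ₂ x b l r) {δ : Fin n → ℂ}
    (h : tangentClass _ x.1 ⟨_, hc.rootMotion_mem δ⟩ ∈
      kernelOfDifferential (quadricIntersection φ₁ φ₂) x) : ∃ a, δ = quadraticValues r a := by
  have hn := hc.three_le
  let i : Fin n := ⟨0, by omega⟩
  let j : Fin n := ⟨1, by omega⟩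
  let k : Fin n := ⟨2, by omega⟩
  have hij : i ≠ j := by simp [i, j]
  have hik : i ≠ k := by simp [i, k]
  have hjk : j ≠ k := by simp [j, k]
  obtain ⟨ψ, h1, h0⟩ := exists_separating hc.injective hc.trivialStabilizer hij hik hjk
  obtain ⟨c, hca, hc0, hcd, hcr⟩ := hc.exists_rootMotion_curve δ
  have hev := hc.eventually_moduliFunction hca hc0 hcr
  obtain ⟨γ, hγ⟩ := exists_lift x (hev.mono fun t ht => ⟨ht.1, ht.2.1⟩)
  obtain ⟨A, B, C, hABC⟩ := exists_quadratic_of_variation_eq_zero (δ := δ) hc.injective hij hik hjk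
    (by
      intro m hm
      obtain ⟨L, hL, hLw⟩ := h _ (isRegularGermAt_moduliFunction (by omega) hij k
        (testPolynomial i j k r ψ m) _)
      have hd := hL γ c ⟨_, hc.rootMotion_mem δ⟩ hca hγ hc0 hcd
      rw [hLw] at hd
      have hd' := (hasDerivAt_crossRatioSum (δ := δ) hc.injective hij h1 h0 m hm).congr_of_eventuallyEq
        (f₁ := fun t => moduliFunction i j k (testPolynomial i j k r ψ m)
          (moduliMap (quadricIntersection φ₁ φ₂) (γ t))) (by
          filter_upwards [hev, hγ] with t ht hγt
          obtain ⟨hu, hm', hval⟩ := ht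
          have hγt' : γ t = ⟨_, hm'⟩ := Subtype.ext hγt.2
          rw [hγt', hval])
      have := hd'.unique hd
      rw [div_eq_zero_iff] at this
      refine this.resolve_right (pow_ne_zero 2 (mul_ne_zero ?_ ?_))
      · exact _root_.sub_ne_zero.2 (hc.injective.ne hm)
      · exact _root_.sub_ne_zero.2 (hc.injective.ne hij.symm))
  exact ⟨![A, B, C], funext fun p => by simp [quadraticValues, hABC]⟩

theorem exists_fiber_curve (hc : IsChart φ₁ φ₂ x b l r) (a : Fin 3 → ℂ) :
    ∃ (c : ℂ → Fin (n + 3) → ℂ) (s : ℂ), AnalyticAt ℂ c 0 ∧ c 0 = x.1.rep ∧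
      HasDerivAt c (rootMotion b l r x.1.rep (quadraticValues r a) + s • x.1.rep) 0 ∧
      ∀ᶠ t in nhds (0 : ℂ), c t ∈ cone (moduliFiber (quadricIntersection φ₁ φ₂) x) := by
  -- The matrix is chosen so that -(m₁ + (m₀ - m₃) r - m₂ r²) becomes a₀ + a₁ r + a₂ r².
  obtain ⟨c, s, hca, hc0, hcd, hcr⟩ := hc.exists_moebius_curve ![-a 1, -a 0, a 2, 0]
  refine ⟨c, s, hca, hc0, ?_, ?_⟩
  · convert hcd using 4
    simp [quadraticValues]
    ring
  · filter_upwards [hcr, eventually_ne_zero hca.continuousAt hc0] with t ht hu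
    exact hc.mem_cone_moduliFiber_iff.2 ⟨hu, ht⟩

theorem mem_cone_of_smul_rep (x : nonsingularLocus (quadricIntersection φ₁ φ₂)) {a : ℂ}
    (ha : a ≠ 0) : a • x.1.rep ∈ cone (moduliFiber (quadricIntersection φ₁ φ₂) x) := by
  refine ⟨smul_ne_zero ha x.1.rep_nonzero, ?_⟩
  have : Projectivization.mk ℂ (a • x.1.rep) (smul_ne_zero ha x.1.rep_nonzero) = x.1 := by
    conv_rhs => rw [← x.1.mk_rep]
    exact (Projectivization.mk_eq_mk_iff' ℂ _ _ _ _).2 ⟨a, rfl⟩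
  rw [this]
  exact mem_moduliFiber _ x

theorem exists_radial_curve (x : nonsingularLocus (quadricIntersection φ₁ φ₂)) :
    ∃ c : ℂ → Fin (n + 3) → ℂ, c 0 = x.1.rep ∧ HasDerivAt c x.1.rep 0 ∧
      ∀ᶠ t in nhds (0 : ℂ), c t ∈ cone (moduliFiber (quadricIntersection φ₁ φ₂) x) := by
  refine ⟨fun t => (1 + t) • x.1.rep, by simp, ?_, ?_⟩
  · have h : HasDerivAt (fun t : ℂ => 1 + t) 1 0 := (hasDerivAt_id (0 : ℂ)).const_add 1
    simpa using h.smul_const x.1.rep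
  · have hcont : ContinuousAt (fun t : ℂ => 1 + t) 0 := by fun_prop
    exact (hcont.eventually_ne (by simp)).mono fun t ht => mem_cone_of_smul_rep x ht

/-- A function pulled back from the moduli space is constant along curves in the fiber, and up to a
radial term the given vector is the velocity of one. The radial term is harmless because the radial
curve lies in the fiber too. -/
theorem mem_kernel_of_quadratic (hc : IsChart φ₁ φ₂ x b l r) (a : Fin 3 → ℂ) :
    tangentClass _ x.1 ⟨_, hc.rootMotion_mem (quadraticValues r a)⟩ ∈
      kernelOfDifferential (quadricIntersection φ₁ φ₂) x := by
  intro f hf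
  obtain ⟨N, E, ⟨p, hp⟩, ⟨q, hq⟩, hEv, hNE⟩ := exists_local_representation hc.nonsingular x hf
  rw [hq] at hEv
  obtain ⟨L, hL⟩ := exists_differential p q hEv
  have hqc : ∀ c : ℂ → Fin (n + 3) → ℂ, c 0 = x.1.rep → (∃ c', HasDerivAt c c' 0) →
      ∀ᶠ t in nhds (0 : ℂ), MvPolynomial.eval (c t) q ≠ 0 := by
    rintro c hc0 ⟨c', hc'⟩
    have := (hasDerivAt_mvPolynomial q hc').continuousAt
    exact this.eventually_ne (by rwa [hc0])
  have hconst : ∀ (c : ℂ → Fin (n + 3) → ℂ) (c' : Fin (n + 3) → ℂ), c 0 = x.1.rep →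
      HasDerivAt c c' 0 →
      (∀ᶠ t in nhds (0 : ℂ), c t ∈ cone (moduliFiber (quadricIntersection φ₁ φ₂) x)) → L c' = 0 := by
    intro c c' hc0 hc' hcF
    refine (hL c c' hc0 hc').unique ((hasDerivAt_const (0 : ℂ)
      (f (moduliMap (quadricIntersection φ₁ φ₂) x))).congr_of_eventuallyEq ?_)
    filter_upwards [hcF, hqc c hc0 ⟨c', hc'⟩] with t ht htq
    obtain ⟨hu, hm, hmap⟩ := ht
    rw [← hmap, hNE (c t) hu hm (by rwa [hq]), hp, hq]
  obtain ⟨c₁, hc₁, hc₁', hc₁F⟩ := exists_radial_curve x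
  have hLv : L x.1.rep = 0 := hconst c₁ _ hc₁ hc₁' hc₁F
  obtain ⟨c₂, s, hc₂a, hc₂, hc₂', hc₂F⟩ := hc.exists_fiber_curve a
  have hLw := hconst c₂ _ hc₂ hc₂' hc₂F
  rw [map_add, map_smul, hLv, smul_zero, add_zero] at hLw
  refine ⟨Submodule.liftQ _ (L ∘ₗ (affineTangent (quadricIntersection φ₁ φ₂) x.1.rep).subtype) ?_,
    ?_, ?_⟩
  · intro w hw
    rw [Submodule.mem_comap, Projectivization.submodule_eq, Submodule.mem_span_singleton] at hw
    obtain ⟨t, ht⟩ := hw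
    rw [LinearMap.mem_ker, LinearMap.comp_apply, ← ht, map_smul, hLv, smul_zero]
  · intro γ c c' hca hγ hc0 hc'
    have hd := hL c c' hc0 hc'
    refine hd.congr_of_eventuallyEq ?_
    filter_upwards [hγ, hqc c hc0 ⟨_, hc'⟩] with t ht htq
    obtain ⟨hu, hγt⟩ := ht
    have hm : Projectivization.mk ℂ (c t) hu ∈ nonsingularLocus (quadricIntersection φ₁ φ₂) := by
      rw [← hγt]
      exact (γ t).2
    have hγt' : γ t = ⟨_, hm⟩ := Subtype.ext hγt
    rw [hγt', hNE (c t) hu hm (by rwa [hq]), hp, hq]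
  · exact hLw

/-- The test functions, written locally as quotients p / q, yield polynomials vanishing on the cone
over the fiber, so a vector of its Zariski tangent space has no first order variation of cross
ratios. -/
theorem exists_quadratic_of_mem_affineTangent (hc : IsChart φ₁ φ₂ x b l r) {w : Fin (n + 3) → ℂ}
    (hw : w ∈ affineTangent (moduliFiber (quadricIntersection φ₁ φ₂) x) x.1.rep) :
    ∃ (a : Fin 3 → ℂ) (s : ℂ),
      w = rootMotion b l r x.1.rep (quadraticValues r a) + s • x.1.rep := by
  have hn := hc.three_le
  have hself : x.1.rep ∈ affineTangent (moduliFiber (quadricIntersection φ₁ φ₂) x) x.1.rep := by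
    obtain ⟨c, hc0, hcd, hcF⟩ := exists_radial_curve x
    have := mem_affineTangent_of_curve hcd hcF
    rwa [hc0] at this
  obtain ⟨δ, s, rfl⟩ := hc.exists_rootMotion_eq (affineTangent_mono (fun y hy => hy.1.1) _ hw)
  have hδ : rootMotion b l r x.1.rep δ ∈
      affineTangent (moduliFiber (quadricIntersection φ₁ φ₂) x) x.1.rep :=
    (Submodule.add_mem_iff_left _ (Submodule.smul_mem _ s hself)).1 hw
  let i : Fin n := ⟨0, by omega⟩
  let j : Fin n := ⟨1, by omega⟩
  let k : Fin n := ⟨2, by omega⟩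
  have hij : i ≠ j := by simp [i, j]
  have hik : i ≠ k := by simp [i, k]
  have hjk : j ≠ k := by simp [j, k]
  obtain ⟨ψ, h1, h0⟩ := exists_separating hc.injective hc.trivialStabilizer hij hik hjk
  obtain ⟨c, hca, hc0, hcd, hcr⟩ := hc.exists_rootMotion_curve δ
  have hev := hc.eventually_moduliFunction hca hc0 hcr
  obtain ⟨A, B, C, hABC⟩ := exists_quadratic_of_variation_eq_zero (δ := δ) hc.injective hij hik hjk
    (by
      intro m hm
      set f := moduliFunction i j k (testPolynomial i j k r ψ m) with hf
      obtain ⟨N, E, ⟨p, hp⟩, ⟨q, hq⟩, hEv, hNE⟩ := exists_local_representation hc.nonsingular x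
        (isRegularGermAt_moduliFunction (by omega) hij k (testPolynomial i j k r ψ m) _)
      set κ := f (moduliMap (quadricIntersection φ₁ φ₂) x) with hκ
      -- The equation p = κ q is only known where q ≠ 0; the additional factor q makes the
      -- polynomial vanish on the whole cone.
      have hvan : ∀ u ∈ cone (moduliFiber (quadricIntersection φ₁ φ₂) x),
          MvPolynomial.eval u ((p - MvPolynomial.C κ * q) * q) = 0 := by
        rintro u ⟨hu, hmem, hmap⟩
        rw [map_mul, map_sub, map_mul, MvPolynomial.eval_C, ← hp, ← hq]
        by_cases hEu : E u = 0
        · rw [hEu, mul_zero]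
        · have := hNE u hu hmem hEu
          rw [hmap, ← hf, ← hκ, eq_div_iff hEu] at this
          rw [this, sub_self, zero_mul]
      have hd := hasDerivAt_mvPolynomial ((p - MvPolynomial.C κ * q) * q) hcd
      rw [hc0, hδ _ hvan] at hd
      have hF := hasDerivAt_crossRatioSum (δ := δ) hc.injective hij h1 h0 m hm
      have hqd := hasDerivAt_mvPolynomial q hcd
      have hq0 : MvPolynomial.eval x.1.rep q ≠ 0 := by rwa [← hq]
      have hqe : ∀ᶠ t in nhds (0 : ℂ), MvPolynomial.eval (c t) q ≠ 0 :=
        hqd.continuousAt.eventually_ne (by rwa [hc0])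
      -- Along the curve the polynomial is the test function minus κ, times q², so vanishing of its
      -- derivative at 0 is vanishing of the derivative of the test function.
      have heq : ∀ᶠ t in nhds (0 : ℂ), MvPolynomial.eval (c t) ((p - MvPolynomial.C κ * q) * q) =
          (crossRatioSum i j k (testPolynomial i j k r ψ m) (fun k => r k + t * δ k) - κ) *
            MvPolynomial.eval (c t) q ^ 2 := by
        filter_upwards [hev, hqe] with t ht htq
        obtain ⟨hu, hm', hval⟩ := ht
        have h2 := hNE (c t) hu hm' (by rwa [hq])
        rw [hval, hp, hq, eq_div_iff htq] at h2
        rw [map_mul, map_sub, map_mul, MvPolynomial.eval_C, ← h2]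
        ring
      have hd' := ((hF.sub_const κ).fun_mul (hqd.fun_pow 2)).congr_of_eventuallyEq heq
      have hκ0 : crossRatioSum i j k (testPolynomial i j k r ψ m) (fun k => r k + 0 * δ k) = κ := by
        have h3 := heq.self_of_nhds
        rw [hc0, hvan _ (by simpa using mem_cone_of_smul_rep x one_ne_zero), eq_comm,
          mul_eq_zero] at h3
        exact sub_eq_zero.1 (h3.resolve_right (pow_ne_zero 2 hq0))
      have h4 := hd'.unique hd
      rw [hκ0, sub_self, zero_mul, add_zero, hc0] at h4
      have h5 := (mul_eq_zero.1 h4).resolve_right (pow_ne_zero 2 hq0)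
      rw [div_eq_zero_iff] at h5
      refine h5.resolve_right (pow_ne_zero 2 (mul_ne_zero ?_ ?_))
      · exact _root_.sub_ne_zero.2 (hc.injective.ne hm)
      · exact _root_.sub_ne_zero.2 (hc.injective.ne hij.symm))
  refine ⟨![A, B, C], s, ?_⟩
  congr 2
  exact funext fun p => by simp [quadraticValues, hABC]

/-- The affine tangent space is parametrized by the three coefficients of a quadratic polynomial and
the radial coefficient; dividing by the line of the point leaves three dimensions. -/
theorem finrank_tangentAt_moduliFiber (hc : IsChart φ₁ φ₂ x b l r) :
    Module.finrank ℂ (TangentAt (moduliFiber (quadricIntersection φ₁ φ₂) x) x.1) = 3 := by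
  have hself : x.1.rep ∈ affineTangent (moduliFiber (quadricIntersection φ₁ φ₂) x) x.1.rep := by
    obtain ⟨c, hc0, hcd, hcF⟩ := exists_radial_curve x
    have := mem_affineTangent_of_curve hcd hcF
    rwa [hc0] at this
  have hmem : ∀ a, rootMotion b l r x.1.rep (quadraticValues r a) ∈
      affineTangent (moduliFiber (quadricIntersection φ₁ φ₂) x) x.1.rep := by
    intro a
    obtain ⟨c, s, hca, hc0, hcd, hcF⟩ := hc.exists_fiber_curve a
    have := mem_affineTangent_of_curve hcd hcF
    rw [hc0] at this
    exact (Submodule.add_mem_iff_left _ (Submodule.smul_mem _ s hself)).1 this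
  let f : (Fin 3 → ℂ) × ℂ →ₗ[ℂ] affineTangent (moduliFiber (quadricIntersection φ₁ φ₂) x) x.1.rep :=
    LinearMap.coprod
      (LinearMap.codRestrict _ (rootMotion b l r x.1.rep ∘ₗ quadraticValues r) hmem)
      (LinearMap.toSpanSingleton ℂ _ ⟨x.1.rep, hself⟩)
  have hf : ∀ p, (f p : Fin (n + 3) → ℂ) =
      rootMotion b l r x.1.rep (quadraticValues r p.1) + p.2 • x.1.rep := by
    intro p
    simp [f]
  have hbij : Function.Bijective f := by
    constructor
    · rw [← LinearMap.ker_eq_bot, LinearMap.ker_eq_bot']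
      rintro ⟨a, s⟩ h
      have h1 := hf (a, s)
      rw [h] at h1
      have h2 : rootMotion b l r x.1.rep (quadraticValues r a) = (-s) • x.1.rep := by
        rw [neg_smul]
        exact eq_neg_of_add_eq_zero_left h1.symm
      have hδ := hc.rootMotion_eq_smul h2
      rw [hδ, map_zero, eq_comm, smul_eq_zero, neg_eq_zero] at h2
      have ha : a = 0 := quadraticValues_injective hc.three_le hc.injective (by rw [hδ, map_zero])
      rw [ha, h2.resolve_right x.1.rep_nonzero]
      rfl
    · rintro ⟨w, hw⟩
      obtain ⟨a, s, rfl⟩ := hc.exists_quadratic_of_mem_affineTangent hw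
      exact ⟨(a, s), Subtype.ext (hf (a, s))⟩
  have h1 := (LinearEquiv.ofBijective f hbij).finrank_eq
  have h2 := finrank_tangentAt_add_one hself
  rw [← h1] at h2
  simp at h2
  omega

theorem isSmoothAt_moduliFiber (hc : IsChart φ₁ φ₂ x b l r) :
    IsSmoothAt (moduliFiber (quadricIntersection φ₁ φ₂) x) ⟨x.1, mem_moduliFiber _ x⟩ := by
  rw [IsSmoothAt, localDimension_eq_of_isOfPureDimension hc.topologicalKrullDim_eq_three]
  have := hc.finrank_tangentAt_moduliFiber
  dsimp only
  rw [this]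

theorem exists_kernel (hc : IsChart φ₁ φ₂ x b l r) :
    ∃ K : Submodule ℂ (TangentAt (quadricIntersection φ₁ φ₂) x.1),
      (K : Set (TangentAt (quadricIntersection φ₁ φ₂) x.1)) =
        kernelOfDifferential (quadricIntersection φ₁ φ₂) x ∧ Module.finrank ℂ K = 3 := by
  have hself := self_mem_affineTangent hc.nonsingular (rep_mem_cone x.2.1)
  let f : (Fin 3 → ℂ) →ₗ[ℂ] TangentAt (quadricIntersection φ₁ φ₂) x.1 :=
    Submodule.mkQ _ ∘ₗ LinearMap.codRestrict _ (rootMotion b l r x.1.rep) hc.rootMotion_mem ∘ₗ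
      quadraticValues r
  have hf : ∀ a, f a = tangentClass _ x.1 ⟨_, hc.rootMotion_mem (quadraticValues r a)⟩ :=
    fun a => rfl
  refine ⟨LinearMap.range f, ?_, ?_⟩
  · ext w
    constructor
    · rintro ⟨a, rfl⟩
      rw [hf]
      exact hc.mem_kernel_of_quadratic a
    · intro hw
      obtain ⟨w, rfl⟩ := Submodule.Quotient.mk_surjective _ w
      obtain ⟨δ, s, hδ⟩ := hc.exists_rootMotion_eq w.2
      have hcl : tangentClass _ x.1 w = tangentClass _ x.1 ⟨_, hc.rootMotion_mem δ⟩ := by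
        rw [← sub_eq_zero]
        refine (tangentClass_eq_zero_iff (w - ⟨_, hc.rootMotion_mem δ⟩)).2 ⟨s, ?_⟩
        rw [Submodule.coe_sub, hδ, add_sub_cancel_left]
      change tangentClass _ x.1 w ∈ _ at hw
      change tangentClass _ x.1 w ∈ _
      rw [hcl] at hw ⊢
      obtain ⟨a, rfl⟩ := hc.quadratic_of_mem_kernel hw
      exact ⟨a, hf a⟩
  · rw [LinearMap.finrank_range_of_inj, Module.finrank_fin_fun]
    rw [← LinearMap.ker_eq_bot, LinearMap.ker_eq_bot']
    intro a ha
    rw [hf] at ha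
    obtain ⟨s, hs⟩ := (tangentClass_eq_zero_iff _).1 ha
    exact quadraticValues_injective hc.three_le hc.injective
      (by rw [hc.rootMotion_eq_smul hs, map_zero])

end IsChart

end Kernel

end QuadricPencil

end

theorem propositionp (n : ℕ) (hn : 3 ≤ n)
    (φ₁ φ₂ : QuadraticForm ℂ (Fin (n + 3) → ℂ))
    (hφ₁ : ¬ QuadricPencil.IsDegenerate φ₁) (hφ₂ : ¬ QuadricPencil.IsDegenerate φ₂)
    (hX : QuadricPencil.IsNonsingularIntersection φ₁ φ₂)
    (X : Set (Projectivization ℂ (Fin (n + 3) → ℂ)))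
    (hXdef : X = QuadricPencil.quadricIntersection φ₁ φ₂)
    (x : QuadricPencil.nonsingularLocus X)
    (hx : QuadricPencil.IsRegularPoint φ₁ φ₂ x.1) :
    QuadricPencil.IsOfPureDimension (QuadricPencil.moduliFiber X x) 3 ∧
    QuadricPencil.IsSmoothAt (QuadricPencil.moduliFiber X x)
      ⟨x.1, QuadricPencil.mem_moduliFiber X x⟩ ∧
    ∃ K : Submodule ℂ (QuadricPencil.TangentAt X x.1),
      (K : Set (QuadricPencil.TangentAt X x.1)) = QuadricPencil.kernelOfDifferential X x ∧
      Module.finrank ℂ K = 3 := by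
  subst hXdef
  obtain ⟨b, l, r, hc⟩ := hx.exists_isChart hn hX
  exact ⟨hc.topologicalKrullDim_eq_three, hc.isSmoothAt_moduliFiber, hc.exists_kernel⟩
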